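/- Let $\mathcal G=(G,\mathcal L)$ be a labeled graph: $G$ is a finite directed graph (loops and multiple edges allowed) with non-empty vertex set $\mathcal V$ and edge set $\mathcal E$, every edge $\xi$ has an initial vertex $i(\xi)$, a terminal vertex $t(\xi)$ and a label $\mathcal L(\xi)$ in a finite alphabet $\mathcal S$. Assume that $\mathcal G$ is irreducible (for all vertices $i,j$ there is a path of positive length from $i$ to $j$) and right-resolving (edges starting at the same vertex have different labels). Let $X_G\subset\mathcal E^{\mathbb Z}$ be the edge shift of $G$ (all $\xi$ with $t(\xi_n)=i(\xi_{n+1})$ for all $n$), let $\mathcal L_\infty\colon (\xi_n)_n\mapsto(\mathcal L(\xi_n))_n$, and let $X_{\mathcal G}=\mathcal L_\infty(X_G)\subset\mathcal S^{\mathbb Z}$ be the sofic shift presented by $\mathcal G$, with shift map $\sigma$. Let $\mathcal B_n$ be the set of words of length $n$ that occur in $X_{\mathcal G}$, and for a word $w$ of length $n$ let $C_{k,l}(w)$ be the set of words in $\mathcal B_{k+n+l}$ whose letters in positions $k+1,\dots,k+n$ form $w$. Let $\mathbb A_s$ be the $0$-$1$ matrix on $\mathcal V$ with $(\mathbb A_s)_{ij}=1$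 exactly if some edge from $i$ to $j$ has label $s$, let $\mathbb A=\sum_{s\in\mathcal S}\mathbb A_s$, and let $p\ge1$ be the period of $G$. Let $\lambda$ be the Perron value of $\mathbb A$, i.e. its non-negative eigenvalue such that no complex eigenvalue has larger absolute value, and let $U=(u_i)$ and $V=(v_i)$ be left and right eigenvectors of $\mathbb A$ for $\lambda$ with $UV=\sum_iu_iv_i=1$ (such $\lambda,U,V$ exist). Then there is a Borel probability measure $\mu$ on $X_{\mathcal G}$, the natural measure, such that for every word $w=s_{i_1}\cdots s_{i_n}$ over $\mathcal S$ the $\mu$-measure $\mu[w]$ of the cylinder of $w$ at any initial site is $$\mu[w]=\lim_{k,l\to\infty}\frac1p\sum_{j=0}^{p-1}\frac{|C_{k-j,l+j}(w)|}{|\mathcal B_{n+k+l}|} =\frac1{\lambda^n}\sum_{i,j}u_i(\mathbb A_{s_{i_1}}\cdots\mathbb A_{s_{i_n}})_{ij}v_j ;$$ in particular $\mu[w]=\lim_{k,l\to\infty}|C_{k,l}(w)|/|\mathcal B_{n+k+l}|$ if $G$ is aperiodic, that is, if some power of its adjacency matrix is strictly positive. Here $k,l\to\infty$ independently. Moreover: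 1. $\mu=(\mathcal L_\infty)_*\nu$, where $\nu$ is the Parry measure of $X_G$. Here $X_G$ is regarded as the shift of finite type $\Sigma(B)$ with $B_{ef}=1$ if $t(e)=i(f)$ and $B_{ef}=0$ otherwise, and the Parry measure of $\Sigma(B)$ is the probability measure with $\nu[e_1\cdots e_n]=\rho^{-(n-1)}x_{e_1}y_{e_n}\prod_{r=1}^{n-1}B_{e_re_{r+1}}$ on cylinders, where $\rho$ is the Perron value of $B$ and $x,y$ are left and right eigenvectors for $\rho$ with $\sum_ex_ey_e=1$. 2. $\mu$ is the unique ergodic $\sigma$-invariant Borel probability measure of maximal entropy on $X_{\mathcal G}$: it is ergodic, its measure-theoretic entropy equals the topological entropy $\lim_n\frac1n\log|\mathcal B_n|$, and no other ergodic measure has this entropy. 3. If $G$ is aperiodic, then $\mu$ is strongly mixing: $\mu(\sigma^{-n}E\cap F)\to\mu(E)\mu(F)$ for all Borel sets $E,F\subset X_{\mathcal G}$. -/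

import Mathlib

open Filter Topology MeasureTheory
open scoped Matrix

noncomputable section

/-! ### Shift spaces, words and cylinders -/

namespace ShiftSpace

variable {S : Type*}

/-- The shift map `(σ x)_n = x_{n+1}` restricted to a shift-invariant set `X ⊆ S^ℤ`. -/
def shiftMap (X : Set (ℤ → S))
    (hX : Set.MapsTo (SymbolicDynamics.FullShift.shift (1 : ℤ)) X X) : X → X :=
  hX.restrict (SymbolicDynamics.FullShift.shift (1 : ℤ)) X X

/-- The cylinder `{x ∈ X | x_α = w_1, …, x_{α+n-1} = w_n}`. -/
def cylinder (X : Set (ℤ → S)) (α : ℤ) {n : ℕ} (w : Fin n → S) : Set X :=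
  {x | ∀ i : Fin n, x.1 (α + (i : ℤ)) = w i}

/-- `B_n(X)`: the words of length `n` that occur in some point of `X`. -/
def blocks (X : Set (ℤ → S)) (n : ℕ) : Set (Fin n → S) :=
  {w | ∃ α : ℤ, (cylinder X α w).Nonempty}

/-- `C_{k,l}(w)`: the words `x ∈ B_{k+n+l}(X)` in which the first `k` letters are followed
by `w`. -/
def blocksThrough (X : Set (ℤ → S)) {n : ℕ} (w : Fin n → S) (k l : ℕ) :
    Set (Fin (k + n + l) → S) :=
  {x | x ∈ blocks X (k + n + l) ∧ ∀ j : Fin n, x ⟨k + j, by omega⟩ = w j}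

/-- A probability measure `μ` on `X` is the natural measure, with averaging over `p` successive
windows, if for every word `w` and every initial site `α` the ratios
`(1/p) ∑_{j<p} |C_{k-j,l+j}(w)| / |B_{n+k+l}(X)|` converge, as `k, l → ∞` independently, to the
`μ`-measure of the cylinder of `w`. For `p = 1` this is the limit of
`|C_{k,l}(w)| / |B_{n+k+l}(X)|`. (The truncated subtraction `k - j` is the true one
for `k ≥ p`, so it does not affect the limit.) -/
structure IsNaturalMeasure [MeasurableSpace S] (X : Set (ℤ → S)) (p : ℕ) (μ : Measure X) :
    Prop where
  isProbabilityMeasure : IsProbabilityMeasure μ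
  tendsto : ∀ (n : ℕ) (w : Fin n → S) (α : ℤ),
    Tendsto (fun kl : ℕ × ℕ => (1 / (p : ℝ)) * ∑ j ∈ Finset.range p,
        ((blocksThrough X w (kl.1 - j) (kl.2 + j)).ncard : ℝ) /
          ((blocks X (n + kl.1 + kl.2)).ncard : ℝ))
      (atTop ×ˢ atTop) (𝓝 (μ.real (cylinder X α w)))

/-- The topological entropy `h(X) = lim (1/n) log |B_n(X)|` of a shift space. -/
def topEntropy (X : Set (ℤ → S)) : EReal :=
  limsup (fun n : ℕ => ((1 / (n : ℝ) * Real.log ((blocks X n).ncard : ℝ) : ℝ) : EReal)) atTop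

end ShiftSpace

/-! ### Entropy and mixing of measure-preserving maps -/

namespace MeasurePreservingMap

variable {Ω : Type*} [MeasurableSpace Ω]

/-- The entropy `H_m` of the `n`-fold join of `T^{-i} ξ`, `0 ≤ i < n`, where `ξ` is the finite
partition of `Ω` into the level sets of `f : Ω → Fin k`. -/
def joinEntropy (T : Ω → Ω) (m : Measure Ω) {k : ℕ} (f : Ω → Fin k) (n : ℕ) : ℝ :=
  ∑ c : Fin n → Fin k, Real.negMulLog (m.real {x | ∀ i : Fin n, f (T^[i] x) = c i})

/-- The entropy `h_m(T)`: the supremum over all finite measurable partitions of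
`lim (1/n) H_m(⋁_{i<n} T^{-i} ξ)`. -/
def entropy (T : Ω → Ω) (m : Measure Ω) : EReal :=
  ⨆ (k : ℕ) (f : Ω → Fin k) (_ : Measurable f),
    limsup (fun n : ℕ => ((1 / (n : ℝ) * joinEntropy T m f n : ℝ) : EReal)) atTop

/-- Strong mixing: `m(T^{-n} E ∩ F) → m(E) m(F)` for all measurable `E` and `F`. -/
def IsStrongMixing (T : Ω → Ω) (m : Measure Ω) : Prop :=
  MeasurePreserving T m m ∧ ∀ E F : Set Ω, MeasurableSet E → MeasurableSet F →
    Tendsto (fun n : ℕ => m ((T^[n] ⁻¹' E) ∩ F)) atTop (𝓝 (m E * m F))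

end MeasurePreservingMap

/-! ### Non-negative matrices, shifts of finite type and the Parry measure -/

namespace PerronFrobenius

variable {ι : Type*} [Fintype ι] [DecidableEq ι]

/-- `lam` is the Perron value of `A` (a non-negative eigenvalue such that no complex eigenvalue
has larger absolute value), `u` and `v` are left and right eigenvectors for `lam`,
and `u v = 1`. -/
structure IsPerronTriple (A : Matrix ι ι ℝ) (lam : ℝ) (u v : ι → ℝ) : Prop where
  nonneg : 0 ≤ lam
  norm_le : ∀ z : ℂ,
    Module.End.HasEigenvalue (Matrix.toLin' (A.map (fun a : ℝ => (a : ℂ)))) z → ‖z‖ ≤ lam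
  left_eigen : u ᵥ* A = lam • u
  right_eigen : A *ᵥ v = lam • v
  normalized : u ⬝ᵥ v = 1

/-- The period of a non-negative matrix: the greatest common divisor of all `n ≥ 1` for which
`A ^ n` has a positive diagonal entry. -/
def period (A : Matrix ι ι ℝ) : ℕ :=
  sSup {d : ℕ | ∀ n : ℕ, 0 < n → ∀ i : ι, 0 < (A ^ n) i i → d ∣ n}

/-- The shift of finite type `Σ(A)` of a `0`-`1` matrix `A`. -/
def sft (A : Matrix ι ι ℝ) : Set (ℤ → ι) :=
  {x | ∀ n : ℤ, A (x n) (x (n + 1)) = 1}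

/-- The Parry measure of `Σ(A)`: the probability measure with
`m[i_1, …, i_n] = u_{i_1} v_{i_n} λ^{-(n-1)} a_{i_1 i_2} ⋯ a_{i_{n-1} i_n}`, where `λ` is the
Perron value with left and right eigenvectors `u`, `v`, normalized by `u v = 1`. -/
def IsParryMeasure [MeasurableSpace ι] (A : Matrix ι ι ℝ) (m : Measure (sft A)) : Prop :=
  IsProbabilityMeasure m ∧ ∃ (lam : ℝ) (u v : ι → ℝ), IsPerronTriple A lam u v ∧
    ∀ (n : ℕ) (w : Fin (n + 1) → ι) (α : ℤ),
      m.real (ShiftSpace.cylinder (sft A) α w) =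
        u (w 0) * v (w (Fin.last n)) / lam ^ n *
          ∏ i : Fin n, A (w i.castSucc) (w i.succ)

end PerronFrobenius

/-! ### Labeled graphs and sofic shifts -/

/-- A labeled graph with vertex set `V`, edge set `E` and alphabet `S`: each edge has an initial
vertex, a terminal vertex and a label. Multiple edges and loops are allowed. -/
structure LabeledGraph (V E S : Type*) where
  src : E → V
  tgt : E → V
  label : E → S

namespace LabeledGraph

variable {V E S : Type*} (G : LabeledGraph V E S)

/-- Edges that start at the same vertex carry different labels. -/
def RightResolving : Prop :=
  ∀ e e' : E, G.src e = G.src e' → G.label e = G.label e' → e = e'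

/-- The adjacency matrix `A_G` of the underlying graph: `A_{i,j}` is the number of edges from
`i` to `j`. -/
def adjMatrix : Matrix V V ℝ :=
  fun i j => (Nat.card {e : E // G.src e = i ∧ G.tgt e = j} : ℝ)

open Classical in
/-- The `0`-`1` matrix `𝔸_s`: its `(i,j)` entry is `1` if some edge from `i` to `j` has
label `s`. -/
def symbolMatrix (s : S) : Matrix V V ℝ :=
  fun i j => if ∃ e : E, G.src e = i ∧ G.tgt e = j ∧ G.label e = s then 1 else 0

/-- The total matrix `𝔸 = ∑_s 𝔸_s`. -/
def totalMatrix [Fintype S] : Matrix V V ℝ := ∑ s : S, G.symbolMatrix s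

/-- The graph is irreducible: for all `i, j` there is `n ≥ 1` with `(A_G ^ n)_{i,j} > 0`. -/
def Irreducible : Prop := G.adjMatrix.IsIrreducible

open Classical in
/-- The `0`-`1` matrix on edges describing which edge may follow which. -/
def edgeMatrix : Matrix E E ℝ :=
  fun e f => if G.tgt e = G.src f then 1 else 0

/-- The edge shift `X_G`, as the shift of finite type of the edge matrix. -/
def edgeShift [Fintype E] [DecidableEq E] : Set (ℤ → E) := PerronFrobenius.sft G.edgeMatrix

theorem mem_edgeShift_iff [Fintype E] [DecidableEq E] (ξ : ℤ → E) :
    ξ ∈ G.edgeShift ↔ ∀ n : ℤ, G.tgt (ξ n) = G.src (ξ (n + 1)) := by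
  simp [edgeShift, PerronFrobenius.sft, edgeMatrix]

/-- The sofic shift `X_𝒢`: all label sequences of bi-infinite walks on the graph. -/
def soficShift [Fintype E] [DecidableEq E] : Set (ℤ → S) :=
  {x | ∃ ξ ∈ G.edgeShift, (fun n => G.label (ξ n)) = x}

theorem mapsTo_shift_soficShift [Fintype E] [DecidableEq E] :
    Set.MapsTo (SymbolicDynamics.FullShift.shift (1 : ℤ)) G.soficShift G.soficShift := by
  rintro _ ⟨ξ, hξ, rfl⟩
  refine ⟨fun n => ξ (1 + n), ?_, rfl⟩
  rw [mem_edgeShift_iff] at hξ ⊢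
  intro n
  have h := hξ (1 + n)
  rwa [add_assoc] at h

/-- The shift map on the sofic shift. -/
def soficMap [Fintype E] [DecidableEq E] : G.soficShift → G.soficShift :=
  ShiftSpace.shiftMap G.soficShift G.mapsTo_shift_soficShift

/-- The one-block factor map `L_∞ : X_G → X_𝒢`. -/
def labelMap [Fintype E] [DecidableEq E] : G.edgeShift → G.soficShift :=
  fun ξ => ⟨fun n => G.label (ξ.1 n), ξ.1, ξ.2, rfl⟩

end LabeledGraph

end

noncomputable section

/-! ### Perron–Frobenius theory of irreducible matrices -/

namespace PerronFrobenius

variable {ι : Type*} [Fintype ι]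

/-! Let A be the adjacency matrix and p its period. By right-resolvingness A is the sum of the A_s,
and each A_s, hence each product A_w, is the matrix of a partial map of the vertices.
Perron–Frobenius theory gives λ > 0 with positive eigenvectors u, v, and a Doeblin contraction shows
that the powers of Q = A/λ approach a p-periodic sequence of matrices that have rank one between
cyclic classes (`IsCyclicChain.tendsto_pow_sub_cyclicLimit`).

Construction. Put a matrix unit E_e on each edge. By the eigenvector equations the weights λ^{-n} u
E_{e_1}⋯E_{e_n} v are consistent under extension on both sides, so by compactness they come from a
measure on edge sequences, which is the Parry measure. Its image μ under the labels gives the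
cylinder of w the mass λ^{-n} u A_w v. Since A_w is a 0-1 matrix, this mass lies between b λ^{-n}
and C λ^{-n} when A_w ≠ 0, that is, when w occurs in the shift, and vanishes otherwise. These Gibbs
bounds and the convergence of Q^n carry the rest; `IsPerronPresentation` collects what is needed.

Mixing. Summing out a gap of length g between two cylinders produces Q^g, so correlations averaged
over p successive times converge to the product of the masses. This gives ergodicity, and strong
mixing when p = 1.

Counting. Powers of A count paths, whereas the natural measure counts words, and a word may have
many paths. A magic word y is one for which A_y has the least possible number of non-zero columns. A
continuation b of y is then admissible either from all terminal vertices of y or from none, so that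
counting admissible b is counting paths from these vertices, divided by their number
(`IsMagicWord.wordIndicator_append`). By ergodicity and the lower Gibbs bound, words whose first K
letters are not magic form a proportion tending to 0 as K grows, uniformly in the total length.
Hence |C_{k-j,l+j}(w)| and |B_N| are, up to a small error, pairings of one fixed vector with
products of powers of Q, and the convergence of Q^n yields the limit of the ratios.

Maximal entropy. The Gibbs bounds make both the topological entropy and the entropy of μ equal to
log λ. If an invariant m has entropy log λ, subadditivity gives all n-block entropies of m the lower
bound n log λ. Were m to charge a μ-null set, the Gibbs inequality against a version of μ tilted
towards a small neighbourhood of that set would violate this bound. So m is absolutely continuous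
with respect to the ergodic measure μ, whence m = μ. -/

theorem mulVec_pos_of_pos {Q : Matrix ι ι ℝ} (hQ : ∀ i j, 0 < Q i j) {x : ι → ℝ}
    (hx : ∀ i, 0 ≤ x i) (hne : x ≠ 0) (i : ι) : 0 < (Q *ᵥ x) i := by
  obtain ⟨j, hj⟩ := Function.ne_iff.1 hne
  exact Finset.sum_pos' (fun m _ => mul_nonneg (hQ i m).le (hx m))
    ⟨j, Finset.mem_univ _, mul_pos (hQ i j) (lt_of_le_of_ne (hx j) (Ne.symm hj))⟩

variable [DecidableEq ι]

/-- For a periodic matrix no single power is positive, but a sum of powers with one exponent for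
each pair of indices is. Such a sum commutes with A and acts on eigenvectors by scalars. Positivity
of the exponents is what later excludes the eigenvalue 0. -/
theorem exists_pos_commute {A : Matrix ι ι ℝ} (hA : A.IsIrreducible) :
    ∃ s : Finset ℕ, (∀ k ∈ s, 0 < k) ∧ ∀ i j, 0 < (∑ k ∈ s, A ^ k) i j := by
  have h := (Matrix.isIrreducible_iff_exists_pow_pos hA.nonneg).1 hA
  choose k hk hpos using h
  refine ⟨Finset.univ.image fun q : ι × ι => k q.1 q.2, ?_, ?_⟩
  · intro m hm
    obtain ⟨q, -, rfl⟩ := Finset.mem_image.1 hm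
    exact hk _ _
  · intro i j
    rw [Matrix.sum_apply]
    refine Finset.sum_pos' (fun m _ => Matrix.pow_apply_nonneg hA.nonneg m i j)
      ⟨k i j, Finset.mem_image.2 ⟨(i, j), Finset.mem_univ _, rfl⟩, hpos i j⟩

theorem pow_mulVec_eigen {A : Matrix ι ι ℝ} {t : ℝ} {v : ι → ℝ} (h : A *ᵥ v = t • v) (k : ℕ) :
    (A ^ k) *ᵥ v = t ^ k • v := by
  induction k with
  | zero => simp
  | succ k ih => rw [pow_succ, ← Matrix.mulVec_mulVec, h, Matrix.mulVec_smul, ih, smul_smul, pow_succ,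
      mul_comm]

theorem sum_pow_mulVec_eigen {A : Matrix ι ι ℝ} {t : ℝ} {v : ι → ℝ} (h : A *ᵥ v = t • v)
    (s : Finset ℕ) : (∑ k ∈ s, A ^ k) *ᵥ v = (∑ k ∈ s, t ^ k) • v := by
  rw [Matrix.sum_mulVec, Finset.sum_smul]
  exact Finset.sum_congr rfl fun k _ => pow_mulVec_eigen h k

/-- An irreducible matrix has a positive right eigenvector with positive eigenvalue. -/
theorem exists_pos_right_eigenvector [Nonempty ι] {A : Matrix ι ι ℝ} (hA : A.IsIrreducible) :
    ∃ (t : ℝ) (v : ι → ℝ), 0 < t ∧ (∀ i, 0 < v i) ∧ A *ᵥ v = t • v := by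
  obtain ⟨s, hs, hQ⟩ := exists_pos_commute hA
  set Q := ∑ k ∈ s, A ^ k with hQdef
  have hcomm : A * Q = Q * A := by
    rw [hQdef, Finset.mul_sum, Finset.sum_mul]
    exact Finset.sum_congr rfl fun k _ => by rw [← pow_succ, ← pow_succ']
  let C : ℝ := ∑ i, ∑ j, A i j
  -- Collatz–Wielandt: maximize t over pairs (t, x) with x in the simplex and t x ≤ A x. The total
  -- of the entries of A bounds t, which makes this set compact.
  let K : Set (ℝ × (ι → ℝ)) :=
    {q | q ∈ Set.Icc 0 C ×ˢ stdSimplex ℝ ι ∧ ∀ i, q.1 * q.2 i ≤ (A *ᵥ q.2) i}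
  have hbound : ∀ (t : ℝ) (x : ι → ℝ), x ∈ stdSimplex ℝ ι → (∀ i, t * x i ≤ (A *ᵥ x) i) →
      t ≤ C := by
    intro t x hx h
    calc t = ∑ i, t * x i := by rw [← Finset.mul_sum, hx.2, mul_one]
      _ ≤ ∑ i, (A *ᵥ x) i := Finset.sum_le_sum fun i _ => h i
      _ ≤ C := Finset.sum_le_sum fun i _ => Finset.sum_le_sum fun j _ =>
        mul_le_of_le_one_right (hA.nonneg i j)
          (hx.2 ▸ Finset.single_le_sum (fun m _ => hx.1 m) (Finset.mem_univ j))
  have hKc : IsCompact K := by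
    have h1 : IsCompact (Set.Icc 0 C ×ˢ stdSimplex ℝ ι) := isCompact_Icc.prod (isCompact_stdSimplex ℝ ι)
    have h2 : IsClosed {q : ℝ × (ι → ℝ) | ∀ i, q.1 * q.2 i ≤ (A *ᵥ q.2) i} := by
      rw [Set.ofPred_forall]
      refine isClosed_iInter fun i => isClosed_le (by fun_prop) ?_
      simp only [Matrix.mulVec, dotProduct]
      fun_prop
    exact h1.inter_right h2
  have hKne : K.Nonempty := by
    obtain ⟨x, hx⟩ : (stdSimplex ℝ ι).Nonempty :=
      ⟨_, single_mem_stdSimplex ℝ (Classical.arbitrary ι)⟩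
    have h0 : ∀ i, (0 : ℝ) * x i ≤ (A *ᵥ x) i := fun i => by
      rw [zero_mul]
      exact Finset.sum_nonneg fun j _ => mul_nonneg (hA.nonneg i j) (hx.1 j)
    exact ⟨(0, x), ⟨⟨le_rfl, hbound 0 x hx h0⟩, hx⟩, h0⟩
  obtain ⟨⟨t, x⟩, ⟨⟨⟨ht0, -⟩, hx⟩, hle⟩, hmax⟩ := hKc.exists_isMaxOn hKne continuous_fst.continuousOn
  simp only at ht0 hx hle
  have hxne : x ≠ 0 := by
    rintro rfl
    simpa using hx.2
  have hypos := mulVec_pos_of_pos hQ hx.1 hxne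
  -- If A x - t x were non-zero, applying the positive matrix Q would make the inequality strict in
  -- every coordinate, leaving room to enlarge t by ε.
  have heig : A *ᵥ x = t • x := by
    by_contra hne
    set z := A *ᵥ x - t • x with hz
    have hzpos := mulVec_pos_of_pos hQ (x := z)
      (fun i => by simpa [hz] using hle i) (sub_ne_zero.2 hne)
    set y := Q *ᵥ x with hy
    have hAy : A *ᵥ y = t • y + Q *ᵥ z := by
      rw [hz, Matrix.mulVec_sub, Matrix.mulVec_smul, hy, Matrix.mulVec_mulVec, Matrix.mulVec_mulVec,
        hcomm]
      abel
    obtain ⟨i₀, -, hi₀⟩ := Finset.exists_min_image Finset.univ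
      (fun i => (Q *ᵥ z) i / y i) Finset.univ_nonempty
    set ε := (Q *ᵥ z) i₀ / y i₀ with hε
    have hεpos : 0 < ε := div_pos (hzpos i₀) (hypos i₀)
    have hsum : 0 < ∑ i, y i := Finset.sum_pos (fun i _ => hypos i) Finset.univ_nonempty
    have hy' : (∑ i, y i)⁻¹ • y ∈ stdSimplex ℝ ι := by
      refine ⟨fun i => mul_nonneg (inv_nonneg.2 hsum.le) (hypos i).le, ?_⟩
      simp only [Pi.smul_apply, smul_eq_mul, ← Finset.mul_sum]
      exact inv_mul_cancel₀ hsum.ne'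
    have hle' : ∀ i, (t + ε) * ((∑ i, y i)⁻¹ • y) i ≤ (A *ᵥ ((∑ i, y i)⁻¹ • y)) i := by
      intro i
      rw [Matrix.mulVec_smul, hAy]
      have h1 : ε * y i ≤ (Q *ᵥ z) i := (le_div_iff₀ (hypos i)).1 (hi₀ i (Finset.mem_univ i))
      simp only [Pi.smul_apply, Pi.add_apply, smul_eq_mul]
      have h2 := mul_le_mul_of_nonneg_left h1 (inv_nonneg.2 hsum.le)
      linarith
    have := hmax (show (t + ε, (∑ i, y i)⁻¹ • y) ∈ K from
      ⟨⟨⟨by linarith, hbound _ _ hy' hle'⟩, hy'⟩, hle'⟩)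
    simp only [Set.mem_ofPred_eq] at this
    linarith
  have hQx := sum_pow_mulVec_eigen heig s
  rw [← hQdef] at hQx
  have hprod : ∀ i, 0 < (∑ k ∈ s, t ^ k) * x i := fun i => by
    have := hypos i
    rw [hQx] at this
    simpa using this
  have htpos : 0 < t := by
    refine lt_of_le_of_ne ht0 fun h => ?_
    have h0 : ∑ k ∈ s, t ^ k = 0 :=
      Finset.sum_eq_zero fun k hk => by rw [← h, zero_pow (hs k hk).ne']
    have := hprod (Classical.arbitrary ι)
    rw [h0, zero_mul] at this
    exact lt_irrefl _ this
  refine ⟨t, x, htpos, fun i => ?_, heig⟩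
  exact pos_of_mul_pos_right (hprod i) (Finset.sum_nonneg fun k _ => pow_nonneg ht0 k)

/-- The right eigenvectors of an irreducible matrix for the eigenvalue of a positive one are
multiples of it. -/
theorem eigenvector_unique [Nonempty ι] {A : Matrix ι ι ℝ} (hA : A.IsIrreducible) {t : ℝ}
    {v x : ι → ℝ} (hv : ∀ i, 0 < v i) (hAv : A *ᵥ v = t • v) (hAx : A *ᵥ x = t • x) :
    ∃ c : ℝ, x = c • v := by
  obtain ⟨s, -, hQ⟩ := exists_pos_commute hA
  -- Subtract the largest multiple of v that leaves a non-negative vector. The difference vanishes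
  -- at the minimizing index i₀, although a positive matrix would make a non-zero such eigenvector
  -- positive there.
  obtain ⟨i₀, -, hi₀⟩ := Finset.exists_min_image Finset.univ
    (fun i => x i / v i) Finset.univ_nonempty
  refine ⟨x i₀ / v i₀, ?_⟩
  rw [← sub_eq_zero]
  by_contra hne
  set y := x - (x i₀ / v i₀) • v with hy
  have hAy : A *ᵥ y = t • y := by
    rw [hy, Matrix.mulVec_sub, Matrix.mulVec_smul, hAx, hAv, smul_sub, smul_comm]
  have hpos := mulVec_pos_of_pos hQ (x := y) (fun i => by
    have := (le_div_iff₀ (hv i)).1 (hi₀ i (Finset.mem_univ i))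
    simpa [hy] using this) hne i₀
  rw [sum_pow_mulVec_eigen hAy] at hpos
  have : y i₀ = 0 := by simp [hy, (hv i₀).ne']
  simp [this] at hpos

/-- A positive left eigenvector bounds all complex eigenvalues of a non-negative matrix. -/
theorem norm_le_of_pos_left_eigenvector {A : Matrix ι ι ℝ} (hA : ∀ i j, 0 ≤ A i j) {t : ℝ}
    {u : ι → ℝ} (hu : ∀ i, 0 < u i) (huA : u ᵥ* A = t • u) (z : ℂ)
    (hz : Module.End.HasEigenvalue (Matrix.toLin' (A.map (fun a : ℝ => (a : ℂ)))) z) :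
    ‖z‖ ≤ t := by
  obtain ⟨x, hx⟩ := hz.exists_hasEigenvector
  have hxe := hx.apply_eq_smul
  have hxne := hx.2
  rw [Matrix.toLin'_apply] at hxe
  -- By the triangle inequality |x| is a subeigenvector for ‖z‖; pairing with the left eigenvector
  -- compares ‖z‖ with t.
  have h1 : ∀ i, ‖z‖ * ‖x i‖ ≤ (A *ᵥ fun j => ‖x j‖) i := by
    intro i
    rw [← norm_mul, ← smul_eq_mul, ← Pi.smul_apply, ← hxe]
    refine (norm_sum_le _ _).trans (Finset.sum_le_sum fun j _ => ?_)
    simp [abs_of_nonneg (hA i j)]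
  have h2 : ‖z‖ * (u ⬝ᵥ fun j => ‖x j‖) ≤ t * (u ⬝ᵥ fun j => ‖x j‖) := by
    calc ‖z‖ * (u ⬝ᵥ fun j => ‖x j‖) = ∑ i, u i * (‖z‖ * ‖x i‖) := by
          rw [dotProduct, Finset.mul_sum]
          exact Finset.sum_congr rfl fun i _ => by ring
      _ ≤ u ⬝ᵥ (A *ᵥ fun j => ‖x j‖) :=
          Finset.sum_le_sum fun i _ => mul_le_mul_of_nonneg_left (h1 i) (hu i).le
      _ = t * (u ⬝ᵥ fun j => ‖x j‖) := by
          rw [Matrix.dotProduct_mulVec, huA, smul_dotProduct, smul_eq_mul]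
  obtain ⟨j, hj⟩ := Function.ne_iff.1 hxne
  refine le_of_mul_le_mul_right h2 (Finset.sum_pos' (fun i _ => ?_) ⟨j, Finset.mem_univ _, ?_⟩)
  · exact mul_nonneg (hu i).le (norm_nonneg _)
  · exact mul_pos (hu j) (norm_pos_iff.2 hj)

/-- An irreducible matrix has a Perron triple with positive entries. -/
theorem exists_pos_perronTriple [Nonempty ι] {A : Matrix ι ι ℝ} (hA : A.IsIrreducible) :
    ∃ (lam : ℝ) (u v : ι → ℝ), 0 < lam ∧ (∀ i, 0 < u i) ∧ (∀ i, 0 < v i) ∧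
      IsPerronTriple A lam u v := by
  obtain ⟨t, v, ht, hv, hAv⟩ := exists_pos_right_eigenvector hA
  obtain ⟨t', u, -, hu, hAu⟩ := exists_pos_right_eigenvector hA.transpose
  rw [Matrix.mulVec_transpose] at hAu
  have hpos : 0 < u ⬝ᵥ v := Finset.sum_pos (fun i _ => mul_pos (hu i) (hv i)) Finset.univ_nonempty
  have htt : t' = t := by
    have h : u ⬝ᵥ (A *ᵥ v) = (u ᵥ* A) ⬝ᵥ v := Matrix.dotProduct_mulVec u A v
    rw [hAv, hAu, dotProduct_smul, smul_dotProduct, smul_eq_mul, smul_eq_mul] at h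
    exact (mul_right_cancel₀ hpos.ne' h).symm
  subst htt
  refine ⟨t', (u ⬝ᵥ v)⁻¹ • u, v, ht, fun i => mul_pos (inv_pos.2 hpos) (hu i), hv, ht.le,
    norm_le_of_pos_left_eigenvector hA.nonneg hu hAu, ?_, hAv, ?_⟩
  · rw [Matrix.smul_vecMul, hAu, smul_comm]
  · rw [smul_dotProduct, smul_eq_mul, inv_mul_cancel₀ hpos.ne']

theorem IsPerronTriple.hasEigenvalue {A : Matrix ι ι ℝ} {lam : ℝ} {u v : ι → ℝ}
    (h : IsPerronTriple A lam u v) :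
    Module.End.HasEigenvalue (Matrix.toLin' (A.map (fun a : ℝ => (a : ℂ)))) (lam : ℂ) := by
  have hv : v ≠ 0 := by
    rintro rfl
    simpa using h.normalized
  refine Module.End.hasEigenvalue_of_hasEigenvector (x := fun i => (v i : ℂ)) ⟨?_, ?_⟩
  · rw [Module.End.mem_eigenspace_iff, Matrix.toLin'_apply]
    ext i
    have := congrFun h.right_eigen i
    simp only [Matrix.mulVec, dotProduct, Pi.smul_apply, smul_eq_mul] at this
    simp only [Matrix.mulVec, dotProduct, Matrix.map_apply, Pi.smul_apply, smul_eq_mul]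
    exact_mod_cast this
  · intro h0
    exact hv (funext fun i => by simpa using congrFun h0 i)

/-- Perron triples of an irreducible matrix are unique up to scaling. -/
theorem IsPerronTriple.unique [Nonempty ι] {A : Matrix ι ι ℝ} (hA : A.IsIrreducible)
    {lam lam' : ℝ} {u v u' v' : ι → ℝ} (h : IsPerronTriple A lam u v) (hu : ∀ i, 0 < u i)
    (hv : ∀ i, 0 < v i) (h' : IsPerronTriple A lam' u' v') :
    lam' = lam ∧ ∀ i j, u' i * v' j = u i * v j := by
  -- Each of the two values is an eigenvalue bounded by the other. The normalizations then force the
  -- two scaling factors a, b below to satisfy ab = 1, so the products u_i v_j do not change.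
  have hlam : lam' = lam := by
    refine le_antisymm ?_ ?_
    · have := h.norm_le _ h'.hasEigenvalue
      rwa [Complex.norm_real, Real.norm_of_nonneg h'.nonneg] at this
    · have := h'.norm_le _ h.hasEigenvalue
      rwa [Complex.norm_real, Real.norm_of_nonneg h.nonneg] at this
  subst hlam
  obtain ⟨b, rfl⟩ := eigenvector_unique hA hv h.right_eigen h'.right_eigen
  obtain ⟨a, rfl⟩ := eigenvector_unique hA.transpose hu
    (by rw [Matrix.mulVec_transpose]; exact h.left_eigen)
    (by rw [Matrix.mulVec_transpose]; exact h'.left_eigen)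
  have hab := h'.normalized
  rw [smul_dotProduct, dotProduct_smul, h.normalized] at hab
  simp only [smul_eq_mul, mul_one] at hab
  refine ⟨rfl, fun i j => ?_⟩
  simp only [Pi.smul_apply, smul_eq_mul]
  linear_combination u i * v j * hab

end PerronFrobenius

end

noncomputable section

namespace PerronFrobenius

/-! ### Cyclic classes -/

section Cyclic

variable {ι : Type*} [Fintype ι] [DecidableEq ι]

theorem pow_add_pos {A : Matrix ι ι ℝ} (hA : ∀ i j, 0 ≤ A i j) {m n : ℕ} {i j k : ι}
    (h₁ : 0 < (A ^ m) i j) (h₂ : 0 < (A ^ n) j k) : 0 < (A ^ (m + n)) i k := by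
  rw [pow_add, Matrix.mul_apply]
  exact Finset.sum_pos' (fun l _ => mul_nonneg (Matrix.pow_apply_nonneg hA m i l)
    (Matrix.pow_apply_nonneg hA n l k)) ⟨j, Finset.mem_univ _, mul_pos h₁ h₂⟩

/-- A closed path through i can be inserted into a closed path from o through i. A common divisor of
the return times to o therefore divides all return times, so one vertex determines the period.
Positivity of the gcd bounds the set of common divisors, so the supremum is attained. -/
theorem period_eq_setGcd {A : Matrix ι ι ℝ} (hA : A.IsIrreducible) (o : ι) :
    period A = Nat.setGcd {n | 0 < n ∧ 0 < (A ^ n) o o} ∧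
      0 < Nat.setGcd {n | 0 < n ∧ 0 < (A ^ n) o o} := by
  have hpos := (Matrix.isIrreducible_iff_exists_pow_pos hA.nonneg).1 hA
  set s : Set ℕ := {n | 0 < n ∧ 0 < (A ^ n) o o} with hs
  have hg : 0 < Nat.setGcd s := by
    refine Nat.pos_of_ne_zero fun h => ?_
    obtain ⟨k, hk, hk'⟩ := hpos o o
    exact hk.ne' (Nat.setGcd_eq_zero_iff.1 h (show k ∈ s from ⟨hk, hk'⟩))
  refine ⟨?_, hg⟩
  have hD : {d : ℕ | ∀ n : ℕ, 0 < n → ∀ i : ι, 0 < (A ^ n) i i → d ∣ n} =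
      {d | d ∣ Nat.setGcd s} := by
    ext d
    simp only [Set.mem_ofPred_eq]
    constructor
    · intro h
      exact Nat.dvd_setGcd_iff.2 fun m hm => h m hm.1 o hm.2
    · intro h n hn i hi
      obtain ⟨a, ha, ha'⟩ := hpos o i
      obtain ⟨b, hb, hb'⟩ := hpos i o
      have h1 : d ∣ a + b := h.trans (Nat.setGcd_dvd_of_mem
        (show a + b ∈ s from ⟨by omega, pow_add_pos hA.nonneg ha' hb'⟩))
      have h2 : d ∣ (a + n) + b := h.trans (Nat.setGcd_dvd_of_mem
        (show (a + n) + b ∈ s from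
          ⟨by omega, pow_add_pos hA.nonneg (pow_add_pos hA.nonneg ha' hi) hb'⟩))
      have h3 : (a + n) + b = (a + b) + n := by ring
      rw [h3] at h2
      exact (Nat.dvd_add_right h1).1 h2
  rw [period, hD]
  exact IsGreatest.csSup_eq ⟨dvd_refl _, fun d hd => Nat.le_of_dvd hg hd⟩

theorem period_pos [Nonempty ι] {A : Matrix ι ι ℝ} (hA : A.IsIrreducible) : 0 < period A := by
  obtain ⟨h1, h2⟩ := period_eq_setGcd hA (Classical.arbitrary ι)
  rwa [h1]

/-- One step out of o followed by the positive power A^k gives a return time k + 1 besides k. -/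
theorem period_eq_one_of_isPrimitive [Nonempty ι] {A : Matrix ι ι ℝ} (hA : A.IsPrimitive) :
    period A = 1 := by
  have hirr := hA.isIrreducible
  have o := Classical.arbitrary ι
  obtain ⟨h1, -⟩ := period_eq_setGcd hirr o
  obtain ⟨k, hk, hpos⟩ := hA.exists_pos_pow
  rw [h1, ← Nat.dvd_one]
  obtain ⟨m, hm, hm'⟩ : ∃ m, 0 < m ∧ 0 < (A ^ (m + k)) o o ∧ m = 1 := by
    refine ⟨1, one_pos, ?_, rfl⟩
    obtain ⟨j, hj⟩ : ∃ j, 0 < A o j := by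
      by_contra! h
      have h0 : ∀ j, A o j = 0 := fun j => le_antisymm (h j) (hA.nonneg o j)
      obtain ⟨k', rfl⟩ : ∃ k', k = k' + 1 := ⟨k - 1, by omega⟩
      have := hpos o o
      rw [pow_succ', Matrix.mul_apply] at this
      simp [h0] at this
    exact pow_add_pos hA.nonneg (m := 1) (j := j) (by simpa using hj) (hpos j o)
  obtain ⟨hm', rfl⟩ := hm'
  have d1 := Nat.setGcd_dvd_of_mem (show k ∈ {n | 0 < n ∧ 0 < (A ^ n) o o} from ⟨hk, hpos o o⟩)
  have d2 := Nat.setGcd_dvd_of_mem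
    (show 1 + k ∈ {n | 0 < n ∧ 0 < (A ^ n) o o} from ⟨by omega, hm'⟩)
  exact (Nat.dvd_add_left d1).1 d2

/-- The cyclic classes of an irreducible matrix, indexed by residues modulo the period. -/
theorem exists_cyclicClass [Nonempty ι] {A : Matrix ι ι ℝ} (hA : A.IsIrreducible) :
    ∃ c : ι → ZMod (period A), (∀ i j, 0 < A i j → c j = c i + 1) ∧
      ∃ N : ℕ, ∀ n ≥ N, ∀ i j, c j = c i + n → 0 < (A ^ n) i j := by
  have hpos := (Matrix.isIrreducible_iff_exists_pow_pos hA.nonneg).1 hA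
  have o := Classical.arbitrary ι
  obtain ⟨hg, hg0⟩ := period_eq_setGcd hA o
  rw [hg]
  set s : Set ℕ := {n | 0 < n ∧ 0 < (A ^ n) o o} with hs
  have hz : ∀ n, n ∈ s → (n : ZMod (Nat.setGcd s)) = 0 := fun n hn =>
    (ZMod.natCast_eq_zero_iff _ _).2 (Nat.setGcd_dvd_of_mem hn)
  choose a ha ha' using hpos o
  choose b hb hb' using fun i => hpos i o
  -- All paths from o to i close up with the same return path, so their lengths agree modulo the
  -- gcd.
  have hab : ∀ i (m : ℕ), 0 < (A ^ m) o i → ((m : ZMod (Nat.setGcd s))) = -(b i : ZMod _) := by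
    intro i m hm
    have := hz (m + b i) ⟨by have := hb i; omega, pow_add_pos hA.nonneg hm (hb' i)⟩
    push_cast at this
    exact eq_neg_of_add_eq_zero_left this
  refine ⟨fun i => -(b i : ZMod _), fun i j hij => ?_, ?_⟩
  · simp only
    rw [← hab j (a i + 1) (pow_add_pos hA.nonneg (ha' i) (by simpa using hij)), ← hab i _ (ha' i)]
    push_cast
    rfl
  -- A path from i to j is assembled as i to o, loops at o, o to j. The return times generate all
  -- large multiples of their gcd, so a loop of the required length exists once n is large.
  · obtain ⟨N₀, hN₀⟩ := Nat.exists_mem_closure_of_ge s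
    have hcl : ∀ m ∈ AddSubmonoid.closure s, 0 < (A ^ m) o o := by
      intro m hm
      induction hm using AddSubmonoid.closure_induction with
      | mem x hx => exact hx.2
      | zero => simp
      | add x y _ _ hx hy => exact pow_add_pos hA.nonneg hx hy
    refine ⟨N₀ + ∑ i, b i + ∑ i, a i, fun n hn i j hij => ?_⟩
    have h1 : b i ≤ ∑ i, b i := Finset.single_le_sum (fun _ _ => Nat.zero_le _) (Finset.mem_univ i)
    have h2 : a j ≤ ∑ i, a i := Finset.single_le_sum (fun _ _ => Nat.zero_le _) (Finset.mem_univ j)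
    obtain ⟨m, rfl⟩ : ∃ m, n = b i + m + a j := ⟨n - b i - a j, by omega⟩
    refine pow_add_pos hA.nonneg (pow_add_pos hA.nonneg (hb' i) (hcl m (hN₀ m (by omega) ?_))) (ha' j)
    rw [← ZMod.natCast_eq_zero_iff]
    push_cast at hij
    rw [hab j _ (ha' j)] at hij
    linear_combination -hij

end Cyclic

/-! ### Convergence of the powers of a normalized irreducible matrix -/

section Convergence

variable {ι : Type*}

/-- A non-negative matrix with eigenvalue `1`, positive left and right eigenvectors `u`, `v`, and
cyclic classes `c`, of which sufficiently high powers are as positive as `c` permits. -/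
structure IsCyclicChain [Fintype ι] [DecidableEq ι] (Q : Matrix ι ι ℝ) (u v : ι → ℝ) (p : ℕ)
    (c : ι → ZMod p) : Prop where
  nonneg : ∀ i j, 0 ≤ Q i j
  left_pos : ∀ i, 0 < u i
  right_pos : ∀ i, 0 < v i
  left_eigen : u ᵥ* Q = u
  right_eigen : Q *ᵥ v = v
  normalized : u ⬝ᵥ v = 1
  step : ∀ i j, Q i j ≠ 0 → c j = c i + 1
  eventually_pos : ∃ N : ℕ, ∀ n ≥ N, ∀ i j, c j = c i + n → 0 < (Q ^ n) i j

/-- The limit of the powers of a cyclic chain along a residue class modulo the period. -/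
def cyclicLimit (u v : ι → ℝ) {p : ℕ} (c : ι → ZMod p) (r : ZMod p) : Matrix ι ι ℝ :=
  fun i j => if c j = c i + r then p * (v i * u j) else 0

theorem sum_range_ite_natCast_eq {p : ℕ} [NeZero p] (z : ZMod p) (x : ℝ) :
    ∑ j ∈ Finset.range p, (if (j : ZMod p) = z then x else 0) = x := by
  rw [Finset.sum_eq_single_of_mem z.val (Finset.mem_range.2 (ZMod.val_lt z))]
  · simp
  · intro b hb hne
    rw [if_neg]
    rintro rfl
    exact hne (ZMod.val_cast_of_lt (Finset.mem_range.1 hb)).symm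

variable [Fintype ι] [DecidableEq ι]

/-- P is an idempotent absorbed by X on both sides, so all mixed terms of the power collapse to P.
The exponent starts at 1, since the zeroth powers would give 1 against 1 - P. -/
theorem sub_pow_succ_of_absorbing {X P : Matrix ι ι ℝ} (h₁ : X * P = P) (h₂ : P * X = P)
    (h₃ : P * P = P) (k : ℕ) : (X - P) ^ (k + 1) = X ^ (k + 1) - P := by
  have hX : ∀ k, X ^ k * P = P := fun k => by
    induction k with
    | zero => simp
    | succ k ih => rw [pow_succ, mul_assoc, h₁, ih]
  induction k with
  | zero => simp
  | succ k ih =>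
    rw [pow_succ, ih, mul_sub, sub_mul, sub_mul, ← pow_succ, h₂, h₃, hX]
    abel

namespace IsCyclicChain

variable {Q : Matrix ι ι ℝ} {u v : ι → ℝ} {p : ℕ} {c : ι → ZMod p}

theorem pow_mulVec (h : IsCyclicChain Q u v p c) (n : ℕ) : (Q ^ n) *ᵥ v = v := by
  simpa using pow_mulVec_eigen (t := 1) (by simpa using h.right_eigen) n

theorem vecMul_pow (h : IsCyclicChain Q u v p c) (n : ℕ) : u ᵥ* (Q ^ n) = u := by
  have := pow_mulVec_eigen (A := Qᵀ) (t := 1) (v := u)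
    (by rw [Matrix.mulVec_transpose]; simpa using h.left_eigen) n
  rw [← Matrix.transpose_pow, Matrix.mulVec_transpose] at this
  simpa using this

theorem pow_nonneg (h : IsCyclicChain Q u v p c) (n : ℕ) (i j : ι) : 0 ≤ (Q ^ n) i j :=
  Matrix.pow_apply_nonneg h.nonneg n i j

/-- A single term of the fixed-point equation Q^n v = v bounds the entry, uniformly in n. -/
theorem pow_le (h : IsCyclicChain Q u v p c) (n : ℕ) (i j : ι) : (Q ^ n) i j ≤ v i / v j := by
  rw [le_div_iff₀ (h.right_pos j)]
  calc (Q ^ n) i j * v j ≤ ((Q ^ n) *ᵥ v) i :=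
        Finset.single_le_sum (f := fun j => (Q ^ n) i j * v j)
          (fun k _ => mul_nonneg (h.pow_nonneg n i k) (h.right_pos k).le) (Finset.mem_univ j)
    _ = v i := by rw [h.pow_mulVec]

theorem step_pow (h : IsCyclicChain Q u v p c) (n : ℕ) :
    ∀ i j, (Q ^ n) i j ≠ 0 → c j = c i + n := by
  induction n with
  | zero =>
    intro i j hij
    have : i = j := by
      by_contra hne
      exact hij (by simp [hne])
    simp [this]
  | succ n ih =>
    intro i j hij
    rw [pow_succ, Matrix.mul_apply] at hij
    obtain ⟨k, -, hk⟩ := Finset.exists_ne_zero_of_sum_ne_zero hij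
    rw [h.step k j (right_ne_zero_of_mul hk), ih i k (left_ne_zero_of_mul hk)]
    push_cast
    ring

/-- The flow u_i Q_ij v_j passes from class a to class a + 1 only. Summing it over i or over j shows
that consecutive classes have the same mass, and the p masses add up to 1. -/
theorem sum_class (h : IsCyclicChain Q u v p c) [NeZero p] (a : ZMod p) :
    ∑ i, (if c i = a then u i * v i else 0) = 1 / p := by
  have hstep : ∀ a : ZMod p, ∑ i, (if c i = a + 1 then u i * v i else 0) =
      ∑ i, (if c i = a then u i * v i else 0) := by
    intro a
    calc ∑ j, (if c j = a + 1 then u j * v j else 0)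
        = ∑ j, ∑ i, (if c j = a + 1 then u i * Q i j * v j else 0) := by
          refine Finset.sum_congr rfl fun j _ => ?_
          split_ifs
          · rw [← Finset.sum_mul]
            congr 1
            exact (congrFun h.left_eigen j).symm
          · simp
      _ = ∑ i, ∑ j, (if c i = a then u i * Q i j * v j else 0) := by
          rw [Finset.sum_comm]
          refine Finset.sum_congr rfl fun i _ => Finset.sum_congr rfl fun j _ => ?_
          by_cases hQ : Q i j = 0
          · simp [hQ]
          · rw [h.step i j hQ]
            simp
      _ = ∑ i, (if c i = a then u i * v i else 0) := by
          refine Finset.sum_congr rfl fun i _ => ?_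
          split_ifs
          · simp only [mul_assoc, ← Finset.mul_sum]
            congr 1
            exact congrFun h.right_eigen i
          · simp
  have hconst : ∀ n : ℕ, ∑ i, (if c i = (n : ZMod p) then u i * v i else 0) =
      ∑ i, (if c i = 0 then u i * v i else 0) := by
    intro n
    induction n with
    | zero => simp
    | succ n ih => rw [Nat.cast_succ, hstep, ih]
  have hall : ∀ b : ZMod p, ∑ i, (if c i = b then u i * v i else 0) =
      ∑ i, (if c i = 0 then u i * v i else 0) := fun b => by
    rw [← hconst b.val, ZMod.natCast_zmod_val]
  have htot : ∑ b : ZMod p, ∑ i, (if c i = b then u i * v i else 0) = 1 := by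
    rw [Finset.sum_comm]
    simpa [dotProduct] using h.normalized
  simp only [hall] at htot ⊢
  rw [Finset.sum_const, Finset.card_univ, ZMod.card, nsmul_eq_mul] at htot
  have hp : (p : ℝ) ≠ 0 := by exact_mod_cast NeZero.ne p
  field_simp
  linarith

theorem pow_mul_cyclicLimit (h : IsCyclicChain Q u v p c) (n : ℕ) (r : ZMod p) :
    Q ^ n * cyclicLimit u v c r = cyclicLimit u v c (n + r) := by
  ext i j
  rw [Matrix.mul_apply]
  calc ∑ k, (Q ^ n) i k * cyclicLimit u v c r k j
      = ∑ k, (if c j = c i + (n + r) then p * ((Q ^ n) i k * v k * u j) else 0) := by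
        refine Finset.sum_congr rfl fun k _ => ?_
        by_cases hQ : (Q ^ n) i k = 0
        · simp [hQ]
        · rw [cyclicLimit, h.step_pow n i k hQ, add_assoc]
          split_ifs <;> ring
    _ = cyclicLimit u v c (n + r) i j := by
        rw [cyclicLimit]
        split_ifs
        · rw [← Finset.mul_sum, ← Finset.sum_mul]
          congr 2
          exact congrFun (h.pow_mulVec n) i
        · simp

theorem cyclicLimit_mul_pow (h : IsCyclicChain Q u v p c) (n : ℕ) (r : ZMod p) :
    cyclicLimit u v c r * Q ^ n = cyclicLimit u v c (r + n) := by
  ext i j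
  rw [Matrix.mul_apply]
  calc ∑ k, cyclicLimit u v c r i k * (Q ^ n) k j
      = ∑ k, (if c j = c i + (r + n) then p * (v i * (u k * (Q ^ n) k j)) else 0) := by
        refine Finset.sum_congr rfl fun k _ => ?_
        by_cases hQ : (Q ^ n) k j = 0
        · simp [hQ]
        · rw [cyclicLimit, h.step_pow n k j hQ, ← add_assoc]
          simp only [add_left_inj]
          split_ifs <;> ring
    _ = cyclicLimit u v c (r + n) i j := by
        rw [cyclicLimit]
        split_ifs
        · rw [← Finset.mul_sum, ← Finset.mul_sum]
          congr 2
          exact congrFun (h.vecMul_pow n) j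
        · simp

theorem cyclicLimit_mul_self (h : IsCyclicChain Q u v p c) [NeZero p] :
    cyclicLimit u v c 0 * cyclicLimit u v c 0 = cyclicLimit u v c 0 := by
  ext i j
  rw [Matrix.mul_apply]
  have hp : (p : ℝ) ≠ 0 := by exact_mod_cast NeZero.ne p
  calc ∑ k, cyclicLimit u v c 0 i k * cyclicLimit u v c 0 k j
      = ∑ k, cyclicLimit u v c 0 i j * p * (if c k = c i then u k * v k else 0) := by
        refine Finset.sum_congr rfl fun k _ => ?_
        simp only [cyclicLimit, add_zero]
        by_cases h1 : c k = c i
        · simp only [h1, if_true]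
          split_ifs <;> ring
        · simp [h1]
    _ = cyclicLimit u v c 0 i j := by
        rw [← Finset.mul_sum, h.sum_class]
        field_simp

theorem cyclicLimit_nonneg (h : IsCyclicChain Q u v p c) (r : ZMod p) (i j : ι) :
    0 ≤ cyclicLimit u v c r i j := by
  rw [cyclicLimit]
  split_ifs
  · exact mul_nonneg (Nat.cast_nonneg _) (mul_nonneg (h.right_pos i).le (h.left_pos j).le)
  · exact le_rfl

theorem cyclicLimit_le (h : IsCyclicChain Q u v p c) (r : ZMod p) (i j : ι) :
    cyclicLimit u v c r i j ≤ p * (v i * u j) := by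
  rw [cyclicLimit]
  split_ifs
  · exact le_rfl
  · exact mul_nonneg (Nat.cast_nonneg _) (mul_nonneg (h.right_pos i).le (h.left_pos j).le)

/-- Doeblin's argument, with P the limit matrix for the residue 0. For a large multiple N of the
period, R = Q^N is positive wherever P is, so R ≥ δP for some δ in (0, 1). The rest R' = (R - δP)/(1
- δ) is non-negative, fixes v and is absorbed by P. Hence R^k - P = (1 - δ)^k (R'^k - P), and the
powers of R' are bounded by the argument of `pow_le`. -/
theorem tendsto_pow_mul_sub (h : IsCyclicChain Q u v p c) [NeZero p] :
    ∃ N : ℕ, 0 < N ∧ (N : ZMod p) = 0 ∧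
      ∀ i j, Tendsto (fun k : ℕ => ((Q ^ N) ^ k - cyclicLimit u v c 0) i j) atTop (𝓝 0) := by
  obtain ⟨N₀, hN₀⟩ := h.eventually_pos
  have hppos : 0 < p := Nat.pos_of_ne_zero (NeZero.ne p)
  set N := p * (N₀ + 1) with hN
  have hNz : (N : ZMod p) = 0 := by simp [hN]
  have hNge : N₀ ≤ N := by
    rw [hN]
    nlinarith
  refine ⟨N, by positivity, hNz, fun i j => ?_⟩
  set P := cyclicLimit u v c 0 with hP
  set R := Q ^ N with hR
  have hRP : R * P = P := by rw [hR, hP, h.pow_mul_cyclicLimit, hNz, add_zero]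
  have hPR : P * R = P := by rw [hR, hP, h.cyclicLimit_mul_pow, hNz, add_zero]
  have hPP : P * P = P := h.cyclicLimit_mul_self
  have hPv : P *ᵥ v = v := by
    ext a
    have hp : (p : ℝ) ≠ 0 := by exact_mod_cast NeZero.ne p
    calc ∑ k, P a k * v k = ∑ k, p * v a * (if c k = c a then u k * v k else 0) := by
          refine Finset.sum_congr rfl fun k _ => ?_
          simp only [hP, cyclicLimit, add_zero]
          split_ifs <;> ring
      _ = v a := by
          rw [← Finset.mul_sum, h.sum_class]
          field_simp
  obtain ⟨δ, hδ0, hδ1, hδ⟩ : ∃ δ : ℝ, 0 < δ ∧ δ < 1 ∧ ∀ a b, δ * P a b ≤ R a b := by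
    have hev : ∀ᶠ δ in 𝓝[>] (0 : ℝ), ∀ a b, δ * P a b ≤ R a b := by
      refine eventually_all.2 fun a => eventually_all.2 fun b => ?_
      by_cases hab : c b = c a
      · have hRpos : 0 < R a b := hN₀ N hNge a b (by rw [hNz, add_zero, hab])
        have : Tendsto (fun δ : ℝ => δ * P a b) (𝓝[>] 0) (𝓝 (0 * P a b)) :=
          ((continuous_id.mul continuous_const).tendsto 0).mono_left nhdsWithin_le_nhds
        rw [zero_mul] at this
        exact (this.eventually (gt_mem_nhds hRpos)).mono fun _ h => h.le
      · refine Eventually.of_forall fun δ => ?_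
        simp only [hP, cyclicLimit, add_zero, if_neg hab, mul_zero]
        exact h.pow_nonneg N a b
    have hlt : ∀ᶠ δ in 𝓝[>] (0 : ℝ), δ < 1 :=
      nhdsWithin_le_nhds (gt_mem_nhds one_pos)
    obtain ⟨δ, h1, h2, h3⟩ := (hev.and (hlt.and self_mem_nhdsWithin)).exists
    exact ⟨δ, h3, h2, h1⟩
  have hδ' : 0 < 1 - δ := by linarith
  set R' := (1 - δ)⁻¹ • (R - δ • P) with hR'
  have hR'0 : ∀ a b, 0 ≤ R' a b := fun a b => by
    simp only [hR', Matrix.smul_apply, Matrix.sub_apply, smul_eq_mul]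
    exact mul_nonneg (inv_nonneg.2 hδ'.le) (sub_nonneg.2 (hδ a b))
  have hscale : (1 - δ)⁻¹ • (P - δ • P) = P := by
    rw [show P - δ • P = (1 - δ) • P by rw [sub_smul, one_smul], smul_smul,
      inv_mul_cancel₀ hδ'.ne', one_smul]
  have h1 : R' * P = P := by
    rw [hR', Matrix.smul_mul, sub_mul, hRP, Matrix.smul_mul, hPP, hscale]
  have h2 : P * R' = P := by
    rw [hR', Matrix.mul_smul, mul_sub, hPR, Matrix.mul_smul, hPP, hscale]
  have hR'v : R' *ᵥ v = v := by
    rw [hR', Matrix.smul_mulVec, Matrix.sub_mulVec, Matrix.smul_mulVec, hPv, hR, h.pow_mulVec,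
      show v - δ • v = (1 - δ) • v by rw [sub_smul, one_smul], smul_smul,
      inv_mul_cancel₀ hδ'.ne', one_smul]
  have hbound : ∀ k, (R' ^ k) i j ≤ v i / v j := fun k => by
    rw [le_div_iff₀ (h.right_pos j)]
    calc (R' ^ k) i j * v j ≤ ((R' ^ k) *ᵥ v) i :=
          Finset.single_le_sum (f := fun j => (R' ^ k) i j * v j)
            (fun m _ => mul_nonneg (Matrix.pow_apply_nonneg hR'0 k i m) (h.right_pos m).le)
            (Finset.mem_univ j)
      _ = v i := by rw [pow_mulVec_eigen (t := 1) (by simpa using hR'v) k]; simp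
  have hdiff : R - P = (1 - δ) • (R' - P) := by
    rw [smul_sub, hR', smul_smul, mul_inv_cancel₀ hδ'.ne', one_smul, sub_smul, one_smul]
    abel
  have hpow : ∀ k, (R ^ (k + 1) - P) i j = (1 - δ) ^ (k + 1) * ((R' ^ (k + 1)) i j - P i j) := by
    intro k
    rw [← sub_pow_succ_of_absorbing hRP hPR hPP, hdiff, smul_pow,
      sub_pow_succ_of_absorbing h1 h2 hPP]
    rfl
  rw [← tendsto_add_atTop_iff_nat 1]
  have hgeo : Tendsto (fun k : ℕ => (1 - δ) ^ (k + 1) * (v i / v j + P i j)) atTop (𝓝 0) := by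
    have := (tendsto_pow_atTop_nhds_zero_of_lt_one hδ'.le (by linarith : 1 - δ < 1))
    simpa using ((tendsto_add_atTop_iff_nat 1).2 this).mul_const (v i / v j + P i j)
  refine squeeze_zero_norm (fun k => ?_) hgeo
  rw [hpow, norm_mul, norm_pow, Real.norm_of_nonneg hδ'.le]
  refine mul_le_mul_of_nonneg_left ?_ (_root_.pow_nonneg hδ'.le _)
  refine (norm_sub_le _ _).trans (add_le_add ?_ ?_)
  · rw [Real.norm_of_nonneg (Matrix.pow_apply_nonneg hR'0 _ i j)]
    exact hbound _
  · rw [Real.norm_of_nonneg (h.cyclicLimit_nonneg 0 i j)]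

/-- The powers of a cyclic chain approach the cyclic limits. -/
theorem tendsto_pow_sub_cyclicLimit (h : IsCyclicChain Q u v p c) [NeZero p] (i j : ι) :
    Tendsto (fun n : ℕ => (Q ^ n) i j - cyclicLimit u v c n i j) atTop (𝓝 0) := by
  obtain ⟨N, hN, hNz, ht⟩ := h.tendsto_pow_mul_sub
  have hdiv : Tendsto (fun n : ℕ => n / N) atTop atTop := Nat.tendsto_div_const_atTop hN.ne'
  have hsum : Tendsto (fun n : ℕ => ∑ m, ‖((Q ^ N) ^ (n / N) - cyclicLimit u v c 0) i m‖ *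
      (v m / v j)) atTop (𝓝 0) := by
    have := tendsto_finsetSum (Finset.univ : Finset ι)
      (fun m _ => (((ht i m).comp hdiv).norm.mul_const (v m / v j)))
    simpa using this
  refine squeeze_zero_norm (fun n => ?_) hsum
  -- Division with remainder by N, a multiple of p, splits off a bounded factor Q^(n % N) and leaves
  -- the geometric convergence of (Q^N)^(n / N).
  have hmod : ((n % N : ℕ) : ZMod p) = n := by
    conv_rhs => rw [← Nat.div_add_mod n N]
    push_cast
    rw [hNz]
    ring
  have hn : (Q ^ n) i j - cyclicLimit u v c n i j =
      (((Q ^ N) ^ (n / N) - cyclicLimit u v c 0) * Q ^ (n % N)) i j := by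
    rw [sub_mul, h.cyclicLimit_mul_pow, ← pow_mul, ← pow_add, Nat.div_add_mod, zero_add,
      hmod, Matrix.sub_apply]
  rw [hn, Matrix.mul_apply]
  refine (norm_sum_le _ _).trans (Finset.sum_le_sum fun m _ => ?_)
  rw [norm_mul, Real.norm_of_nonneg (h.pow_nonneg _ m j)]
  exact mul_le_mul_of_nonneg_left (h.pow_le _ m j) (norm_nonneg _)

/-- Averages of the powers of a cyclic chain over a period converge. -/
theorem tendsto_average_pow (h : IsCyclicChain Q u v p c) [NeZero p] (i j : ι) :
    Tendsto (fun n : ℕ => (1 / (p : ℝ)) * ∑ r ∈ Finset.range p, (Q ^ (n + r)) i j) atTop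
      (𝓝 (v i * u j)) := by
  have hp : (p : ℝ) ≠ 0 := by exact_mod_cast NeZero.ne p
  have h1 : Tendsto (fun n : ℕ => ∑ r ∈ Finset.range p,
      ((Q ^ (n + r)) i j - cyclicLimit u v c ((n + r : ℕ) : ZMod p) i j)) atTop (𝓝 0) := by
    have := tendsto_finsetSum (Finset.range p) (fun r _ =>
      (h.tendsto_pow_sub_cyclicLimit i j).comp (tendsto_add_atTop_nat r))
    simpa using this
  -- Among p consecutive exponents exactly one has the residue that joins the classes of i and j.
  have h2 : ∀ n : ℕ, ∑ r ∈ Finset.range p, cyclicLimit u v c ((n + r : ℕ) : ZMod p) i j =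
      p * (v i * u j) := fun n => by
    rw [← sum_range_ite_natCast_eq (c j - c i - (n : ZMod p)) (p * (v i * u j))]
    refine Finset.sum_congr rfl fun r _ => ?_
    rw [cyclicLimit]
    congr 1
    push_cast
    rw [eq_iff_iff]
    constructor <;> intro h <;> linear_combination -h
  simp only [Finset.sum_sub_distrib, h2] at h1
  have h3 := (h1.add_const ((p : ℝ) * (v i * u j))).const_mul (1 / (p : ℝ))
  simp only [sub_add_cancel, zero_add] at h3
  convert h3 using 2
  field_simp

/-- Averages over a period of the windows `Q ^ (k - r) * M * Q ^ (l + r)` around a matrix `M` that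
advances the cyclic class by `n` approach a multiple of `Q ^ (k + n + l)`. -/
theorem tendsto_average_window (h : IsCyclicChain Q u v p c) [NeZero p] {M : Matrix ι ι ℝ} {n : ℕ}
    (hM : ∀ a b, M a b ≠ 0 → c b = c a + n) (i j : ι) :
    Tendsto (fun kl : ℕ × ℕ => (1 / (p : ℝ)) *
        ∑ r ∈ Finset.range p, (Q ^ (kl.1 - r) * M * Q ^ (kl.2 + r)) i j -
          (u ⬝ᵥ (M *ᵥ v)) * (Q ^ (n + kl.1 + kl.2)) i j) (atTop ×ˢ atTop) (𝓝 0) := by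
  have hp : (p : ℝ) ≠ 0 := by exact_mod_cast NeZero.ne p
  set L := cyclicLimit u v c with hL
  -- Both outer powers may be replaced by their cyclic limits, because each error is multiplied by a
  -- factor bounded uniformly in k and l.
  have hterm : ∀ r a b, Tendsto (fun kl : ℕ × ℕ =>
      (Q ^ (kl.1 - r)) i a * M a b * (Q ^ (kl.2 + r)) b j -
        L ((kl.1 - r : ℕ) : ZMod p) i a * M a b * L ((kl.2 + r : ℕ) : ZMod p) b j)
      (atTop ×ˢ atTop) (𝓝 0) := by
    intro r a b
    have t1 := ((h.tendsto_pow_sub_cyclicLimit i a).comp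
      (tendsto_sub_atTop_nat r)).comp (tendsto_fst (f := (atTop : Filter ℕ)) (g := (atTop : Filter ℕ)))
    have t2 := ((h.tendsto_pow_sub_cyclicLimit b j).comp
      (tendsto_add_atTop_nat r)).comp (tendsto_snd (f := (atTop : Filter ℕ)) (g := (atTop : Filter ℕ)))
    have t3 : Tendsto (fun kl : ℕ × ℕ =>
        ‖(Q ^ (kl.1 - r)) i a - L ((kl.1 - r : ℕ) : ZMod p) i a‖ * (|M a b| * (v b / v j)) +
        ‖(Q ^ (kl.2 + r)) b j - L ((kl.2 + r : ℕ) : ZMod p) b j‖ * (|M a b| * (p * (v i * u a))))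
        (atTop ×ˢ atTop) (𝓝 0) := by
      simpa using (t1.norm.mul_const (|M a b| * (v b / v j))).add
        (t2.norm.mul_const (|M a b| * (p * (v i * u a))))
    refine squeeze_zero_norm (fun kl => ?_) t3
    generalize kl.1 - r = x
    generalize kl.2 + r = y
    have e : (Q ^ x) i a * M a b * (Q ^ y) b j - L x i a * M a b * L y b j =
        ((Q ^ x) i a - L x i a) * (M a b * (Q ^ y) b j) +
        ((Q ^ y) b j - L y b j) * (M a b * L x i a) := by ring
    rw [e]
    refine (norm_add_le _ _).trans (add_le_add ?_ ?_)
    · rw [norm_mul, norm_mul, Real.norm_of_nonneg (h.pow_nonneg y b j), Real.norm_eq_abs (M a b)]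
      gcongr
      exact h.pow_le y b j
    · rw [norm_mul, norm_mul, Real.norm_of_nonneg (h.cyclicLimit_nonneg _ i a),
        Real.norm_eq_abs (M a b)]
      gcongr
      exact h.cyclicLimit_le _ i a
  have hsum : Tendsto (fun kl : ℕ × ℕ => (1 / (p : ℝ)) *
      (∑ r ∈ Finset.range p, ∑ a, ∑ b, ((Q ^ (kl.1 - r)) i a * M a b * (Q ^ (kl.2 + r)) b j -
        L ((kl.1 - r : ℕ) : ZMod p) i a * M a b * L ((kl.2 + r : ℕ) : ZMod p) b j)) -
      (u ⬝ᵥ (M *ᵥ v)) * ((Q ^ (n + kl.1 + kl.2)) i j - L ((n + kl.1 + kl.2 : ℕ) : ZMod p) i j))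
      (atTop ×ˢ atTop) (𝓝 0) := by
    have t1 := tendsto_finsetSum (Finset.range p) fun r _ =>
      tendsto_finsetSum (Finset.univ : Finset ι) fun a _ =>
        tendsto_finsetSum (Finset.univ : Finset ι) fun b _ => hterm r a b
    have hadd : Tendsto (fun kl : ℕ × ℕ => n + kl.1 + kl.2) (atTop ×ˢ atTop) atTop :=
      tendsto_atTop_mono (fun kl => show kl.1 ≤ n + kl.1 + kl.2 by omega)
        (tendsto_fst (f := (atTop : Filter ℕ)) (g := (atTop : Filter ℕ)))
    have t2 := (h.tendsto_pow_sub_cyclicLimit i j).comp hadd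
    simpa using (t1.const_mul (1 / (p : ℝ))).sub (t2.const_mul (u ⬝ᵥ (M *ᵥ v)))
  refine hsum.congr' ?_
  -- This makes the truncated differences k - r genuine, so that they can be cast to residues.
  have hev : ∀ᶠ kl : ℕ × ℕ in atTop ×ˢ atTop, p ≤ kl.1 :=
    (eventually_ge_atTop p).prod_inl _
  filter_upwards [hev] with kl hkl
  have hlim : (1 / (p : ℝ)) * (∑ r ∈ Finset.range p, ∑ a, ∑ b,
        L ((kl.1 - r : ℕ) : ZMod p) i a * M a b * L ((kl.2 + r : ℕ) : ZMod p) b j) =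
      (u ⬝ᵥ (M *ᵥ v)) * L ((n + kl.1 + kl.2 : ℕ) : ZMod p) i j := by
    have hab : ∀ a b, ∑ r ∈ Finset.range p,
        L ((kl.1 - r : ℕ) : ZMod p) i a * M a b * L ((kl.2 + r : ℕ) : ZMod p) b j =
        p * (u a * M a b * v b * L ((n + kl.1 + kl.2 : ℕ) : ZMod p) i j) := by
      intro a b
      by_cases hz : M a b = 0
      · simp [hz]
      have hcb := hM a b hz
      rw [← sum_range_ite_natCast_eq (c i + (kl.1 : ZMod p) - c a)
        ((p : ℝ) * (u a * M a b * v b * L ((n + kl.1 + kl.2 : ℕ) : ZMod p) i j))]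
      refine Finset.sum_congr rfl fun r hr => ?_
      have hr' : r ≤ kl.1 := (Finset.mem_range.1 hr).le.trans hkl
      -- For given a and b exactly one offset r lets the left factor pass from i to a. For this r
      -- the right factor passes from b to j exactly when the total length n + k + l is compatible
      -- with i and j.
      by_cases h1 : (r : ZMod p) = c i + kl.1 - c a
      · rw [if_pos h1]
        have e1 : c a = c i + ((kl.1 - r : ℕ) : ZMod p) := by
          push_cast [hr']
          linear_combination h1
        have e2 : c j = c b + ((kl.2 + r : ℕ) : ZMod p) ↔
            c j = c i + ((n + kl.1 + kl.2 : ℕ) : ZMod p) := by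
          rw [hcb]
          push_cast
          constructor <;> intro h
          · linear_combination h + h1
          · linear_combination h - h1
        simp only [hL, cyclicLimit, if_pos e1, e2]
        split_ifs <;> ring
      · rw [if_neg h1]
        have e1 : ¬ c a = c i + ((kl.1 - r : ℕ) : ZMod p) := by
          intro h
          push_cast [hr'] at h
          exact h1 (by linear_combination h)
        simp only [hL, cyclicLimit, if_neg e1, zero_mul]
    rw [Finset.sum_comm]
    simp only [Finset.sum_comm (s := Finset.range p), hab, ← Finset.mul_sum, ← Finset.sum_mul]
    rw [← mul_assoc, one_div, inv_mul_cancel₀ hp, one_mul]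
    congr 1
    simp only [dotProduct, Matrix.mulVec, Finset.mul_sum, mul_assoc]
  simp only [Finset.sum_sub_distrib, mul_sub, hlim]
  have hexp : ∀ r, (Q ^ (kl.1 - r) * M * Q ^ (kl.2 + r)) i j =
      ∑ a, ∑ b, (Q ^ (kl.1 - r)) i a * M a b * (Q ^ (kl.2 + r)) b j := by
    intro r
    rw [mul_assoc, Matrix.mul_apply]
    refine Finset.sum_congr rfl fun a _ => ?_
    rw [Matrix.mul_apply, Finset.mul_sum]
    exact Finset.sum_congr rfl fun b _ => by ring
  simp only [hexp]
  ring

end IsCyclicChain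

end Convergence

end PerronFrobenius

end

noncomputable section

/-! ### Sums over words -/

section Words

variable {T : Type*}

theorem Fin.append_append_middle {k n l : ℕ} (a : Fin k → T) (b : Fin n → T) (c : Fin l → T)
    (j : Fin n) : Fin.append (Fin.append a b) c ⟨k + j, by omega⟩ = b j := by
  have : (⟨k + j, by omega⟩ : Fin (k + n + l)) = Fin.castAdd l (Fin.natAdd k j) := rfl
  rw [this, Fin.append_left, Fin.append_right]

theorem List.ofFn_append_append {k n l : ℕ} (a : Fin k → T) (b : Fin n → T) (c : Fin l → T) :
    List.ofFn (Fin.append (Fin.append a b) c) = List.ofFn a ++ List.ofFn b ++ List.ofFn c := by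
  rw [List.ofFn_fin_append, List.ofFn_fin_append]
variable [Fintype T] {R : Type*} [AddCommMonoid R]

theorem Fin.sum_cons_univ {n : ℕ} (f : (Fin (n + 1) → T) → R) :
    ∑ x, f x = ∑ t : T, ∑ y : Fin n → T, f (Fin.cons t y) := by
  rw [← Fintype.sum_prod_type']
  exact (Fintype.sum_equiv (Fin.consEquiv fun _ : Fin (n + 1) => T) _ _ fun _ => rfl).symm

theorem Fin.sum_append_univ {m n : ℕ} (f : (Fin (m + n) → T) → R) :
    ∑ x, f x = ∑ a : Fin m → T, ∑ b : Fin n → T, f (Fin.append a b) := by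
  rw [← Fintype.sum_prod_type']
  exact (Fintype.sum_equiv (Fin.appendEquiv m n) _ _ fun _ => rfl).symm

open Classical in
/-- Summing over the words with a prescribed middle part amounts to summing over the prefixes and
the suffixes. -/
theorem Fin.sum_middle {k n l : ℕ} (w : Fin n → T) (f : (Fin (k + n + l) → T) → R) :
    ∑ x, (if ∀ j : Fin n, x ⟨k + j, by omega⟩ = w j then f x else 0) =
      ∑ a : Fin k → T, ∑ c : Fin l → T, f (Fin.append (Fin.append a w) c) := by
  rw [Fin.sum_append_univ, Fin.sum_append_univ]
  refine Finset.sum_congr rfl fun a _ => ?_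
  simp only [Fin.append_append_middle, ← funext_iff]
  rw [Finset.sum_comm]
  refine Finset.sum_congr rfl fun c _ => ?_
  simp

end Words

/-! ### Products of matrices along words -/

section WordMatrix

variable {V T : Type*} [Fintype V] [DecidableEq V]

/-- The product of the matrices of the letters of a word. -/
def wordMatrix (M : T → Matrix V V ℝ) (w : List T) : Matrix V V ℝ := (w.map M).prod

variable (M : T → Matrix V V ℝ)

@[simp] theorem wordMatrix_nil : wordMatrix M [] = 1 := rfl

@[simp] theorem wordMatrix_cons (t : T) (w : List T) :
    wordMatrix M (t :: w) = M t * wordMatrix M w := by simp [wordMatrix]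

@[simp] theorem wordMatrix_append (w w' : List T) :
    wordMatrix M (w ++ w') = wordMatrix M w * wordMatrix M w' := by simp [wordMatrix]

theorem wordMatrix_nonneg {M : T → Matrix V V ℝ} (hM : ∀ t i j, 0 ≤ M t i j) (w : List T) :
    ∀ i j, 0 ≤ wordMatrix M w i j := by
  induction w with
  | nil =>
    intro i j
    rw [wordMatrix_nil, Matrix.one_apply]
    split_ifs <;> simp
  | cons t w ih =>
    intro i j
    rw [wordMatrix_cons, Matrix.mul_apply]
    exact Finset.sum_nonneg fun k _ => mul_nonneg (hM t i k) (ih k j)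

/-- Summing the matrices of the words that map to `w` under a letter-to-letter map. -/
theorem sum_wordMatrix_fiber [Fintype T] {S : Type*} [DecidableEq S] (f : T → S) {n : ℕ}
    (w : Fin n → S) :
    ∑ x : Fin n → T, (if ∀ i, f (x i) = w i then wordMatrix M (List.ofFn x) else 0) =
      wordMatrix (fun s => ∑ t, if f t = s then M t else 0) (List.ofFn w) := by
  induction n with
  | zero => simp
  | succ n ih =>
    rw [Fin.sum_cons_univ, List.ofFn_succ, wordMatrix_cons, ← ih, Finset.sum_mul]
    refine Finset.sum_congr rfl fun t _ => ?_
    rw [Finset.mul_sum]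
    refine Finset.sum_congr rfl fun y _ => ?_
    simp only [Fin.forall_fin_succ, Fin.cons_zero, Fin.cons_succ, List.ofFn_succ, wordMatrix_cons]
    by_cases h1 : f t = w 0 <;> by_cases h2 : ∀ i, f (y i) = w i.succ <;> simp [h1, h2]

theorem sum_wordMatrix_ofFn [Fintype T] (n : ℕ) :
    ∑ x : Fin n → T, wordMatrix M (List.ofFn x) = (∑ t, M t) ^ n := by
  have h := sum_wordMatrix_fiber M (fun _ => ()) (fun _ : Fin n => ())
  simp only [implies_true, if_true] at h
  rw [h, wordMatrix, List.map_ofFn]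
  simp [Function.comp_def]

/-- The weight `λ^{-n} u M_{w_1} ⋯ M_{w_n} v` of a word. -/
def wordWeight (lam : ℝ) (u v : V → ℝ) (w : List T) : ℝ :=
  (u ⬝ᵥ (wordMatrix M w *ᵥ v)) / lam ^ w.length

variable {M} {lam : ℝ} {u v : V → ℝ}

theorem wordWeight_nonneg (hM : ∀ t i j, 0 ≤ M t i j) (hlam : 0 < lam) (hu : ∀ i, 0 < u i)
    (hv : ∀ i, 0 < v i) (w : List T) : 0 ≤ wordWeight M lam u v w :=
  div_nonneg (Finset.sum_nonneg fun i _ => mul_nonneg (hu i).le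
    (Finset.sum_nonneg fun j _ => mul_nonneg (wordMatrix_nonneg hM w i j) (hv j).le))
    (pow_nonneg hlam.le _)

theorem wordWeight_nil (h : u ⬝ᵥ v = 1) : wordWeight M lam u v [] = 1 := by
  simp [wordWeight, h]

/-- The right eigenvector equation gives consistency under extension to the right; the left one
gives the mirror statement below. -/
theorem sum_wordWeight_append [Fintype T] (hlam : lam ≠ 0) (hv : (∑ t, M t) *ᵥ v = lam • v)
    (w : List T) : ∑ t, wordWeight M lam u v (w ++ [t]) = wordWeight M lam u v w := by
  simp only [wordWeight, wordMatrix_append, wordMatrix_cons, wordMatrix_nil, mul_one,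
    List.length_append, List.length_singleton]
  rw [← Finset.sum_div, ← dotProduct_sum, ← Matrix.sum_mulVec, ← Finset.mul_sum,
    ← Matrix.mulVec_mulVec, hv, Matrix.mulVec_smul, dotProduct_smul, smul_eq_mul, pow_succ]
  field_simp

theorem sum_wordWeight_cons [Fintype T] (hlam : lam ≠ 0) (hu : u ᵥ* (∑ t, M t) = lam • u)
    (w : List T) : ∑ t, wordWeight M lam u v (t :: w) = wordWeight M lam u v w := by
  simp only [wordWeight, wordMatrix_cons, List.length_cons]
  rw [← Finset.sum_div, ← dotProduct_sum, ← Matrix.sum_mulVec, ← Finset.sum_mul,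
    ← Matrix.mulVec_mulVec, Matrix.dotProduct_mulVec, hu, smul_dotProduct, smul_eq_mul, pow_succ]
  field_simp

end WordMatrix

/-! ### Matrices of partial maps -/

/-- A `0`-`1` matrix with at most one non-zero entry in each row. -/
structure IsPartialMapMatrix {V : Type*} (M : Matrix V V ℝ) : Prop where
  zero_or_one : ∀ i j, M i j = 0 ∨ M i j = 1
  unique : ∀ i j k, M i j ≠ 0 → M i k ≠ 0 → j = k

namespace IsPartialMapMatrix

variable {V : Type*}

theorem one [DecidableEq V] : IsPartialMapMatrix (1 : Matrix V V ℝ) where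
  zero_or_one i j := by
    rw [Matrix.one_apply]
    split_ifs <;> simp
  unique i j k hj hk := by
    have h : ∀ j, (1 : Matrix V V ℝ) i j ≠ 0 → i = j := fun j hj => by
      by_contra hne
      exact hj (Matrix.one_apply_ne hne)
    rw [← h j hj, ← h k hk]

variable {M N : Matrix V V ℝ}

theorem nonneg (hM : IsPartialMapMatrix M) (i j : V) : 0 ≤ M i j := by
  rcases hM.zero_or_one i j with h | h <;> simp [h]

variable [Fintype V]

theorem sum_row_mul (hM : IsPartialMapMatrix M) {i j : V} (h : M i j ≠ 0) (f : V → ℝ) :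
    ∑ k, M i k * f k = f j := by
  rw [Finset.sum_eq_single j]
  · rw [(hM.zero_or_one i j).resolve_left h, one_mul]
  · intro k _ hk
    have : M i k = 0 := by
      by_contra h'
      exact hk (hM.unique i k j h' h)
    rw [this, zero_mul]
  · simp

theorem mul (hM : IsPartialMapMatrix M) (hN : IsPartialMapMatrix N) :
    IsPartialMapMatrix (M * N) := by
  have hrow : ∀ i, (∀ k, (M * N) i k = 0) ∨ ∃ j, ∀ k, (M * N) i k = N j k := by
    intro i
    by_cases h : ∃ j, M i j ≠ 0
    · obtain ⟨j, hj⟩ := h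
      exact Or.inr ⟨j, fun k => by rw [Matrix.mul_apply, hM.sum_row_mul hj]⟩
    · push Not at h
      exact Or.inl fun k => by simp [Matrix.mul_apply, h]
  constructor
  · intro i k
    rcases hrow i with h | ⟨j, h⟩
    · exact Or.inl (h k)
    · rw [h]
      exact hN.zero_or_one j k
  · intro i k l hk hl
    rcases hrow i with h | ⟨j, h⟩
    · exact absurd (h k) hk
    · rw [h] at hk hl
      exact hN.unique j k l hk hl

theorem sum_row_eq_ite [DecidableEq V] (hM : IsPartialMapMatrix M) (i : V) [Decidable (∃ j, M i j ≠ 0)] :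
    ∑ j, M i j = if ∃ j, M i j ≠ 0 then 1 else 0 := by
  split_ifs with h
  · obtain ⟨j, hj⟩ := h
    simpa using hM.sum_row_mul hj fun _ => 1
  · push Not at h
    simp [h]

end IsPartialMapMatrix

theorem isPartialMapMatrix_wordMatrix {V T : Type*} [Fintype V] [DecidableEq V]
    {M : T → Matrix V V ℝ} (hM : ∀ t, IsPartialMapMatrix (M t)) (w : List T) :
    IsPartialMapMatrix (wordMatrix M w) := by
  induction w with
  | nil => exact IsPartialMapMatrix.one
  | cons t w ih =>
    rw [wordMatrix_cons]
    exact (hM t).mul ih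

/-! ### The matrices of a labeled graph -/

namespace LabeledGraph

variable {V E S : Type*} (G : LabeledGraph V E S)

theorem symbolMatrix_nonneg (s : S) (i j : V) : 0 ≤ G.symbolMatrix s i j := by
  rw [symbolMatrix]
  split_ifs <;> simp

theorem symbolMatrix_ne_zero {s : S} {i j : V} (h : G.symbolMatrix s i j ≠ 0) :
    ∃ e, G.src e = i ∧ G.tgt e = j ∧ G.label e = s := by
  by_contra h'
  exact h (if_neg h')

variable {G}

/-- A vertex and a label determine the edge, hence its terminal vertex. This determinism underlies
both the Gibbs bounds and the magic words. -/
theorem RightResolving.isPartialMapMatrix (hres : G.RightResolving) (s : S) :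
    IsPartialMapMatrix (G.symbolMatrix s) where
  zero_or_one i j := by
    rw [symbolMatrix]
    split_ifs <;> simp
  unique i j k hj hk := by
    obtain ⟨e, he1, he2, he3⟩ := G.symbolMatrix_ne_zero hj
    obtain ⟨f, hf1, hf2, hf3⟩ := G.symbolMatrix_ne_zero hk
    have := hres e f (he1.trans hf1.symm) (he3.trans hf3.symm)
    rw [← he2, ← hf2, this]

variable [DecidableEq V]

variable (G) in
/-- The matrix with a single entry at the position of the edge `e`. -/
def singleEdgeMatrix (e : E) : Matrix V V ℝ := Matrix.single (G.src e) (G.tgt e) 1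

theorem singleEdgeMatrix_nonneg (e : E) (i j : V) : 0 ≤ G.singleEdgeMatrix e i j := by
  rw [singleEdgeMatrix, Matrix.single_apply]
  split_ifs <;> simp

variable [Fintype E]

theorem adjMatrix_eq_sum : G.adjMatrix = ∑ e, G.singleEdgeMatrix e := by
  ext i j
  simp only [adjMatrix, Matrix.sum_apply, singleEdgeMatrix, Matrix.single_apply]
  rw [Finset.sum_boole, Nat.card_eq_fintype_card, Fintype.card_subtype]

variable [DecidableEq S]

/-- The 0-1 matrix of a symbol ignores multiplicities, but parallel edges cannot share a label here,
so nothing is lost. Multiple edges of the graph are thus counted correctly by the total matrix. -/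
theorem RightResolving.symbolMatrix_eq_sum (hres : G.RightResolving) (s : S) :
    G.symbolMatrix s = ∑ e, if G.label e = s then G.singleEdgeMatrix e else 0 := by
  ext i j
  rw [Matrix.sum_apply]
  by_cases h : ∃ e, G.src e = i ∧ G.tgt e = j ∧ G.label e = s
  · rw [symbolMatrix, if_pos h]
    obtain ⟨e, rfl, rfl, rfl⟩ := h
    rw [Finset.sum_eq_single e]
    · simp [singleEdgeMatrix]
    · intro f _ hne
      split_ifs with hl
      · rw [singleEdgeMatrix, Matrix.single_apply, if_neg]
        rintro ⟨h1, -⟩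
        exact hne (hres f e h1 hl)
      · rfl
    · simp
  · rw [symbolMatrix, if_neg h]
    refine (Finset.sum_eq_zero fun e _ => ?_).symm
    split_ifs with hl
    · rw [singleEdgeMatrix, Matrix.single_apply, if_neg]
      rintro ⟨h1, h2⟩
      exact h ⟨e, h1, h2, hl⟩
    · rfl

theorem RightResolving.totalMatrix_eq_sum [Fintype S] (hres : G.RightResolving) :
    G.totalMatrix = ∑ e, G.singleEdgeMatrix e := by
  simp only [totalMatrix, hres.symbolMatrix_eq_sum]
  rw [Finset.sum_comm]
  simp

theorem RightResolving.totalMatrix_eq_adjMatrix [Fintype S] (hres : G.RightResolving) :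
    G.totalMatrix = G.adjMatrix := by
  rw [hres.totalMatrix_eq_sum, adjMatrix_eq_sum]

end LabeledGraph

end

noncomputable section

/-! ### Measures on full shifts from consistent weights -/

section Extension

variable {T : Type*} [Fintype T]

theorem sum_prepend_eq {q : List T → ℝ} (h : ∀ w, ∑ t, q (t :: w) = q w) (n : ℕ) (w : List T) :
    ∑ a : Fin n → T, q (List.ofFn a ++ w) = q w := by
  induction n generalizing w with
  | zero => simp
  | succ n ih =>
    rw [Fin.sum_cons_univ, Finset.sum_comm]
    simp only [List.ofFn_succ, Fin.cons_zero, Fin.cons_succ, List.cons_append, h]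
    exact ih w

theorem sum_append_eq {q : List T → ℝ} (h : ∀ w, ∑ t, q (w ++ [t]) = q w) (n : ℕ) (w : List T) :
    ∑ a : Fin n → T, q (w ++ List.ofFn a) = q w := by
  induction n generalizing w with
  | zero => simp
  | succ n ih =>
    rw [Fin.sum_cons_univ]
    simp only [List.ofFn_succ, Fin.cons_zero, Fin.cons_succ]
    rw [← h w]
    refine Finset.sum_congr rfl fun t _ => ?_
    rw [← ih (w ++ [t])]
    simp

/-- The bi-infinite sequence that agrees with `w` on `[-k, n - k)` and is constant elsewhere. -/
def extendWord (t₀ : T) (k : ℕ) {n : ℕ} (w : Fin n → T) : ℤ → T :=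
  fun i => if h : 0 ≤ i + k ∧ i + k < n then w ⟨(i + k).toNat, by omega⟩ else t₀

omit [Fintype T] in
theorem extendWord_apply (t₀ : T) (k : ℕ) {n : ℕ} (w : Fin n → T) (i : Fin n) :
    extendWord t₀ k w ((i : ℕ) - (k : ℤ)) = w i := by
  rw [extendWord, dif_pos (by omega)]
  congr 1
  ext
  simp

variable [MeasurableSpace T]

/-- The distribution of a random word with the weights `q`, extended to a sequence. -/
def wordDistribution (q : List T → ℝ) (t₀ : T) (k n : ℕ) : Measure (ℤ → T) :=
  ∑ w : Fin n → T, ENNReal.ofReal (q (List.ofFn w)) • Measure.dirac (extendWord t₀ k w)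

variable {q : List T → ℝ}

theorem isProbabilityMeasure_wordDistribution (h0 : ∀ w, 0 ≤ q w) (h1 : q [] = 1)
    (hr : ∀ w, ∑ t, q (w ++ [t]) = q w) (t₀ : T) (k n : ℕ) :
    IsProbabilityMeasure (wordDistribution q t₀ k n) where
  measure_univ := by
    simp only [wordDistribution, Measure.coe_finsetSum, Finset.sum_apply, Measure.smul_apply,
      measure_univ, smul_eq_mul, mul_one]
    rw [← ENNReal.ofReal_sum_of_nonneg fun _ _ => h0 _]
    have := sum_append_eq hr n []
    simp only [List.nil_append] at this
    rw [this, h1, ENNReal.ofReal_one]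

variable [DiscreteMeasurableSpace T]

omit [Fintype T] in
theorem measurableSet_fullCylinder (α : ℤ) {n : ℕ} (w : Fin n → T) :
    MeasurableSet {x : ℤ → T | ∀ i : Fin n, x (α + i) = w i} := by
  have : {x : ℤ → T | ∀ i : Fin n, x (α + i) = w i} =
      (fun (x : ℤ → T) (i : Fin n) => x (α + i)) ⁻¹' {w} := by
    ext x
    simp [funext_iff]
  rw [this]
  exact (measurable_pi_lambda _ fun i => measurable_pi_apply _) (measurableSet_singleton _)

/-- The random word occupies a window starting at -k that contains the sites of the cylinder, with a
letters before and b after. Two-sided consistency of q sums these out. -/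
theorem wordDistribution_cylinder (h0 : ∀ w, 0 ≤ q w) (hr : ∀ w, ∑ t, q (w ++ [t]) = q w)
    (hl : ∀ w, ∑ t, q (t :: w) = q w) (t₀ : T) (k a n b : ℕ) (w : Fin n → T) :
    wordDistribution q t₀ k (a + n + b) {x : ℤ → T | ∀ i : Fin n, x ((a : ℤ) - k + i) = w i} =
      ENNReal.ofReal (q (List.ofFn w)) := by
  classical
  have hmem : ∀ x : Fin (a + n + b) → T,
      (Measure.dirac (extendWord t₀ k x)) {x : ℤ → T | ∀ i : Fin n, x ((a : ℤ) - k + i) = w i} =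
        if ∀ j : Fin n, x ⟨a + j, by omega⟩ = w j then 1 else 0 := by
    intro x
    rw [Measure.dirac_apply' _ (measurableSet_fullCylinder _ w), Set.indicator_apply]
    have : ∀ j : Fin n, extendWord t₀ k x ((a : ℤ) - k + j) = x ⟨a + j, by omega⟩ := fun j => by
      rw [← extendWord_apply t₀ k x ⟨a + j, by omega⟩]
      congr 1
      push_cast
      ring
    simp only [Set.mem_ofPred_eq, this, Pi.one_apply]
  simp only [wordDistribution, Measure.coe_finsetSum, Finset.sum_apply, Measure.smul_apply,
    smul_eq_mul, hmem, mul_ite, mul_one, mul_zero]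
  rw [Fin.sum_middle w (fun x => ENNReal.ofReal (q (List.ofFn x)))]
  simp only [List.ofFn_append_append]
  simp only [← ENNReal.ofReal_sum_of_nonneg (fun _ _ => h0 _)]
  rw [← ENNReal.ofReal_sum_of_nonneg (fun _ _ => Finset.sum_nonneg fun _ _ => h0 _)]
  simp only [sum_append_eq hr, sum_prepend_eq hl]

/-- A consistent non-negative weight on words extends to a probability measure on sequences. -/
theorem exists_measure_fullCylinder (h0 : ∀ w, 0 ≤ q w) (h1 : q [] = 1)
    (hr : ∀ w, ∑ t, q (w ++ [t]) = q w) (hl : ∀ w, ∑ t, q (t :: w) = q w) :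
    ∃ ν : Measure (ℤ → T), IsProbabilityMeasure ν ∧ ∀ (n : ℕ) (w : Fin n → T) (α : ℤ),
      ν {x | ∀ i : Fin n, x (α + i) = w i} = ENNReal.ofReal (q (List.ofFn w)) := by
  have hne : Nonempty T := by
    by_contra h
    rw [not_nonempty_iff] at h
    have := hr []
    simp [h1] at this
  obtain ⟨t₀⟩ := hne
  let : TopologicalSpace T := ⊥
  have : DiscreteTopology T := ⟨rfl⟩
  have : BorelSpace T := inferInstance
  let P : ℕ → ProbabilityMeasure (ℤ → T) := fun k =>
    ⟨wordDistribution q t₀ k (2 * k + 1), isProbabilityMeasure_wordDistribution h0 h1 hr _ _ _⟩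
  -- With the discrete topology on T the sequence space is compact, hence so is its space of
  -- probability measures, and an ultrafilter limit exists. Cylinders are clopen, so their measures
  -- pass to the limit; they are constant once the window [-k, k] contains the sites involved.
  let U : Ultrafilter ℕ := hyperfilter ℕ
  have hU : (U : Filter ℕ) ≤ atTop := Nat.hyperfilter_le_atTop
  have hlim : Tendsto P U (𝓝 ((U.map P).lim)) := (U.map P).le_nhds_lim
  refine ⟨((U.map P).lim : ProbabilityMeasure (ℤ → T)), inferInstance, fun n w α => ?_⟩
  have hclopen : IsClopen {x : ℤ → T | ∀ i : Fin n, x (α + i) = w i} := by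
    have : {x : ℤ → T | ∀ i : Fin n, x (α + i) = w i} =
        (fun (x : ℤ → T) (i : Fin n) => x (α + i)) ⁻¹' {w} := by
      ext x
      simp [funext_iff]
    rw [this]
    exact (isClopen_discrete {w}).preimage (by fun_prop)
  have ht := ProbabilityMeasure.tendsto_measure_of_null_frontier_of_tendsto' hlim
    (E := {x : ℤ → T | ∀ i : Fin n, x (α + i) = w i}) (by simp [hclopen.frontier_eq])
  refine tendsto_nhds_unique ht (tendsto_const_nhds.congr' ?_)
  filter_upwards [hU (eventually_ge_atTop (α.natAbs + n))] with k hk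
  obtain ⟨a, ha⟩ : ∃ a : ℕ, α = a - k := ⟨(α + k).toNat, by omega⟩
  obtain ⟨b, hb⟩ : ∃ b : ℕ, 2 * k + 1 = a + n + b := ⟨2 * k + 1 - a - n, by omega⟩
  subst ha
  simp only [P, ProbabilityMeasure.coe_mk, hb]
  exact (wordDistribution_cylinder h0 hr hl t₀ k a n b w).symm

end Extension

end

noncomputable section

/-! ### Averaged mixing -/

section Mixing

variable {Ω : Type*} [MeasurableSpace Ω]

/-- The averages of `m(T^{-(n + j)} E ∩ F)` over `j < p` converge to `m(E) m(F)`. -/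
def IsAveragedMixing (T : Ω → Ω) (m : Measure Ω) (p : ℕ) (E F : Set Ω) : Prop :=
  Tendsto (fun n : ℕ => (1 / (p : ℝ)) * ∑ j ∈ Finset.range p, m.real (T^[n + j] ⁻¹' E ∩ F)) atTop
    (𝓝 (m.real E * m.real F))

variable {T : Ω → Ω} {m : Measure Ω}

theorem abs_average_sub_average_le {p : ℕ} (hp : 0 < p) {a b : ℕ → ℝ} {ε : ℝ}
    (h : ∀ j, |a j - b j| ≤ ε) :
    |(1 / (p : ℝ)) * ∑ j ∈ Finset.range p, a j - (1 / (p : ℝ)) * ∑ j ∈ Finset.range p, b j| ≤ ε := by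
  have hp' : (0 : ℝ) < p := by exact_mod_cast hp
  rw [← mul_sub, ← Finset.sum_sub_distrib, abs_mul, abs_of_pos (by positivity : 0 < 1 / (p : ℝ))]
  calc 1 / (p : ℝ) * |∑ j ∈ Finset.range p, (a j - b j)|
      ≤ 1 / (p : ℝ) * ∑ j ∈ Finset.range p, ε := by
        gcongr
        exact (Finset.abs_sum_le_sum_abs _ _).trans (Finset.sum_le_sum fun j _ => h j)
    _ = ε := by
        rw [Finset.sum_const, Finset.card_range, nsmul_eq_mul]
        field_simp

/-- Averaged mixing extends from a dense family of sets to all measurable sets. -/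
theorem isAveragedMixing_of_measureDense [IsProbabilityMeasure m] (hT : MeasurePreserving T m m)
    {𝒜 : Set (Set Ω)} (hd : m.MeasureDense 𝒜) {p : ℕ} (hp : 0 < p)
    (h : ∀ E ∈ 𝒜, ∀ F ∈ 𝒜, IsAveragedMixing T m p E F) {E F : Set Ω} (hE : MeasurableSet E)
    (hF : MeasurableSet F) : IsAveragedMixing T m p E F := by
  rw [IsAveragedMixing, Metric.tendsto_atTop]
  intro ε hε
  -- The budget of fifths: one for the limit along E', F', two for replacing E and F inside the
  -- correlations, two for replacing them in the product of measures.
  have happrox : ∀ A : Set Ω, MeasurableSet A → ∃ A' ∈ 𝒜, MeasurableSet A' ∧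
      m.real (symmDiff A A') < ε / 5 := by
    intro A hA
    obtain ⟨A', hA', hlt⟩ := hd.approx A hA (measure_ne_top _ _) (ε / 5) (by positivity)
    refine ⟨A', hA', hd.measurable A' hA', ?_⟩
    rw [measureReal_def]
    exact (ENNReal.toReal_lt_toReal (measure_ne_top _ _) ENNReal.ofReal_ne_top).2 hlt |>.trans_eq
      (ENNReal.toReal_ofReal (by positivity))
  obtain ⟨E', hE', hmE', hEE'⟩ := happrox E hE
  obtain ⟨F', hF', hmF', hFF'⟩ := happrox F hF
  obtain ⟨N, hN⟩ := Metric.tendsto_atTop.1 (h E' hE' F' hF') (ε / 5) (by positivity)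
  refine ⟨N, fun n hn => ?_⟩
  have h1 := hN n hn
  rw [Real.dist_eq] at h1 ⊢
  have h2 : ∀ j, |m.real (T^[n + j] ⁻¹' E ∩ F) - m.real (T^[n + j] ⁻¹' E' ∩ F')| ≤ 2 * (ε / 5) := by
    intro j
    have hTj := hT.iterate (n + j)
    refine (abs_measureReal_sub_le_measureReal_symmDiff
      ((hTj.measurable hE).inter hF).nullMeasurableSet
      ((hTj.measurable hmE').inter hmF').nullMeasurableSet).trans ?_
    have hsub : symmDiff (T^[n + j] ⁻¹' E ∩ F) (T^[n + j] ⁻¹' E' ∩ F') ⊆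
        T^[n + j] ⁻¹' (symmDiff E E') ∪ symmDiff F F' := by
      intro x
      simp only [Set.mem_symmDiff, Set.mem_inter_iff, Set.mem_preimage, Set.mem_union]
      tauto
    have h3 : m.real (T^[n + j] ⁻¹' (symmDiff E E')) = m.real (symmDiff E E') := by
      rw [measureReal_def, measureReal_def,
        hTj.measure_preimage (hE.symmDiff hmE').nullMeasurableSet]
    have := (measureReal_mono hsub (measure_ne_top m _)).trans (measureReal_union_le _ _)
    linarith
  have h4 := abs_average_sub_average_le hp h2
  have h5 : |m.real E - m.real E'| ≤ ε / 5 :=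
    (abs_measureReal_sub_le_measureReal_symmDiff hE.nullMeasurableSet
      hmE'.nullMeasurableSet).trans hEE'.le
  have h6 : |m.real F - m.real F'| ≤ ε / 5 :=
    (abs_measureReal_sub_le_measureReal_symmDiff hF.nullMeasurableSet
      hmF'.nullMeasurableSet).trans hFF'.le
  have h7 : |m.real E * m.real F - m.real E' * m.real F'| < 2 * (ε / 5) := by
    have e : m.real E * m.real F - m.real E' * m.real F' =
      (m.real E - m.real E') * m.real F + m.real E' * (m.real F - m.real F') := by ring
    have hlt5 : |m.real E - m.real E'| < ε / 5 :=
      (abs_measureReal_sub_le_measureReal_symmDiff hE.nullMeasurableSet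
        hmE'.nullMeasurableSet).trans_lt hEE'
    rw [e]
    refine (abs_add_le _ _).trans_lt ?_
    rw [abs_mul, abs_mul, abs_of_nonneg (measureReal_nonneg : 0 ≤ m.real F),
      abs_of_nonneg (measureReal_nonneg : 0 ≤ m.real E')]
    have b1 : |m.real E - m.real E'| * m.real F ≤ |m.real E - m.real E'| :=
      mul_le_of_le_one_right (abs_nonneg _) measureReal_le_one
    have b2 : m.real E' * |m.real F - m.real F'| ≤ |m.real F - m.real F'| :=
      mul_le_of_le_one_left (abs_nonneg _) measureReal_le_one
    linarith
  rw [abs_lt] at h1 h7 ⊢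
  rw [abs_le] at h4
  constructor <;> linarith [h1.1, h1.2, h4.1, h4.2, h7.1, h7.2]

/-- For an invariant set s the averages of m(T^{-n} s ∩ s) are constantly m(s), so m(s) = m(s)². -/
theorem ergodic_of_isAveragedMixing [IsProbabilityMeasure m] (hT : MeasurePreserving T m m) {p : ℕ}
    (hp : 0 < p)
    (h : ∀ E F, MeasurableSet E → MeasurableSet F → IsAveragedMixing T m p E F) : Ergodic T m where
  toMeasurePreserving := hT
  aeconst_set s hs hinv := by
    have hiter : ∀ n, T^[n] ⁻¹' s = s := fun n => by
      induction n with
      | zero => rfl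
      | succ n ih => rw [Function.iterate_succ, Set.preimage_comp, ih, hinv]
    have hlim := h s s hs hs
    have hp' : (p : ℝ) ≠ 0 := by exact_mod_cast hp.ne'
    simp only [IsAveragedMixing, hiter, Set.inter_self, Finset.sum_const, Finset.card_range,
      nsmul_eq_mul] at hlim
    have heq := tendsto_nhds_unique hlim tendsto_const_nhds
    have h01 : m.real s = 0 ∨ m.real s = 1 := by
      have : m.real s * (m.real s - 1) = 0 := by
        rw [← mul_assoc, one_div, inv_mul_cancel₀ hp', one_mul] at heq
        linarith
      rcases mul_eq_zero.1 this with h | h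
      · exact Or.inl h
      · exact Or.inr (by linarith)
    rw [eventuallyConst_set']
    rcases h01 with h | h
    · exact Or.inl (ae_eq_empty.2 ((measureReal_eq_zero_iff (measure_ne_top _ _)).1 h))
    · refine Or.inr (ae_eq_univ.2 ?_)
      rw [prob_compl_eq_zero_iff hs]
      rw [measureReal_def] at h
      rwa [ENNReal.toReal_eq_one_iff] at h

theorem isStrongMixing_of_isAveragedMixing_one [IsProbabilityMeasure m]
    (hT : MeasurePreserving T m m)
    (h : ∀ E F, MeasurableSet E → MeasurableSet F → IsAveragedMixing T m 1 E F) :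
    MeasurePreservingMap.IsStrongMixing T m := by
  refine ⟨hT, fun E F hE hF => ?_⟩
  have hlim := h E F hE hF
  simp only [IsAveragedMixing, Nat.cast_one, div_one, one_mul, Finset.range_one,
    Finset.sum_singleton, add_zero] at hlim
  have := ENNReal.tendsto_ofReal hlim
  rw [ENNReal.ofReal_mul measureReal_nonneg] at this
  simpa only [ofReal_measureReal (measure_ne_top m _)] using this

end Mixing

/-! ### Finite-valued maps -/

section FiniteValued

variable {Ω ι : Type*} [MeasurableSpace Ω] [Fintype ι] [MeasurableSpace ι]
  [DiscreteMeasurableSpace ι] {m : Measure Ω} [IsFiniteMeasure m] {f : Ω → ι}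

open Classical in
theorem measureReal_preimage_eq_sum (hf : Measurable f) (W : Set ι) :
    m.real (f ⁻¹' W) = ∑ w, if w ∈ W then m.real (f ⁻¹' {w}) else 0 := by
  rw [← Finset.sum_filter, sum_measureReal_preimage_singleton _
    fun y _ => hf (measurableSet_singleton y)]
  simp

theorem measureReal_eq_sum_inter (hf : Measurable f) (A : Set Ω) :
    m.real A = ∑ w, m.real (A ∩ f ⁻¹' {w}) := by
  have h := sum_measureReal_preimage_singleton (μ := m.restrict A) (Finset.univ : Finset ι) (f := f)
    fun y _ => hf (measurableSet_singleton y)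
  simp only [Finset.coe_univ, Set.preimage_univ] at h
  rw [measureReal_restrict_apply MeasurableSet.univ, Set.univ_inter] at h
  rw [← h]
  refine Finset.sum_congr rfl fun w _ => ?_
  rw [measureReal_restrict_apply (hf (measurableSet_singleton w)), Set.inter_comm]

end FiniteValued

/-! ### Windows and local sets in shift spaces -/

namespace ShiftSpace

variable {S : Type*}

/-- The word `x_α x_{α+1} ⋯ x_{α+n-1}`. -/
def window (X : Set (ℤ → S)) (α : ℤ) (n : ℕ) (x : X) : Fin n → S := fun i => x.1 (α + i)

/-- The sets determined by finitely many coordinates. -/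
def localSets (X : Set (ℤ → S)) : Set (Set X) :=
  {E | ∃ r : ℕ, ∀ x y : X, (∀ i : ℤ, |i| ≤ r → x.1 i = y.1 i) → x ∈ E → y ∈ E}

variable {X : Set (ℤ → S)}

theorem cylinder_eq_preimage (α : ℤ) {n : ℕ} (w : Fin n → S) :
    cylinder X α w = window X α n ⁻¹' {w} := by
  ext x
  simp [cylinder, window, funext_iff]

theorem cylinder_append (α : ℤ) {k n : ℕ} (a : Fin k → S) (b : Fin n → S) :
    cylinder X α (Fin.append a b) = cylinder X α a ∩ cylinder X (α + k) b := by
  ext x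
  simp only [cylinder, Set.mem_ofPred_eq, Set.mem_inter_iff]
  constructor
  · intro h
    refine ⟨fun i => ?_, fun i => ?_⟩
    · simpa using h (Fin.castAdd n i)
    · simpa [add_assoc] using h (Fin.natAdd k i)
  · rintro ⟨h1, h2⟩ i
    refine Fin.addCases (fun i => ?_) (fun i => ?_) i
    · simpa using h1 i
    · simpa [add_assoc] using h2 i

theorem isSetAlgebra_localSets : IsSetAlgebra (localSets X) where
  empty_mem := ⟨0, fun _ _ _ h => h⟩
  compl_mem := by
    rintro E ⟨r, hr⟩
    exact ⟨r, fun x y hxy hx hy => hx (hr y x (fun i hi => (hxy i hi).symm) hy)⟩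
  union_mem := by
    rintro E F ⟨r, hr⟩ ⟨s, hs⟩
    refine ⟨max r s, fun x y hxy hx => ?_⟩
    rcases hx with hx | hx
    · exact Or.inl (hr x y (fun i hi => hxy i (hi.trans (by exact_mod_cast le_max_left r s))) hx)
    · exact Or.inr (hs x y (fun i hi => hxy i (hi.trans (by exact_mod_cast le_max_right r s))) hx)

/-- Any larger window works as well, so finitely many local sets can be read off one common window.
-/
theorem exists_eq_preimage_window {E : Set X} (hE : E ∈ localSets X) :
    ∃ r₀ : ℕ, ∀ r ≥ r₀, ∃ W : Set (Fin (2 * r + 1) → S),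
      E = window X (-(r : ℤ)) (2 * r + 1) ⁻¹' W := by
  obtain ⟨r₀, hr₀⟩ := hE
  refine ⟨r₀, fun r hr => ⟨window X (-(r : ℤ)) (2 * r + 1) '' E, ?_⟩⟩
  refine Set.Subset.antisymm (Set.subset_preimage_image _ _) ?_
  rintro y ⟨x, hx, hxy⟩
  refine hr₀ x y (fun i hi => ?_) hx
  rw [abs_le] at hi
  have := congrFun hxy ⟨(i + r).toNat, by omega⟩
  simp only [window] at this
  rwa [show -(r : ℤ) + ((i + r).toNat : ℕ) = i by omega] at this

theorem preimage_window_mem_localSets (α : ℤ) (n : ℕ) (W : Set (Fin n → S)) :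
    window X α n ⁻¹' W ∈ localSets X := by
  refine ⟨α.natAbs + n, fun x y hxy hx => ?_⟩
  have : window X α n y = window X α n x := by
    funext i
    refine (hxy _ ?_).symm
    rw [abs_le]
    have := i.2
    omega
  rwa [Set.mem_preimage, this]

section Shift

variable (hX : Set.MapsTo (SymbolicDynamics.FullShift.shift (1 : ℤ)) X X)

theorem shiftMap_iterate_apply (n : ℕ) (x : X) (i : ℤ) :
    ((shiftMap X hX)^[n] x).1 i = x.1 (n + i) := by
  induction n generalizing x with
  | zero => simp
  | succ n ih =>
    rw [Function.iterate_succ_apply, ih]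
    change x.1 (1 + (n + i)) = _
    exact congrArg x.1 (by push_cast; ring)

theorem window_shiftMap_iterate (n k : ℕ) (α : ℤ) (x : X) :
    window X α k ((shiftMap X hX)^[n] x) = window X (α + n) k x := by
  funext i
  rw [window, window, shiftMap_iterate_apply]
  exact congrArg x.1 (by ring)

theorem preimage_cylinder (n : ℕ) (α : ℤ) {k : ℕ} (w : Fin k → S) :
    (shiftMap X hX)^[n] ⁻¹' cylinder X α w = cylinder X (α + n) w := by
  ext x
  rw [cylinder_eq_preimage, cylinder_eq_preimage, Set.mem_preimage, Set.mem_preimage,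
    Set.mem_preimage, window_shiftMap_iterate]

end Shift

variable [MeasurableSpace S]

theorem measurable_window (α : ℤ) (n : ℕ) : Measurable (window X α n) :=
  measurable_pi_lambda _ fun _ => (measurable_pi_apply _).comp measurable_subtype_coe

theorem measurable_shiftMap (hX : Set.MapsTo (SymbolicDynamics.FullShift.shift (1 : ℤ)) X X) :
    Measurable (shiftMap X hX) := by
  have h : Measurable fun x : X => fun i : ℤ => x.1 (1 + i) :=
    measurable_pi_lambda _ fun i => (measurable_pi_apply (1 + i)).comp measurable_subtype_coe
  exact h.subtype_mk (h := fun x => hX x.2)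

variable [DiscreteMeasurableSpace S]

theorem measurableSet_cylinder [Countable S] (α : ℤ) {n : ℕ} (w : Fin n → S) :
    MeasurableSet (cylinder X α w) := by
  rw [cylinder_eq_preimage]
  exact measurable_window α n (measurableSet_singleton w)

variable [Fintype S]

theorem measurableSet_of_mem_localSets {E : Set X} (hE : E ∈ localSets X) : MeasurableSet E := by
  obtain ⟨r₀, h⟩ := exists_eq_preimage_window hE
  obtain ⟨W, rfl⟩ := h r₀ le_rfl
  exact measurable_window _ _ W.toFinite.measurableSet

theorem generateFrom_localSets :
    (inferInstance : MeasurableSpace X) = MeasurableSpace.generateFrom (localSets X) := by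
  refine le_antisymm ?_ (MeasurableSpace.generateFrom_le fun E hE =>
    measurableSet_of_mem_localSets hE)
  have : @Measurable X (ℤ → S) (MeasurableSpace.generateFrom (localSets X)) _ Subtype.val := by
    refine @measurable_pi_lambda _ _ _ (MeasurableSpace.generateFrom (localSets X)) _ _ fun i => ?_
    refine @measurable_to_countable' _ _ _ _ (MeasurableSpace.generateFrom (localSets X)) _
      fun s => MeasurableSpace.measurableSet_generateFrom ?_
    have h := preimage_window_mem_localSets (X := X) i 1 {fun _ => s}
    convert h using 1
    ext x
    simp [window, funext_iff]
  exact measurable_iff_comap_le.1 this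

theorem measureDense_localSets (m : Measure X) [IsFiniteMeasure m] :
    m.MeasureDense (localSets X) :=
  Measure.MeasureDense.of_generateFrom_isSetAlgebra_finite m isSetAlgebra_localSets
    generateFrom_localSets

/-- Finite measures on a shift space of the same mass that agree on cylinders are equal. -/
theorem measure_ext {m m' : Measure X} [IsProbabilityMeasure m] [IsProbabilityMeasure m']
    (h : ∀ (n : ℕ) (w : Fin n → S) (α : ℤ), m.real (cylinder X α w) = m'.real (cylinder X α w)) :
    m = m' := by
  refine ext_of_generate_finite (localSets X) generateFrom_localSets
    (fun E hE F hF _ => isSetAlgebra_localSets.inter_mem hE hF) (fun E hE => ?_) (by simp)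
  obtain ⟨r₀, hr₀⟩ := exists_eq_preimage_window hE
  obtain ⟨W, rfl⟩ := hr₀ r₀ le_rfl
  rw [← measureReal_eq_measureReal_iff,
    measureReal_preimage_eq_sum (measurable_window _ _),
    measureReal_preimage_eq_sum (measurable_window _ _)]
  simp only [← cylinder_eq_preimage, h]

theorem measurePreserving_shiftMap
    (hX : Set.MapsTo (SymbolicDynamics.FullShift.shift (1 : ℤ)) X X) {m : Measure X}
    [IsProbabilityMeasure m]
    (h : ∀ (n : ℕ) (w : Fin n → S) (α : ℤ),
      m.real (cylinder X (α + 1) w) = m.real (cylinder X α w)) :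
    MeasurePreserving (shiftMap X hX) m m := by
  have hmeas := measurable_shiftMap hX
  refine ⟨hmeas, ?_⟩
  have := Measure.isProbabilityMeasure_map (μ := m) hmeas.aemeasurable
  refine measure_ext fun n w α => ?_
  rw [map_measureReal_apply hmeas (measurableSet_cylinder α w), ← h n w α]
  congr 1
  simpa using preimage_cylinder hX 1 α w

end ShiftSpace

end

noncomputable section

open PerronFrobenius ShiftSpace

/-! ### Shift spaces presented by partial-map matrices -/

section Presentation

theorem Matrix.exists_ne_zero {m n : Type*} {W : Matrix m n ℝ} (h : W ≠ 0) : ∃ i j, W i j ≠ 0 := by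
  by_contra! h'
  exact h (Matrix.ext h')

variable {V S : Type*} [Fintype V] [DecidableEq V]

open Classical in
/-- The indicator of the words with non-zero matrix. -/
def wordIndicator (M : S → Matrix V V ℝ) (w : List S) : ℝ := if wordMatrix M w ≠ 0 then 1 else 0

theorem wordIndicator_nonneg (M : S → Matrix V V ℝ) (w : List S) : 0 ≤ wordIndicator M w := by
  rw [wordIndicator]
  split_ifs <;> simp

variable [Fintype S] [MeasurableSpace S]

/-- A measure on a shift space whose points carry only words with non-zero matrix, with the
Perron weights as measures of cylinders. -/
structure IsPerronPresentation (X : Set (ℤ → S)) (M : S → Matrix V V ℝ) (lam : ℝ) (u v : V → ℝ)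
    (p : ℕ) (c : V → ZMod p) (μ : Measure X) : Prop where
  partialMap : ∀ s, IsPartialMapMatrix (M s)
  lam_pos : 0 < lam
  chain : IsCyclicChain (lam⁻¹ • ∑ s, M s) u v p c
  isProbabilityMeasure : IsProbabilityMeasure μ
  measure_cylinder : ∀ (n : ℕ) (w : Fin n → S) (α : ℤ),
    μ.real (cylinder X α w) = wordWeight M lam u v (List.ofFn w)
  support : ∀ (x : X) (α : ℤ) (n : ℕ), wordMatrix M (List.ofFn (window X α n x)) ≠ 0

namespace IsPerronPresentation

variable {X : Set (ℤ → S)} {M : S → Matrix V V ℝ} {lam : ℝ} {u v : V → ℝ} {p : ℕ}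
  {c : V → ZMod p} {μ : Measure X}

theorem wordMatrix_isPartialMapMatrix (h : IsPerronPresentation X M lam u v p c μ) (w : List S) :
    IsPartialMapMatrix (wordMatrix M w) :=
  isPartialMapMatrix_wordMatrix h.partialMap w

theorem wordWeight_nonneg (h : IsPerronPresentation X M lam u v p c μ) (w : List S) :
    0 ≤ wordWeight M lam u v w :=
  _root_.wordWeight_nonneg (fun s => (h.partialMap s).nonneg) h.lam_pos h.chain.left_pos
    h.chain.right_pos w

/-- Lower Gibbs bound: a non-zero 0-1 matrix has an entry 1, which contributes at least the minimum
of the products u_i v_j. -/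
theorem exists_le_wordWeight (h : IsPerronPresentation X M lam u v p c μ) :
    ∃ b : ℝ, 0 < b ∧ ∀ w, b * wordIndicator M w / lam ^ w.length ≤ wordWeight M lam u v w := by
  have hpos : ∀ q : V × V, 0 < u q.1 * v q.2 := fun q =>
    mul_pos (h.chain.left_pos _) (h.chain.right_pos _)
  have hne : Nonempty V := by
    by_contra h'
    rw [not_nonempty_iff] at h'
    simpa using h.chain.normalized
  obtain ⟨q, -, hq⟩ := Finset.exists_min_image Finset.univ (fun q : V × V => u q.1 * v q.2)
    Finset.univ_nonempty
  refine ⟨u q.1 * v q.2, hpos q, fun w => ?_⟩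
  rw [wordIndicator]
  split_ifs with hw
  · rw [mul_one, wordWeight]
    refine div_le_div_of_nonneg_right ?_ (pow_nonneg h.lam_pos.le _)
    obtain ⟨i, j, hij⟩ := Matrix.exists_ne_zero hw
    have hP := h.wordMatrix_isPartialMapMatrix w
    calc u q.1 * v q.2 ≤ u i * v j := hq (i, j) (Finset.mem_univ _)
      _ = u i * (wordMatrix M w *ᵥ v) i := by
        rw [Matrix.mulVec, dotProduct, hP.sum_row_mul hij]
      _ ≤ u ⬝ᵥ (wordMatrix M w *ᵥ v) :=
        Finset.single_le_sum (f := fun i => u i * (wordMatrix M w *ᵥ v) i)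
          (fun k _ => mul_nonneg (h.chain.left_pos k).le (Finset.sum_nonneg fun l _ =>
            mul_nonneg (hP.nonneg k l) (h.chain.right_pos l).le)) (Finset.mem_univ i)
  · simpa using h.wordWeight_nonneg w

/-- Upper Gibbs bound: all entries of the matrix of a word are at most 1. -/
theorem exists_wordWeight_le (h : IsPerronPresentation X M lam u v p c μ) :
    ∃ C : ℝ, 0 < C ∧ ∀ w, wordWeight M lam u v w ≤ C * wordIndicator M w / lam ^ w.length := by
  have hne : Nonempty V := by
    by_contra h'
    rw [not_nonempty_iff] at h'
    simpa using h.chain.normalized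
  refine ⟨∑ i, ∑ j, u i * v j, Finset.sum_pos (fun i _ => Finset.sum_pos (fun j _ =>
    mul_pos (h.chain.left_pos i) (h.chain.right_pos j)) Finset.univ_nonempty)
    Finset.univ_nonempty, fun w => ?_⟩
  rw [wordIndicator]
  split_ifs with hw
  · rw [mul_one, wordWeight]
    refine div_le_div_of_nonneg_right ?_ (pow_nonneg h.lam_pos.le _)
    refine Finset.sum_le_sum fun i _ => ?_
    rw [Matrix.mulVec, dotProduct, Finset.mul_sum]
    refine Finset.sum_le_sum fun j _ => ?_
    refine mul_le_mul_of_nonneg_left ?_ (h.chain.left_pos i).le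
    refine mul_le_of_le_one_left (h.chain.right_pos j).le ?_
    rcases (h.wordMatrix_isPartialMapMatrix w).zero_or_one i j with h0 | h0 <;> simp [h0]
  · push Not at hw
    simp [wordWeight, hw]

/-- Words of points have non-zero matrix by `support`. Conversely a non-zero matrix gives the
cylinder positive mass, so the cylinder is not empty. -/
theorem blocks_eq (h : IsPerronPresentation X M lam u v p c μ) (n : ℕ) :
    blocks X n = {w | wordMatrix M (List.ofFn w) ≠ 0} := by
  ext w
  constructor
  · rintro ⟨α, x, hx⟩
    have := h.support x α n
    rw [cylinder_eq_preimage] at hx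
    rwa [Set.mem_preimage.1 hx] at this
  · intro hw
    rw [Set.mem_ofPred_eq] at hw
    refine ⟨0, Set.nonempty_iff_ne_empty.2 fun hempty => ?_⟩
    have h1 := h.measure_cylinder n w 0
    rw [hempty, measureReal_empty] at h1
    obtain ⟨b, hb, hle⟩ := h.exists_le_wordWeight
    have h2 := hle (List.ofFn w)
    rw [← h1, wordIndicator, if_pos hw, mul_one] at h2
    exact absurd h2 (not_le.2 (div_pos hb (pow_pos h.lam_pos _)))

theorem ncard_blocks (h : IsPerronPresentation X M lam u v p c μ) (n : ℕ) :
    ((blocks X n).ncard : ℝ) = ∑ w : Fin n → S, wordIndicator M (List.ofFn w) := by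
  classical
  rw [h.blocks_eq, Set.ncard_eq_toFinset_card', Set.toFinset_ofPred]
  simp only [wordIndicator]
  rw [Finset.sum_boole]

theorem ncard_blocksThrough (h : IsPerronPresentation X M lam u v p c μ) {n : ℕ} (w : Fin n → S)
    (k l : ℕ) :
    ((blocksThrough X w k l).ncard : ℝ) = ∑ a : Fin k → S, ∑ b : Fin l → S,
      wordIndicator M (List.ofFn a ++ List.ofFn w ++ List.ofFn b) := by
  classical
  simp only [← List.ofFn_append_append]
  rw [← Fin.sum_middle w (fun x => wordIndicator M (List.ofFn x)), blocksThrough, h.blocks_eq,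
    Set.ncard_eq_toFinset_card', Set.toFinset_ofPred]
  simp only [wordIndicator, ← ite_and]
  rw [Finset.sum_boole]
  congr 2
  ext x
  simp [and_comm]

theorem sum_wordWeight_ofFn (h : IsPerronPresentation X M lam u v p c μ) (n : ℕ) :
    ∑ w : Fin n → S, wordWeight M lam u v (List.ofFn w) = 1 := by
  simp only [wordWeight, List.length_ofFn]
  rw [← Finset.sum_div, ← dotProduct_sum, ← Matrix.sum_mulVec, sum_wordMatrix_ofFn]
  have := h.chain.pow_mulVec n
  rw [smul_pow, Matrix.smul_mulVec] at this
  have h2 := congrArg (u ⬝ᵥ ·) this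
  simp only [dotProduct_smul, h.chain.normalized, smul_eq_mul] at h2
  rwa [inv_pow, inv_mul_eq_div] at h2

/-- The weights of the words of length n add up to 1, so the Gibbs bounds turn into bounds on the
number of words: here from above, next from below. -/
theorem exists_sum_wordIndicator_le (h : IsPerronPresentation X M lam u v p c μ) :
    ∃ C : ℝ, 0 < C ∧ ∀ n, ∑ w : Fin n → S, wordIndicator M (List.ofFn w) ≤ C * lam ^ n := by
  obtain ⟨b, hb, hle⟩ := h.exists_le_wordWeight
  refine ⟨b⁻¹, inv_pos.2 hb, fun n => ?_⟩
  have h1 := Finset.sum_le_sum fun (w : Fin n → S) (_ : w ∈ Finset.univ) => hle (List.ofFn w)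
  simp only [List.length_ofFn] at h1
  rw [h.sum_wordWeight_ofFn, ← Finset.sum_div, ← Finset.mul_sum,
    div_le_one (pow_pos h.lam_pos _)] at h1
  rwa [inv_mul_eq_div, le_div_iff₀ hb, mul_comm]

theorem exists_le_sum_wordIndicator (h : IsPerronPresentation X M lam u v p c μ) :
    ∃ b : ℝ, 0 < b ∧ ∀ n, b * lam ^ n ≤ ∑ w : Fin n → S, wordIndicator M (List.ofFn w) := by
  obtain ⟨C, hC, hle⟩ := h.exists_wordWeight_le
  refine ⟨C⁻¹, inv_pos.2 hC, fun n => ?_⟩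
  have h1 := Finset.sum_le_sum fun (w : Fin n → S) (_ : w ∈ Finset.univ) => hle (List.ofFn w)
  simp only [List.length_ofFn] at h1
  rw [h.sum_wordWeight_ofFn, ← Finset.sum_div, ← Finset.mul_sum,
    one_le_div (pow_pos h.lam_pos _)] at h1
  rwa [inv_mul_eq_div, div_le_iff₀ hC, mul_comm]

/-- The words filling a gap of length g sum to the g-th power of the normalized matrix, which
reduces correlations of cylinders to the powers of a cyclic chain. -/
theorem sum_wordWeight_gap (h : IsPerronPresentation X M lam u v p c μ) (w w' : List S) (g : ℕ) :
    ∑ b : Fin g → S, wordWeight M lam u v (w ++ List.ofFn b ++ w') =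
      ∑ i, ∑ j, (u ᵥ* wordMatrix M w) i / lam ^ w.length *
        ((lam⁻¹ • ∑ s, M s) ^ g) i j * ((wordMatrix M w' *ᵥ v) j / lam ^ w'.length) := by
  have hlam := h.lam_pos.ne'
  simp only [wordWeight, wordMatrix_append, List.length_append, List.length_ofFn]
  rw [← Finset.sum_div, ← dotProduct_sum, ← Matrix.sum_mulVec, ← Finset.sum_mul, ← Finset.mul_sum,
    sum_wordMatrix_ofFn, smul_pow, ← Matrix.mulVec_mulVec, ← Matrix.mulVec_mulVec,
    Matrix.dotProduct_mulVec]
  rw [dotProduct, Finset.sum_div]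
  refine Finset.sum_congr rfl fun i _ => ?_
  rw [Matrix.mulVec, dotProduct, Finset.mul_sum, Finset.sum_div]
  refine Finset.sum_congr rfl fun j _ => ?_
  rw [Matrix.smul_apply, smul_eq_mul, inv_pow, pow_add, pow_add]
  field_simp

variable [DiscreteMeasurableSpace S]

theorem measurePreserving (h : IsPerronPresentation X M lam u v p c μ)
    (hX : Set.MapsTo (SymbolicDynamics.FullShift.shift (1 : ℤ)) X X) :
    MeasurePreserving (shiftMap X hX) μ μ := by
  have := h.isProbabilityMeasure
  exact measurePreserving_shiftMap hX fun n w α => by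
    rw [h.measure_cylinder, h.measure_cylinder]

theorem measure_cylinder_inter (h : IsPerronPresentation X M lam u v p c μ) (α : ℤ) {n k : ℕ}
    (w : Fin n → S) (w' : Fin k → S) (g : ℕ) :
    μ.real (cylinder X (α + (n + g : ℕ)) w' ∩ cylinder X α w) =
      ∑ b : Fin g → S, wordWeight M lam u v (List.ofFn w ++ List.ofFn b ++ List.ofFn w') := by
  have := h.isProbabilityMeasure
  rw [measureReal_eq_sum_inter (measurable_window (X := X) (α + n) g)]
  refine Finset.sum_congr rfl fun b _ => ?_
  rw [← List.ofFn_append_append, ← h.measure_cylinder _ _ α, cylinder_append, cylinder_append,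
    ← cylinder_eq_preimage]
  congr 1
  push_cast
  rw [← add_assoc]
  ext x
  simp only [Set.mem_inter_iff]
  tauto

theorem isAveragedMixing_cylinder (h : IsPerronPresentation X M lam u v p c μ) [NeZero p]
    (hX : Set.MapsTo (SymbolicDynamics.FullShift.shift (1 : ℤ)) X X) (α : ℤ) {n k : ℕ}
    (w : Fin n → S) (w' : Fin k → S) :
    IsAveragedMixing (shiftMap X hX) μ p (cylinder X α w') (cylinder X α w) := by
  -- Delaying time by the length of w puts the shifted cylinder to the right of the first one, with
  -- a gap of non-negative length.
  rw [IsAveragedMixing, ← tendsto_add_atTop_iff_nat n]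
  set x : V → ℝ := fun i => (u ᵥ* wordMatrix M (List.ofFn w)) i / lam ^ (List.ofFn w).length with hx
  set y : V → ℝ := fun j => (wordMatrix M (List.ofFn w') *ᵥ v) j / lam ^ (List.ofFn w').length
    with hy
  have hterm : ∀ g j, μ.real ((shiftMap X hX)^[g + n + j] ⁻¹' cylinder X α w' ∩ cylinder X α w) =
      ∑ a, ∑ b, x a * ((lam⁻¹ • ∑ s, M s) ^ (g + j)) a b * y b := by
    intro g j
    rw [preimage_cylinder, show g + n + j = n + (g + j) by ring, h.measure_cylinder_inter,
      h.sum_wordWeight_gap]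
  have hlim : Tendsto (fun g : ℕ => ∑ a, ∑ b, x a * ((1 / (p : ℝ)) * ∑ j ∈ Finset.range p,
      ((lam⁻¹ • ∑ s, M s) ^ (g + j)) a b) * y b) atTop
      (𝓝 (∑ a, ∑ b, x a * (v a * u b) * y b)) :=
    tendsto_finsetSum _ fun a _ => tendsto_finsetSum _ fun b _ =>
      ((h.chain.tendsto_average_pow a b).const_mul (x a)).mul_const (y b)
  have hval : ∑ a, ∑ b, x a * (v a * u b) * y b =
      μ.real (cylinder X α w') * μ.real (cylinder X α w) := by
    rw [h.measure_cylinder, h.measure_cylinder, wordWeight, wordWeight,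
      Matrix.dotProduct_mulVec u (wordMatrix M (List.ofFn w)) v, dotProduct, dotProduct,
      Finset.sum_div, Finset.sum_div, Finset.sum_mul_sum, Finset.sum_comm]
    refine Finset.sum_congr rfl fun a _ => Finset.sum_congr rfl fun b _ => ?_
    simp only [hx, hy]
    ring
  rw [← hval]
  refine hlim.congr fun g => Eq.symm ?_
  simp only [hterm]
  rw [Finset.sum_comm, Finset.mul_sum]
  refine Finset.sum_congr rfl fun a _ => ?_
  rw [Finset.sum_comm, Finset.mul_sum]
  refine Finset.sum_congr rfl fun b _ => ?_
  simp only [Finset.mul_sum, Finset.sum_mul]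
  exact Finset.sum_congr rfl fun j _ => by ring

theorem isAveragedMixing (h : IsPerronPresentation X M lam u v p c μ) [NeZero p]
    (hX : Set.MapsTo (SymbolicDynamics.FullShift.shift (1 : ℤ)) X X) {E F : Set X}
    (hE : MeasurableSet E) (hF : MeasurableSet F) :
    IsAveragedMixing (shiftMap X hX) μ p E F := by
  classical
  have := h.isProbabilityMeasure
  refine isAveragedMixing_of_measureDense (h.measurePreserving hX) (measureDense_localSets μ)
    (Nat.pos_of_ne_zero (NeZero.ne p)) (fun E hE F hF => ?_) hE hF
  obtain ⟨r₁, h₁⟩ := exists_eq_preimage_window hE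
  obtain ⟨r₂, h₂⟩ := exists_eq_preimage_window hF
  obtain ⟨r, hr₁, hr₂⟩ : ∃ r, r₁ ≤ r ∧ r₂ ≤ r := ⟨max r₁ r₂, le_max_left _ _, le_max_right _ _⟩
  obtain ⟨W, rfl⟩ := h₁ r hr₁
  obtain ⟨W', rfl⟩ := h₂ r hr₂
  set f := window X (-(r : ℤ)) (2 * r + 1) with hf
  have hfm : Measurable f := measurable_window _ _
  have hsplit : ∀ n, μ.real ((shiftMap X hX)^[n] ⁻¹' (f ⁻¹' W) ∩ f ⁻¹' W') =
      ∑ a, ∑ b, (if a ∈ W then if b ∈ W' then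
        μ.real ((shiftMap X hX)^[n] ⁻¹' (f ⁻¹' {a}) ∩ f ⁻¹' {b}) else 0 else 0) := by
    intro n
    have hg : Measurable fun x => (f ((shiftMap X hX)^[n] x), f x) :=
      (hfm.comp ((measurable_shiftMap hX).iterate n)).prodMk hfm
    have h3 := measureReal_preimage_eq_sum (m := μ) hg (W ×ˢ W')
    rw [Fintype.sum_prod_type] at h3
    refine (h3.trans ?_)
    refine Finset.sum_congr rfl fun a _ => Finset.sum_congr rfl fun b _ => ?_
    rw [← Set.singleton_prod_singleton, Set.mk_preimage_prod]
    simp only [Set.mem_prod, ite_and]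
    rfl
  have hlim : Tendsto (fun n : ℕ => ∑ a, ∑ b, (if a ∈ W then if b ∈ W' then
      (1 / (p : ℝ)) * ∑ j ∈ Finset.range p,
        μ.real ((shiftMap X hX)^[n + j] ⁻¹' (f ⁻¹' {a}) ∩ f ⁻¹' {b}) else 0 else 0)) atTop
      (𝓝 (∑ a, ∑ b, (if a ∈ W then if b ∈ W' then μ.real (f ⁻¹' {a}) * μ.real (f ⁻¹' {b})
        else 0 else 0))) := by
    refine tendsto_finsetSum _ fun a _ => tendsto_finsetSum _ fun b _ => ?_
    split_ifs
    · have := h.isAveragedMixing_cylinder hX (-(r : ℤ)) b a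
      rw [cylinder_eq_preimage, cylinder_eq_preimage] at this
      exact this
    · exact tendsto_const_nhds
    · exact tendsto_const_nhds
  have hval : ∑ a, ∑ b, (if a ∈ W then if b ∈ W' then μ.real (f ⁻¹' {a}) * μ.real (f ⁻¹' {b})
        else 0 else 0) = μ.real (f ⁻¹' W) * μ.real (f ⁻¹' W') := by
    rw [measureReal_preimage_eq_sum hfm W, measureReal_preimage_eq_sum hfm W', Finset.sum_mul_sum]
    refine Finset.sum_congr rfl fun a _ => Finset.sum_congr rfl fun b _ => ?_
    split_ifs <;> simp
  rw [IsAveragedMixing, ← hval]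
  refine hlim.congr fun n => Eq.symm ?_
  simp only [hsplit]
  rw [Finset.sum_comm, Finset.mul_sum]
  refine Finset.sum_congr rfl fun a _ => ?_
  rw [Finset.sum_comm, Finset.mul_sum]
  refine Finset.sum_congr rfl fun b _ => ?_
  split_ifs <;> simp

theorem ergodic (h : IsPerronPresentation X M lam u v p c μ) [NeZero p]
    (hX : Set.MapsTo (SymbolicDynamics.FullShift.shift (1 : ℤ)) X X) :
    Ergodic (shiftMap X hX) μ := by
  have := h.isProbabilityMeasure
  exact ergodic_of_isAveragedMixing (h.measurePreserving hX) (Nat.pos_of_ne_zero (NeZero.ne p))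
    fun E F hE hF => h.isAveragedMixing hX hE hF

end IsPerronPresentation

end Presentation

end

noncomputable section

open PerronFrobenius ShiftSpace

/-! ### Words of minimal rank -/

section Magic

variable {V S : Type*} [Fintype V]

open Classical in
/-- The indices of the non-zero columns. -/
def Matrix.columnSupport (W : Matrix V V ℝ) : Finset V := {j | ∃ i, W i j ≠ 0}

theorem Matrix.mem_columnSupport {W : Matrix V V ℝ} {j : V} :
    j ∈ W.columnSupport ↔ ∃ i, W i j ≠ 0 := by simp [Matrix.columnSupport]

theorem Matrix.columnSupport_nonempty {W : Matrix V V ℝ} (h : W ≠ 0) : W.columnSupport.Nonempty := by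
  obtain ⟨i, j, hij⟩ := Matrix.exists_ne_zero h
  exact ⟨j, Matrix.mem_columnSupport.2 ⟨i, hij⟩⟩

theorem Matrix.columnSupport_mul_subset (A B : Matrix V V ℝ) :
    (A * B).columnSupport ⊆ B.columnSupport := by
  intro j hj
  obtain ⟨i, hij⟩ := Matrix.mem_columnSupport.1 hj
  rw [Matrix.mul_apply] at hij
  obtain ⟨k, -, hk⟩ := Finset.exists_ne_zero_of_sum_ne_zero hij
  exact Matrix.mem_columnSupport.2 ⟨k, right_ne_zero_of_mul hk⟩

open Classical in
-- A terminal vertex of the product is the image, under the partial map B, of a terminal vertex of A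
-- in the domain of B. Choosing such preimages is injective because B is single-valued.
theorem IsPartialMapMatrix.card_columnSupport_mul_le (A : Matrix V V ℝ) {B : Matrix V V ℝ}
    (hB : IsPartialMapMatrix B) :
    (A * B).columnSupport.card ≤ (A.columnSupport.filter fun k => ∃ j, B k j ≠ 0).card := by
  have h : ∀ j ∈ (A * B).columnSupport, ∃ k, k ∈ A.columnSupport ∧ B k j ≠ 0 := by
    intro j hj
    obtain ⟨i, hij⟩ := Matrix.mem_columnSupport.1 hj
    rw [Matrix.mul_apply] at hij
    obtain ⟨k, -, hk⟩ := Finset.exists_ne_zero_of_sum_ne_zero hij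
    exact ⟨k, Matrix.mem_columnSupport.2 ⟨i, left_ne_zero_of_mul hk⟩, right_ne_zero_of_mul hk⟩
  choose! k hk hkB using h
  refine Finset.card_le_card_of_injOn k
    (fun j hj => Finset.mem_filter.2 ⟨hk j hj, j, hkB j hj⟩) fun j hj j' hj' heq => ?_
  refine hB.unique (k j) j j' (hkB j hj) ?_
  rw [heq]
  exact hkB j' hj'

variable [DecidableEq V]

/-- A word with non-zero matrix of minimal rank. -/
def IsMagicWord (M : S → Matrix V V ℝ) (w : List S) : Prop :=
  wordMatrix M w ≠ 0 ∧ ∀ w', wordMatrix M w' ≠ 0 →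
    (wordMatrix M w).columnSupport.card ≤ (wordMatrix M w').columnSupport.card

theorem exists_isMagicWord [Nonempty V] (M : S → Matrix V V ℝ) : ∃ w, IsMagicWord M w := by
  obtain ⟨w, hw, hmin⟩ := WellFounded.has_min
    (measure fun w : List S => (wordMatrix M w).columnSupport.card).wf
    {w | wordMatrix M w ≠ 0} ⟨[], by simp⟩
  exact ⟨w, hw, fun w' hw' => not_lt.1 (hmin w' hw')⟩

variable {M : S → Matrix V V ℝ}

/-- Extending a word on either side cannot increase the number of its terminal vertices, so
minimality persists as long as the matrix remains non-zero. -/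
theorem IsMagicWord.append_left {w : List S} (h : IsMagicWord M w) {a : List S}
    (ha : wordMatrix M (a ++ w) ≠ 0) : IsMagicWord M (a ++ w) := by
  refine ⟨ha, fun w' hw' => le_trans ?_ (h.2 w' hw')⟩
  rw [wordMatrix_append]
  exact Finset.card_le_card (Matrix.columnSupport_mul_subset _ _)

theorem IsMagicWord.append_right (hM : ∀ s, IsPartialMapMatrix (M s)) {w : List S}
    (h : IsMagicWord M w) {b : List S} (hb : wordMatrix M (w ++ b) ≠ 0) : IsMagicWord M (w ++ b) := by
  classical
  refine ⟨hb, fun w' hw' => le_trans ?_ (h.2 w' hw')⟩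
  rw [wordMatrix_append]
  exact ((isPartialMapMatrix_wordMatrix hM b).card_columnSupport_mul_le _).trans
    (Finset.card_le_card (Finset.filter_subset _ _))

/-- The continuations of a word of minimal rank can be counted by counting paths. -/
theorem IsMagicWord.wordIndicator_append (hM : ∀ s, IsPartialMapMatrix (M s)) {y : List S}
    (h : IsMagicWord M y) (b : List S) :
    wordIndicator M (y ++ b) = ((wordMatrix M y).columnSupport.card : ℝ)⁻¹ *
      ∑ k ∈ (wordMatrix M y).columnSupport, ∑ j, wordMatrix M b k j := by
  classical
  have hB := isPartialMapMatrix_wordMatrix hM b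
  have hcard : ((wordMatrix M y).columnSupport.card : ℝ) ≠ 0 := by
    exact_mod_cast (Finset.card_pos.2 (Matrix.columnSupport_nonempty h.1)).ne'
  rw [wordIndicator]
  split_ifs with hyb
  · have h1 : (wordMatrix M y).columnSupport.card ≤
        ((wordMatrix M y).columnSupport.filter fun k => ∃ j, wordMatrix M b k j ≠ 0).card := by
      refine (h.2 _ hyb).trans ?_
      rw [wordMatrix_append]
      exact hB.card_columnSupport_mul_le _
    have h2 := Finset.eq_of_subset_of_card_le (Finset.filter_subset _ _) h1
    have h3 : ∑ k ∈ (wordMatrix M y).columnSupport, ∑ j, wordMatrix M b k j =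
        (wordMatrix M y).columnSupport.card := by
      rw [Finset.sum_congr rfl (g := fun _ => (1 : ℝ))]
      · simp
      · intro k hk
        rw [← h2] at hk
        rw [hB.sum_row_eq_ite, if_pos (Finset.mem_filter.1 hk).2]
    rw [h3, inv_mul_cancel₀ hcard]
  · push Not at hyb
    rw [Finset.sum_eq_zero, mul_zero]
    intro k hk
    obtain ⟨i, hik⟩ := Matrix.mem_columnSupport.1 hk
    refine Finset.sum_eq_zero fun j _ => ?_
    have := congrFun (congrFun hyb i) j
    rw [wordMatrix_append, Matrix.mul_apply,
      (isPartialMapMatrix_wordMatrix hM y).sum_row_mul hik] at this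
    exact this

theorem wordIndicator_append_le (a b : List S) :
    wordIndicator M (a ++ b) ≤ wordIndicator M a * wordIndicator M b := by
  simp only [wordIndicator, wordMatrix_append]
  by_cases h1 : wordMatrix M a = 0
  · simp [h1]
  by_cases h2 : wordMatrix M b = 0
  · simp [h2]
  simp only [ne_eq, h1, h2, not_false_eq_true, if_true, mul_one]
  split_ifs <;> simp

variable [Fintype S]

open Classical in
/-- The number of words of length `K` of minimal rank that may be followed by a path starting at a
given vertex, in units of this rank. -/
def magicVector (M : S → Matrix V V ℝ) (K : ℕ) : V → ℝ := fun i =>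
  ∑ y : Fin K → S, if IsMagicWord M (List.ofFn y) ∧ i ∈ (wordMatrix M (List.ofFn y)).columnSupport
    then ((wordMatrix M (List.ofFn y)).columnSupport.card : ℝ)⁻¹ else 0

open Classical in
/-- The number of words of length `K` with non-zero matrix that are not of minimal rank. -/
def nonMagicCount (M : S → Matrix V V ℝ) (K : ℕ) : ℝ :=
  ∑ y : Fin K → S, if IsMagicWord M (List.ofFn y) then 0 else wordIndicator M (List.ofFn y)

theorem nonMagicCount_nonneg (M : S → Matrix V V ℝ) (K : ℕ) : 0 ≤ nonMagicCount M K :=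
  Finset.sum_nonneg fun y _ => by
    split_ifs
    · exact le_rfl
    · exact wordIndicator_nonneg _ _

/-- Up to the words with a prefix of non-minimal rank, words can be counted by counting paths. -/
theorem abs_sum_wordIndicator_sub_le (hM : ∀ s, IsPartialMapMatrix (M s)) (K : ℕ) {β : Type*}
    [Fintype β] (φ : β → List S) :
    |∑ y : Fin K → S, ∑ b, wordIndicator M (List.ofFn y ++ φ b) -
      magicVector M K ⬝ᵥ ((∑ b, wordMatrix M (φ b)) *ᵥ 1)| ≤
      nonMagicCount M K * ∑ b, wordIndicator M (φ b) := by
  classical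
  -- The pairing counts exactly the words with a magic prefix. The other words are then bounded by
  -- the number of non-magic prefixes times the number of continuations.
  have hgood : magicVector M K ⬝ᵥ ((∑ b, wordMatrix M (φ b)) *ᵥ 1) =
      ∑ y : Fin K → S, ∑ b, if IsMagicWord M (List.ofFn y) then
        wordIndicator M (List.ofFn y ++ φ b) else 0 := by
    simp only [dotProduct, magicVector, Finset.sum_mul]
    rw [Finset.sum_comm]
    refine Finset.sum_congr rfl fun y _ => ?_
    by_cases hy : IsMagicWord M (List.ofFn y)
    · simp only [hy, true_and, if_true, hy.wordIndicator_append hM]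
      rw [← Finset.mul_sum, Finset.sum_comm, Finset.mul_sum, ← Finset.sum_filter_add_sum_filter_not
        Finset.univ (fun i => i ∈ (wordMatrix M (List.ofFn y)).columnSupport)]
      rw [Finset.filter_mem_eq_inter, Finset.univ_inter]
      rw [Finset.sum_eq_zero (s := Finset.filter _ _), add_zero]
      · refine Finset.sum_congr rfl fun k hk => ?_
        rw [if_pos hk, Matrix.sum_mulVec, Finset.sum_apply]
        simp [Matrix.mulVec, dotProduct]
      · intro i hi
        rw [if_neg (Finset.mem_filter.1 hi).2, zero_mul]
    · simp [hy]
  rw [hgood, ← Finset.sum_sub_distrib, nonMagicCount, Finset.sum_mul]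
  refine (Finset.abs_sum_le_sum_abs _ _).trans (Finset.sum_le_sum fun y _ => ?_)
  rw [← Finset.sum_sub_distrib]
  refine (Finset.abs_sum_le_sum_abs _ _).trans ?_
  rw [Finset.mul_sum]
  refine Finset.sum_le_sum fun b _ => ?_
  split_ifs
  · simp
  · rw [sub_zero, abs_of_nonneg (wordIndicator_nonneg M _)]
    exact wordIndicator_append_le _ _

end Magic

/-! ### The natural measure -/

namespace IsPerronPresentation

variable {V S : Type*} [Fintype V] [DecidableEq V] [Fintype S] [MeasurableSpace S]
  {X : Set (ℤ → S)} {M : S → Matrix V V ℝ} {lam : ℝ} {u v : V → ℝ} {p : ℕ}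
  {c : V → ZMod p} {μ : Measure X}

theorem nonempty (h : IsPerronPresentation X M lam u v p c μ) : Nonempty V := by
  by_contra h'
  rw [not_nonempty_iff] at h'
  simpa using h.chain.normalized

theorem class_eq_of_wordMatrix_ne_zero (h : IsPerronPresentation X M lam u v p c μ) (w : List S) :
    ∀ a b, wordMatrix M w a b ≠ 0 → c b = c a + w.length := by
  induction w with
  | nil =>
    intro a b hab
    have : a = b := by
      by_contra hne
      exact hab (by simp [hne])
    simp [this]
  | cons s w ih =>
    intro a b hab
    rw [wordMatrix_cons, Matrix.mul_apply] at hab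
    obtain ⟨k, -, hk⟩ := Finset.exists_ne_zero_of_sum_ne_zero hab
    have hQ : (lam⁻¹ • ∑ s, M s) a k ≠ 0 := by
      rw [Matrix.smul_apply, Matrix.sum_apply]
      refine (mul_pos (inv_pos.2 h.lam_pos) ?_).ne'
      exact Finset.sum_pos' (fun t _ => (h.partialMap t).nonneg a k) ⟨s, Finset.mem_univ _,
        lt_of_le_of_ne ((h.partialMap s).nonneg a k) (left_ne_zero_of_mul hk).symm⟩
    rw [ih k b (right_ne_zero_of_mul hk), h.chain.step a k hQ, List.length_cons]
    push_cast
    ring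

/-- The points none of whose initial windows is magic form a set that the shift maps into itself,
since prepending a letter keeps a word magic. By ergodicity it has measure 0 or 1, and it misses the
cylinder of a magic word, which has positive measure. The lower Gibbs bound converts measure into
number of words. -/
theorem tendsto_nonMagicCount [DiscreteMeasurableSpace S]
    (h : IsPerronPresentation X M lam u v p c μ) [NeZero p]
    (hX : Set.MapsTo (SymbolicDynamics.FullShift.shift (1 : ℤ)) X X) :
    Tendsto (fun K : ℕ => nonMagicCount M K / lam ^ K) atTop (𝓝 0) := by
  classical
  have := h.isProbabilityMeasure
  have := h.nonempty
  let B : ℕ → Set X := fun K => window X 0 K ⁻¹' {y | ¬ IsMagicWord M (List.ofFn y)}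
  have hBm : ∀ K, MeasurableSet (B K) := fun K =>
    measurable_window 0 K (Set.toFinite _).measurableSet
  have hBanti : Antitone B := by
    refine antitone_nat_of_succ_le fun K x hx => ?_
    simp only [B, Set.mem_preimage, Set.mem_ofPred_eq] at hx ⊢
    refine fun hmag => hx ?_
    have e : List.ofFn (window X 0 (K + 1) x) = List.ofFn (window X 0 K x) ++ [x.1 K] := by
      have e₀ : window X 0 (K + 1) x (Fin.last K) = x.1 K := by simp [window]
      rw [List.ofFn_succ_last, e₀]
      rfl
    have hne := h.support x 0 (K + 1)
    rw [e] at hne ⊢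
    exact hmag.append_right h.partialMap hne
  have hsub : (⋂ K, B K) ⊆ shiftMap X hX ⁻¹' (⋂ K, B K) := by
    intro x hx
    simp only [Set.mem_preimage, Set.mem_iInter] at hx ⊢
    intro K hmag
    refine hx (K + 1) ?_
    have e1 : List.ofFn (window X 0 (K + 1) x) =
        [x.1 0] ++ List.ofFn (window X 0 K (shiftMap X hX x)) := by
      have e₀ : (fun i : Fin K => window X 0 (K + 1) x i.succ) =
          window X 0 K (shiftMap X hX x) := by
        have := window_shiftMap_iterate hX 1 K 0 x
        rw [Function.iterate_one] at this
        rw [this]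
        funext i
        exact congrArg x.1 (by push_cast [Fin.val_succ]; ring)
      rw [List.ofFn_succ, e₀]
      simp [window]
    have hne := h.support x 0 (K + 1)
    rw [e1] at hne ⊢
    exact hmag.append_left hne
  have hzero : μ (⋂ K, B K) = 0 := by
    have hm : MeasurableSet (⋂ K, B K) := MeasurableSet.iInter hBm
    rcases (h.ergodic hX).ae_empty_or_univ_of_ae_le_preimage' hm.nullMeasurableSet
      (Eventually.of_forall hsub) (measure_ne_top _ _) with h0 | h1
    · exact ae_eq_empty.1 h0
    · exfalso
      obtain ⟨w₀, hw₀⟩ := exists_isMagicWord M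
      obtain ⟨b, hb, hle⟩ := h.exists_le_wordWeight
      have hpos : 0 < μ.real (cylinder X 0 w₀.get) := by
        rw [h.measure_cylinder, List.ofFn_get]
        refine lt_of_lt_of_le ?_ (hle w₀)
        rw [wordIndicator, if_pos hw₀.1, mul_one]
        exact div_pos hb (pow_pos h.lam_pos _)
      have hz : μ (cylinder X 0 w₀.get) = 0 := by
        refine measure_mono_null ?_ (ae_eq_univ.1 h1)
        intro x hx hx'
        have := Set.mem_iInter.1 hx' w₀.length
        refine this ?_
        rw [cylinder_eq_preimage] at hx
        rw [Set.mem_preimage.1 hx, List.ofFn_get]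
        exact hw₀
      rw [measureReal_def, hz] at hpos
      simp at hpos
  have hlim : Tendsto (fun K => μ.real (B K)) atTop (𝓝 0) := by
    have h1 := tendsto_measure_iInter_atTop (μ := μ) (fun K => (hBm K).nullMeasurableSet) hBanti
      ⟨0, measure_ne_top _ _⟩
    rw [hzero] at h1
    exact (ENNReal.tendsto_toReal ENNReal.zero_ne_top).comp h1
  obtain ⟨b, hb, hle⟩ := h.exists_le_wordWeight
  have hbound : ∀ K, nonMagicCount M K / lam ^ K ≤ b⁻¹ * μ.real (B K) := by
    intro K
    rw [measureReal_preimage_eq_sum (measurable_window 0 K), nonMagicCount, Finset.sum_div,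
      Finset.mul_sum]
    refine Finset.sum_le_sum fun y _ => ?_
    rw [← cylinder_eq_preimage, h.measure_cylinder]
    simp only [Set.mem_ofPred_eq]
    by_cases hy : IsMagicWord M (List.ofFn y)
    · simp [hy]
    · simp only [hy, if_false, not_false_eq_true, if_true]
      have := hle (List.ofFn y)
      rw [List.length_ofFn, mul_div_assoc] at this
      rwa [inv_mul_eq_div, le_div_iff₀ hb, mul_comm]
  refine squeeze_zero (fun K => ?_) hbound (by simpa using hlim.const_mul b⁻¹)
  refine div_nonneg (Finset.sum_nonneg fun y _ => ?_) (pow_nonneg h.lam_pos.le _)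
  split_ifs
  · exact le_rfl
  · exact wordIndicator_nonneg _ _

/-- Words are cut after K letters, and the continuations number at most a constant times λ^l. The
point is that the error does not depend on l and vanishes as K grows. -/
theorem ncard_blocks_approx (h : IsPerronPresentation X M lam u v p c μ) :
    ∃ D : ℝ, 0 < D ∧ ∀ K l : ℕ,
      |((blocks X (K + l)).ncard : ℝ) / lam ^ (K + l) -
        magicVector M K ⬝ᵥ ((lam⁻¹ • ∑ s, M s) ^ l *ᵥ 1) / lam ^ K| ≤
      D * (nonMagicCount M K / lam ^ K) := by
  have hlam := h.lam_pos
  obtain ⟨C, hC, hle⟩ := h.exists_sum_wordIndicator_le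
  refine ⟨C, hC, fun K l => ?_⟩
  have h1 := abs_sum_wordIndicator_sub_le h.partialMap K (fun b : Fin l → S => List.ofFn b)
  rw [sum_wordMatrix_ofFn] at h1
  have h2 := h1.trans (mul_le_mul_of_nonneg_left (hle l) (nonMagicCount_nonneg M K))
  rw [h.ncard_blocks, Fin.sum_append_univ]
  simp only [List.ofFn_fin_append]
  rw [smul_pow, Matrix.smul_mulVec, dotProduct_smul, smul_eq_mul, inv_pow]
  have h3 := div_le_div_of_nonneg_right h2 (pow_pos hlam (K + l)).le
  rw [← abs_of_pos (pow_pos hlam (K + l)), ← abs_div, abs_of_pos (pow_pos hlam (K + l)), sub_div]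
    at h3
  refine (le_of_eq ?_).trans (h3.trans (le_of_eq ?_))
  · congr 2
    rw [pow_add]
    field_simp
  · rw [pow_add]
    field_simp

/-- The same cut, with w placed k letters after the prefix. The vector paired with the matrices is
the one for the full block count, which makes the two counts comparable. -/
theorem ncard_blocksThrough_approx (h : IsPerronPresentation X M lam u v p c μ) {n : ℕ}
    (w : Fin n → S) :
    ∃ D : ℝ, 0 < D ∧ ∀ K k l : ℕ,
      |((blocksThrough X w (K + k) l).ncard : ℝ) / lam ^ (n + (K + k) + l) -
        magicVector M K ⬝ᵥ (((lam⁻¹ • ∑ s, M s) ^ k * ((lam ^ n)⁻¹ • wordMatrix M (List.ofFn w)) *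
          (lam⁻¹ • ∑ s, M s) ^ l) *ᵥ 1) / lam ^ K| ≤
      D * (nonMagicCount M K / lam ^ K) := by
  have hlam := h.lam_pos
  obtain ⟨C, hC, hle⟩ := h.exists_sum_wordIndicator_le
  refine ⟨C * C / lam ^ n, by positivity, fun K k l => ?_⟩
  have h1 := abs_sum_wordIndicator_sub_le h.partialMap K
    (fun q : (Fin k → S) × (Fin l → S) => List.ofFn q.1 ++ (List.ofFn w ++ List.ofFn q.2))
  have hsum : ∑ q : (Fin k → S) × (Fin l → S),
      wordMatrix M (List.ofFn q.1 ++ (List.ofFn w ++ List.ofFn q.2)) =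
      (∑ s, M s) ^ k * wordMatrix M (List.ofFn w) * (∑ s, M s) ^ l := by
    rw [Fintype.sum_prod_type]
    simp only [wordMatrix_append, ← Finset.mul_sum, ← Finset.sum_mul, sum_wordMatrix_ofFn, mul_assoc]
  have hcnt : ∑ q : (Fin k → S) × (Fin l → S),
      wordIndicator M (List.ofFn q.1 ++ (List.ofFn w ++ List.ofFn q.2)) ≤
      (C * lam ^ k) * (C * lam ^ l) := by
    rw [Fintype.sum_prod_type]
    refine le_trans ?_ (mul_le_mul (hle k) (hle l)
      (Finset.sum_nonneg fun _ _ => wordIndicator_nonneg _ _) (by positivity))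
    rw [Finset.sum_mul_sum]
    refine Finset.sum_le_sum fun a _ => Finset.sum_le_sum fun b _ => ?_
    refine (wordIndicator_append_le _ _).trans
      (mul_le_mul_of_nonneg_left ?_ (wordIndicator_nonneg _ _))
    refine (wordIndicator_append_le _ _).trans
      (mul_le_of_le_one_left (wordIndicator_nonneg _ _) ?_)
    rw [wordIndicator]
    split_ifs <;> simp
  rw [hsum] at h1
  have h2 := h1.trans (mul_le_mul_of_nonneg_left hcnt (nonMagicCount_nonneg M K))
  rw [h.ncard_blocksThrough, Fin.sum_append_univ]
  simp only [Fintype.sum_prod_type] at h2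
  simp only [List.ofFn_fin_append, List.append_assoc]
  have h3 := div_le_div_of_nonneg_right h2 (pow_pos hlam (n + (K + k) + l)).le
  rw [← abs_of_pos (pow_pos hlam (n + (K + k) + l)), ← abs_div,
    abs_of_pos (pow_pos hlam (n + (K + k) + l)), sub_div] at h3
  refine (le_of_eq ?_).trans (h3.trans (le_of_eq ?_))
  · congr 2
    simp only [smul_pow, Matrix.smul_mul, Matrix.mul_smul, Matrix.smul_mulVec, dotProduct_smul,
      smul_eq_mul, inv_pow, pow_add]
    field_simp
  · simp only [pow_add]
    field_simp

/-- For fixed K, averaging over windows relates the main terms of both counts, the factor being the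
mass t of w. The remaining error is a multiple of the proportion of non-magic prefixes. Thus K is
fixed first, and k, l go to infinity afterwards; the lower bound b λ^N on the number of words
permits the division. -/
theorem isNaturalMeasure [DiscreteMeasurableSpace S] (h : IsPerronPresentation X M lam u v p c μ)
    [NeZero p] (hX : Set.MapsTo (SymbolicDynamics.FullShift.shift (1 : ℤ)) X X) :
    IsNaturalMeasure X p μ := by
  refine ⟨h.isProbabilityMeasure, fun n w α => ?_⟩
  have hlam := h.lam_pos
  have hp : 0 < p := Nat.pos_of_ne_zero (NeZero.ne p)
  set Q := lam⁻¹ • ∑ s, M s with hQ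
  set W := (lam ^ n)⁻¹ • wordMatrix M (List.ofFn w) with hW
  set t := u ⬝ᵥ (W *ᵥ v) with ht
  have hμ : μ.real (cylinder X α w) = t := by
    rw [h.measure_cylinder, wordWeight, List.length_ofFn, ht, hW, Matrix.smul_mulVec,
      dotProduct_smul, smul_eq_mul, inv_mul_eq_div]
  have ht0 : 0 ≤ t := by
    rw [← hμ]
    exact measureReal_nonneg
  rw [hμ]
  have hWc : ∀ a b, W a b ≠ 0 → c b = c a + n := fun a b hab => by
    rw [hW, Matrix.smul_apply] at hab
    have := h.class_eq_of_wordMatrix_ne_zero _ a b (right_ne_zero_of_mul hab)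
    rwa [List.length_ofFn] at this
  obtain ⟨D₁, hD₁, happ₁⟩ := h.ncard_blocks_approx
  obtain ⟨D₂, hD₂, happ₂⟩ := h.ncard_blocksThrough_approx w
  obtain ⟨b, hb, hlow⟩ := h.exists_le_sum_wordIndicator
  -- The discrepancy of the main terms. The first K letters are spent on the prefix, hence the
  -- exponents k - K.
  let δ : ℕ → ℕ × ℕ → ℝ := fun K kl =>
    (1 / (p : ℝ)) * ∑ j ∈ Finset.range p,
        magicVector M K ⬝ᵥ ((Q ^ (kl.1 - K - j) * W * Q ^ (kl.2 + j)) *ᵥ 1) / lam ^ K -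
      t * (magicVector M K ⬝ᵥ (Q ^ (n + (kl.1 - K) + kl.2) *ᵥ 1) / lam ^ K)
  have hδ : ∀ K, Tendsto (δ K) (atTop ×ˢ atTop) (𝓝 0) := by
    intro K
    have hsub : Tendsto (fun kl : ℕ × ℕ => (kl.1 - K, kl.2)) (atTop ×ˢ atTop)
        (atTop ×ˢ atTop) :=
      ((tendsto_sub_atTop_nat K).comp tendsto_fst).prodMk tendsto_snd
    have hexp : ∀ B : Matrix V V ℝ, magicVector M K ⬝ᵥ (B *ᵥ 1) / lam ^ K =
        ∑ i, ∑ m, magicVector M K i / lam ^ K * B i m := by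
      intro B
      rw [dotProduct, Finset.sum_div]
      refine Finset.sum_congr rfl fun i _ => ?_
      rw [Matrix.mulVec, dotProduct, Finset.mul_sum, Finset.sum_div]
      exact Finset.sum_congr rfl fun m _ => by
        rw [Pi.one_apply]
        ring
    have h1 := tendsto_finsetSum (Finset.univ : Finset V) fun i _ =>
      tendsto_finsetSum (Finset.univ : Finset V) fun m _ =>
        (((h.chain.tendsto_average_window hWc i m).comp hsub).const_mul
          (magicVector M K i / lam ^ K))
    simp only [mul_zero, Finset.sum_const_zero, ← hQ, ← ht] at h1
    refine h1.congr fun kl => ?_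
    simp only [δ, Function.comp, hexp, mul_sub, Finset.sum_sub_distrib]
    congr 1
    · symm
      rw [Finset.sum_comm, Finset.mul_sum]
      refine Finset.sum_congr rfl fun i _ => ?_
      rw [Finset.sum_comm, Finset.mul_sum]
      refine Finset.sum_congr rfl fun m _ => ?_
      simp only [Finset.mul_sum]
      exact Finset.sum_congr rfl fun j _ => by ring
    · simp only [Finset.mul_sum]
      exact Finset.sum_congr rfl fun i _ => Finset.sum_congr rfl fun m _ => by ring
  have hmain : ∀ K, ∀ᶠ kl : ℕ × ℕ in atTop ×ˢ atTop,
      |(1 / (p : ℝ)) * ∑ j ∈ Finset.range p,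
        ((blocksThrough X w (kl.1 - j) (kl.2 + j)).ncard : ℝ) /
          ((blocks X (n + kl.1 + kl.2)).ncard : ℝ) - t| ≤
      (|δ K kl| + (D₂ + t * D₁) * (nonMagicCount M K / lam ^ K)) / b := by
    intro K
    -- Every window k - j with j < p must still contain the prefix of length K.
    have hev : ∀ᶠ kl : ℕ × ℕ in atTop ×ˢ atTop, K + p ≤ kl.1 :=
      (eventually_ge_atTop (K + p)).prod_inl _
    filter_upwards [hev] with kl hkl
    obtain ⟨k, l⟩ := kl
    simp only at hkl ⊢
    set N := n + k + l with hN
    have hB : b * lam ^ N ≤ ((blocks X N).ncard : ℝ) := by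
      rw [h.ncard_blocks]
      exact hlow N
    have hBpos : 0 < ((blocks X N).ncard : ℝ) := lt_of_lt_of_le (by positivity) hB
    have e1 : ∀ j ∈ Finset.range p,
        |((blocksThrough X w (k - j) (l + j)).ncard : ℝ) / lam ^ N -
          magicVector M K ⬝ᵥ ((Q ^ (k - K - j) * W * Q ^ (l + j)) *ᵥ 1) / lam ^ K| ≤
        D₂ * (nonMagicCount M K / lam ^ K) := by
      intro j hj
      have hj' := Finset.mem_range.1 hj
      have := happ₂ K (k - K - j) (l + j)
      rwa [show K + (k - K - j) = k - j by omega, show n + (k - j) + (l + j) = N by omega] at this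
    have e2 := happ₁ K (n + (k - K) + l)
    rw [show K + (n + (k - K) + l) = N by omega, ← hQ] at e2
    have hp' : (0 : ℝ) < p := by exact_mod_cast hp
    have e3 : |(1 / (p : ℝ)) * ∑ j ∈ Finset.range p,
          ((blocksThrough X w (k - j) (l + j)).ncard : ℝ) / lam ^ N -
        (1 / (p : ℝ)) * ∑ j ∈ Finset.range p,
          magicVector M K ⬝ᵥ ((Q ^ (k - K - j) * W * Q ^ (l + j)) *ᵥ 1) / lam ^ K| ≤
        D₂ * (nonMagicCount M K / lam ^ K) := by
      rw [← mul_sub, ← Finset.sum_sub_distrib, abs_mul, abs_of_pos (by positivity : 0 < 1 / (p : ℝ))]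
      calc _ ≤ 1 / (p : ℝ) * ∑ j ∈ Finset.range p, D₂ * (nonMagicCount M K / lam ^ K) := by
            gcongr
            exact (Finset.abs_sum_le_sum_abs _ _).trans (Finset.sum_le_sum e1)
        _ = _ := by
            rw [Finset.sum_const, Finset.card_range, nsmul_eq_mul]
            field_simp
    have e4 : |(1 / (p : ℝ)) * ∑ j ∈ Finset.range p,
          ((blocksThrough X w (k - j) (l + j)).ncard : ℝ) / lam ^ N -
        t * (((blocks X N).ncard : ℝ) / lam ^ N)| ≤
        |δ K (k, l)| + (D₂ + t * D₁) * (nonMagicCount M K / lam ^ K) := by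
      have e5 := mul_le_mul_of_nonneg_left e2 ht0
      rw [← abs_of_nonneg ht0, ← abs_mul, abs_of_nonneg ht0, mul_sub] at e5
      have e6 := le_abs_self (δ K (k, l))
      have e7 := neg_abs_le (δ K (k, l))
      simp only [δ] at e6 e7 ⊢
      rw [abs_le] at e3 e5 ⊢
      constructor <;> linarith [e3.1, e3.2, e5.1, e5.2]
    have e8 : (1 / (p : ℝ)) * ∑ j ∈ Finset.range p,
        ((blocksThrough X w (k - j) (l + j)).ncard : ℝ) / ((blocks X N).ncard : ℝ) - t =
        ((1 / (p : ℝ)) * ∑ j ∈ Finset.range p,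
          ((blocksThrough X w (k - j) (l + j)).ncard : ℝ) / lam ^ N -
        t * (((blocks X N).ncard : ℝ) / lam ^ N)) / (((blocks X N).ncard : ℝ) / lam ^ N) := by
      simp only [← Finset.sum_div]
      field_simp
    have e9 : b ≤ ((blocks X N).ncard : ℝ) / lam ^ N := (le_div_iff₀ (by positivity)).2 hB
    rw [e8, abs_div, abs_of_pos (hb.trans_le e9)]
    exact div_le_div₀ ((abs_nonneg _).trans e4) e4 hb e9
  rw [Metric.tendsto_nhds]
  intro ε hε
  obtain ⟨K, hK⟩ : ∃ K, (D₂ + t * D₁) * (nonMagicCount M K / lam ^ K) < b * ε / 2 := by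
    have h1 := (h.tendsto_nonMagicCount hX).const_mul (D₂ + t * D₁)
    rw [mul_zero] at h1
    exact (h1.eventually (gt_mem_nhds (by positivity : 0 < b * ε / 2))).exists
  have h2 := (hδ K).abs
  rw [abs_zero] at h2
  filter_upwards [hmain K, h2.eventually (gt_mem_nhds (by positivity : 0 < b * ε / 2))] with kl h3 h4
  rw [Real.dist_eq]
  refine h3.trans_lt ?_
  rw [div_lt_iff₀ hb]
  linarith

end IsPerronPresentation

end

noncomputable section

/-! ### Entropy of finite-valued maps -/

section FiniteEntropy

/-- The Gibbs inequality. -/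
theorem sum_negMulLog_le {ι : Type*} (s : Finset ι) {a q : ι → ℝ} (ha : ∀ i ∈ s, 0 ≤ a i)
    (hq : ∀ i ∈ s, 0 ≤ q i) (hsum : ∑ i ∈ s, q i ≤ ∑ i ∈ s, a i)
    (h : ∀ i ∈ s, a i ≠ 0 → q i ≠ 0) :
    ∑ i ∈ s, Real.negMulLog (a i) ≤ ∑ i ∈ s, -(a i * Real.log (q i)) := by
  have hterm : ∀ i ∈ s, Real.negMulLog (a i) ≤ -(a i * Real.log (q i)) + (q i - a i) := by
    intro i hi
    rcases (ha i hi).eq_or_lt with h0 | hpos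
    · simp [← h0, hq i hi]
    · have hqpos : 0 < q i := lt_of_le_of_ne (hq i hi) (h i hi hpos.ne').symm
      have h1 := Real.log_le_sub_one_of_pos (div_pos hqpos hpos)
      rw [Real.log_div hqpos.ne' hpos.ne'] at h1
      have h2 := mul_le_mul_of_nonneg_left h1 hpos.le
      rw [mul_sub, mul_sub, mul_one, mul_div_cancel₀ _ hpos.ne'] at h2
      rw [Real.negMulLog]
      linarith
  refine (Finset.sum_le_sum hterm).trans ?_
  rw [Finset.sum_add_distrib, Finset.sum_sub_distrib]
  linarith

variable {Ω ι κ : Type*} [MeasurableSpace Ω] [Fintype ι]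

/-- The entropy of the partition into the level sets of a finite-valued map. -/
def levelEntropy (m : Measure Ω) (f : Ω → ι) : ℝ := ∑ c, Real.negMulLog (m.real (f ⁻¹' {c}))

theorem levelEntropy_nonneg (m : Measure Ω) [IsProbabilityMeasure m] (f : Ω → ι) :
    0 ≤ levelEntropy m f :=
  Finset.sum_nonneg fun _ _ => Real.negMulLog_nonneg measureReal_nonneg measureReal_le_one

variable [MeasurableSpace ι] [DiscreteMeasurableSpace ι] {m : Measure Ω}
  [IsProbabilityMeasure m] {f : Ω → ι}

theorem sum_measureReal_preimage_eq_one (hf : Measurable f) : ∑ c, m.real (f ⁻¹' {c}) = 1 := by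
  have := sum_measureReal_preimage_singleton (μ := m) (Finset.univ : Finset ι) (f := f)
    fun y _ => hf (measurableSet_singleton y)
  simpa using this

theorem levelEntropy_le (hf : Measurable f) {q : ι → ℝ} (hq : ∀ i, 0 ≤ q i) (hsum : ∑ i, q i ≤ 1)
    (h : ∀ i, m.real (f ⁻¹' {i}) ≠ 0 → q i ≠ 0) :
    levelEntropy m f ≤ ∑ i, -(m.real (f ⁻¹' {i}) * Real.log (q i)) :=
  sum_negMulLog_le _ (fun _ _ => measureReal_nonneg) (fun i _ => hq i)
    (by rwa [sum_measureReal_preimage_eq_one hf]) fun i _ => h i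

theorem levelEntropy_le_log_card (hf : Measurable f) (s : Finset ι) (hs : ∀ x, f x ∈ s) :
    levelEntropy m f ≤ Real.log s.card := by
  classical
  have hne : s.Nonempty := by
    obtain ⟨x⟩ := m.nonempty_of_neZero
    exact ⟨f x, hs x⟩
  have hcard : (0 : ℝ) < s.card := by exact_mod_cast hne.card_pos
  have hmem : ∀ i, m.real (f ⁻¹' {i}) ≠ 0 → i ∈ s := by
    intro i hi
    by_contra h
    refine hi ?_
    have : f ⁻¹' {i} = ∅ := by
      ext x
      simp only [Set.mem_preimage, Set.mem_singleton_iff, Set.mem_empty_iff_false, iff_false]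
      rintro rfl
      exact h (hs x)
    rw [this, measureReal_empty]
  -- Gibbs inequality against the uniform distribution on s.
  refine (levelEntropy_le hf (q := fun i => if i ∈ s then (s.card : ℝ)⁻¹ else 0) (fun i => ?_) ?_
    fun i hi => ?_).trans ?_
  · split_ifs
    · exact inv_nonneg.2 hcard.le
    · exact le_rfl
  · rw [Finset.sum_ite_mem, Finset.univ_inter, Finset.sum_const, nsmul_eq_mul,
      mul_inv_cancel₀ hcard.ne']
  · rw [if_pos (hmem i hi)]
    exact inv_ne_zero hcard.ne'
  · refine le_of_eq ?_
    calc ∑ i, -(m.real (f ⁻¹' {i}) * Real.log (if i ∈ s then (s.card : ℝ)⁻¹ else 0))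
        = ∑ i, m.real (f ⁻¹' {i}) * Real.log s.card := by
          refine Finset.sum_congr rfl fun i _ => ?_
          by_cases hi : m.real (f ⁻¹' {i}) = 0
          · simp [hi]
          · rw [if_pos (hmem i hi), Real.log_inv]
            ring
      _ = Real.log s.card := by
          rw [← Finset.sum_mul, sum_measureReal_preimage_eq_one hf, one_mul]

variable [Fintype κ]

/-- Each atom of f lies in an atom of g ∘ f, whose larger measure has the smaller information. -/
theorem levelEntropy_comp_le (hf : Measurable f) (g : ι → κ) :
    levelEntropy m (g ∘ f) ≤ levelEntropy m f := by
  classical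
  have hsum : ∀ k, m.real ((g ∘ f) ⁻¹' {k}) =
      ∑ c, if g c = k then m.real (f ⁻¹' {c}) else 0 := by
    intro k
    rw [Set.preimage_comp, measureReal_preimage_eq_sum hf]
    simp
  calc levelEntropy m (g ∘ f)
      = ∑ k, ∑ c, (if g c = k then
          -(m.real (f ⁻¹' {c}) * Real.log (m.real ((g ∘ f) ⁻¹' {k}))) else 0) := by
        refine Finset.sum_congr rfl fun k _ => ?_
        rw [Real.negMulLog]
        conv_lhs => rw [hsum k]
        rw [neg_mul, Finset.sum_mul, ← Finset.sum_neg_distrib, ← hsum k]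
        refine Finset.sum_congr rfl fun c _ => ?_
        split_ifs <;> simp
    _ = ∑ c, -(m.real (f ⁻¹' {c}) * Real.log (m.real ((g ∘ f) ⁻¹' {g c}))) := by
        rw [Finset.sum_comm]
        simp
    _ ≤ levelEntropy m f := by
        refine Finset.sum_le_sum fun c _ => ?_
        rw [Real.negMulLog, neg_mul]
        refine neg_le_neg ?_
        rcases (measureReal_nonneg : 0 ≤ m.real (f ⁻¹' {c})).eq_or_lt with h0 | hpos
        · simp [← h0]
        · refine mul_le_mul_of_nonneg_left (Real.log_le_log hpos ?_) hpos.le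
          refine measureReal_mono ?_ (measure_ne_top _ _)
          rintro x rfl
          rfl

variable [MeasurableSpace κ] [DiscreteMeasurableSpace κ]

/-- Gibbs inequality of the joint distribution against the product of its marginals. -/
theorem levelEntropy_prodMk_le (hf : Measurable f) {g : Ω → κ} (hg : Measurable g) :
    levelEntropy m (fun x => (f x, g x)) ≤ levelEntropy m f + levelEntropy m g := by
  classical
  have hpre : ∀ c d, (fun x => (f x, g x)) ⁻¹' {(c, d)} = f ⁻¹' {c} ∩ g ⁻¹' {d} := by
    intro c d
    ext x
    simp
  have hle1 : ∀ c d, m.real (f ⁻¹' {c} ∩ g ⁻¹' {d}) ≤ m.real (f ⁻¹' {c}) := fun c d =>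
    measureReal_mono Set.inter_subset_left (measure_ne_top _ _)
  have hle2 : ∀ c d, m.real (f ⁻¹' {c} ∩ g ⁻¹' {d}) ≤ m.real (g ⁻¹' {d}) := fun c d =>
    measureReal_mono Set.inter_subset_right (measure_ne_top _ _)
  have hne : ∀ c d, m.real (f ⁻¹' {c} ∩ g ⁻¹' {d}) ≠ 0 →
      m.real (f ⁻¹' {c}) ≠ 0 ∧ m.real (g ⁻¹' {d}) ≠ 0 := by
    intro c d h
    have hpos := lt_of_le_of_ne measureReal_nonneg (Ne.symm h)
    exact ⟨(hpos.trans_le (hle1 c d)).ne', (hpos.trans_le (hle2 c d)).ne'⟩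
  refine (levelEntropy_le (hf.prodMk hg)
    (q := fun r => m.real (f ⁻¹' {r.1}) * m.real (g ⁻¹' {r.2}))
    (fun r => mul_nonneg measureReal_nonneg measureReal_nonneg) ?_ ?_).trans (le_of_eq ?_)
  · rw [Fintype.sum_prod_type]
    dsimp only
    rw [← Finset.sum_mul_sum, sum_measureReal_preimage_eq_one hf,
      sum_measureReal_preimage_eq_one hg, one_mul]
  · rintro ⟨c, d⟩ h
    rw [hpre] at h
    exact mul_ne_zero (hne c d h).1 (hne c d h).2
  · rw [Fintype.sum_prod_type]
    have hterm : ∀ c d, -(m.real ((fun x => (f x, g x)) ⁻¹' {(c, d)}) *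
        Real.log (m.real (f ⁻¹' {c}) * m.real (g ⁻¹' {d}))) =
        -(m.real (f ⁻¹' {c} ∩ g ⁻¹' {d}) * Real.log (m.real (f ⁻¹' {c}))) +
        -(m.real (f ⁻¹' {c} ∩ g ⁻¹' {d}) * Real.log (m.real (g ⁻¹' {d}))) := by
      intro c d
      rw [hpre]
      by_cases h : m.real (f ⁻¹' {c} ∩ g ⁻¹' {d}) = 0
      · simp [h]
      · rw [Real.log_mul (hne c d h).1 (hne c d h).2]
        ring
    simp only [hterm, Finset.sum_add_distrib]
    congr 1
    · refine Finset.sum_congr rfl fun c _ => ?_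
      rw [Finset.sum_neg_distrib, ← Finset.sum_mul, ← measureReal_eq_sum_inter hg, Real.negMulLog,
        neg_mul]
    · rw [Finset.sum_comm]
      refine Finset.sum_congr rfl fun d _ => ?_
      simp only [Set.inter_comm _ (g ⁻¹' {d})]
      rw [Finset.sum_neg_distrib, ← Finset.sum_mul, ← measureReal_eq_sum_inter hf, Real.negMulLog,
        neg_mul]

theorem levelEntropy_pi_le {n : ℕ} {F : Ω → Fin n → ι} (hF : Measurable F) :
    levelEntropy m F ≤ ∑ i, levelEntropy m fun x => F x i := by
  induction n with
  | zero =>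
    refine (levelEntropy_le_log_card hF Finset.univ fun _ => Finset.mem_univ _).trans ?_
    simp
  | succ n ih =>
    have h0 : Measurable fun x => F x 0 := (measurable_pi_apply 0).comp hF
    have h1 : Measurable fun x => fun i : Fin n => F x i.succ :=
      measurable_pi_lambda _ fun i => (measurable_pi_apply i.succ).comp hF
    have hcomp : F = (fun q : ι × (Fin n → ι) => (Fin.cons q.1 q.2 : Fin (n + 1) → ι)) ∘
        fun x => (F x 0, fun i : Fin n => F x i.succ) := by
      funext x i
      refine Fin.cases ?_ (fun i => ?_) i <;> simp
    rw [hcomp, Fin.sum_univ_succ]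
    refine (levelEntropy_comp_le (h0.prodMk h1) _).trans
      ((levelEntropy_prodMk_le h0 h1).trans ?_)
    simpa using ih h1

/-- A finite-valued map that is constant outside a set of small measure has small entropy. -/
theorem exists_levelEntropy_lt (o : ι) {η : ℝ} (hη : 0 < η) :
    ∃ ε : ℝ, 0 < ε ∧ ∀ D : Ω → ι, Measurable D → m.real {x | D x ≠ o} < ε →
      levelEntropy m D < η := by
  -- One more share than there are atoms makes the final inequality strict. The atom over o has
  -- measure near 1 and the others near 0, where `Real.negMulLog` is small.
  have hcard : (0 : ℝ) < Fintype.card ι + 1 := by positivity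
  have hη' : 0 < η / (Fintype.card ι + 1) := div_pos hη hcard
  have ev0 : ∀ᶠ x in 𝓝 (0 : ℝ), Real.negMulLog x < η / (Fintype.card ι + 1) :=
    Real.continuous_negMulLog.continuousAt.eventually (gt_mem_nhds (by simpa using hη'))
  have ev1 : ∀ᶠ x in 𝓝 (1 : ℝ), Real.negMulLog x < η / (Fintype.card ι + 1) :=
    Real.continuous_negMulLog.continuousAt.eventually (gt_mem_nhds (by simpa using hη'))
  obtain ⟨ε₀, hε₀, h0⟩ := Metric.eventually_nhds_iff.1 ev0
  obtain ⟨ε₁, hε₁, h1⟩ := Metric.eventually_nhds_iff.1 ev1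
  refine ⟨min ε₀ ε₁, lt_min hε₀ hε₁, fun D hD hlt => ?_⟩
  have hlt0 := hlt.trans_le (min_le_left _ _)
  have hlt1 := hlt.trans_le (min_le_right _ _)
  have hterm : ∀ c, Real.negMulLog (m.real (D ⁻¹' {c})) ≤ η / (Fintype.card ι + 1) := by
    intro c
    by_cases hc : c = o
    · subst hc
      refine (h1 ?_).le
      have hcompl : D ⁻¹' {c} = {x | D x ≠ c}ᶜ := by
        ext x
        simp
      have hm : MeasurableSet {x | D x ≠ c} := hD (measurableSet_singleton c).compl
      rw [hcompl, measureReal_compl hm, probReal_univ, Real.dist_eq, sub_sub_cancel_left,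
        abs_neg, abs_of_nonneg measureReal_nonneg]
      exact hlt1
    · refine (h0 ?_).le
      rw [Real.dist_eq, sub_zero, abs_of_nonneg measureReal_nonneg]
      refine (measureReal_mono ?_ (measure_ne_top _ _)).trans_lt hlt0
      rintro x rfl
      exact hc
  calc levelEntropy m D ≤ ∑ _c : ι, η / (Fintype.card ι + 1) :=
        Finset.sum_le_sum fun c _ => hterm c
    _ = Fintype.card ι * (η / (Fintype.card ι + 1)) := by
        rw [Finset.sum_const, Finset.card_univ, nsmul_eq_mul]
    _ < η := by
        rw [mul_div_assoc', div_lt_iff₀ hcard]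
        nlinarith

end FiniteEntropy

/-! ### Entropy of shift maps -/

namespace MeasurePreservingMap

variable {Ω : Type*} [MeasurableSpace Ω] {T : Ω → Ω} {m : Measure Ω}

theorem joinEntropy_eq {k : ℕ} (f : Ω → Fin k) (n : ℕ) :
    joinEntropy T m f n = levelEntropy m fun x (i : Fin n) => f (T^[i] x) := by
  refine Finset.sum_congr rfl fun c _ => ?_
  congr 2
  ext x
  simp [funext_iff]

theorem levelEntropy_comp_iterate {ι : Type*} [Fintype ι] [MeasurableSpace ι]
    [DiscreteMeasurableSpace ι] (hT : MeasurePreserving T m m) {f : Ω → ι} (hf : Measurable f)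
    (n : ℕ) : levelEntropy m (fun x => f (T^[n] x)) = levelEntropy m f := by
  refine Finset.sum_congr rfl fun c _ => ?_
  congr 1
  rw [measureReal_def, measureReal_def, ← (hT.iterate n).measure_preimage
    (hf (measurableSet_singleton c)).nullMeasurableSet]
  rfl

open Classical in
/-- Changing a finite-valued map on a small set changes the entropy of joins by little. -/
theorem joinEntropy_le_add [IsProbabilityMeasure m] (hT : MeasurePreserving T m m) {k : ℕ}
    {f g : Ω → Fin k} (hf : Measurable f) (hg : Measurable g) (n : ℕ) :
    joinEntropy T m f n ≤ joinEntropy T m g n +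
      n * levelEntropy m (fun x => if f x = g x then none else some (f x)) := by
  let : MeasurableSpace (Option (Fin k)) := ⊤
  have : DiscreteMeasurableSpace (Option (Fin k)) := ⟨fun _ => trivial⟩
  -- D is a correction: it records f only where f differs from g, so g and D together determine f.
  set D : Ω → Option (Fin k) := fun x => if f x = g x then none else some (f x) with hD
  have hDm : Measurable D :=
    (measurable_of_finite fun q : Fin k × Fin k => if q.1 = q.2 then none else some q.1).comp
      (hf.prodMk hg)
  have hgn : Measurable fun x (i : Fin n) => g (T^[i] x) :=
    measurable_pi_lambda _ fun i => hg.comp (hT.measurable.iterate i)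
  have hDn : Measurable fun x (i : Fin n) => D (T^[i] x) :=
    measurable_pi_lambda _ fun i => hDm.comp (hT.measurable.iterate i)
  have hcomp : (fun x (i : Fin n) => f (T^[i] x)) =
      (fun (q : (Fin n → Fin k) × (Fin n → Option (Fin k))) (i : Fin n) => (q.2 i).getD (q.1 i)) ∘
        fun x => ((fun i : Fin n => g (T^[i] x)), fun i : Fin n => D (T^[i] x)) := by
    funext x i
    simp only [hD, Function.comp]
    split_ifs with h <;> simp [h]
  rw [joinEntropy_eq, joinEntropy_eq, hcomp]
  refine (levelEntropy_comp_le (hgn.prodMk hDn) _).trans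
    ((levelEntropy_prodMk_le hgn hDn).trans (add_le_add le_rfl ?_))
  refine (levelEntropy_pi_le hDn).trans (le_of_eq ?_)
  simp only [levelEntropy_comp_iterate hT hDm]
  simp

end MeasurePreservingMap

namespace ShiftSpace

open MeasurePreservingMap

variable {S : Type*} [Fintype S] [MeasurableSpace S] [DiscreteMeasurableSpace S] {X : Set (ℤ → S)}
  {m : Measure X} [IsProbabilityMeasure m]
  {hX : Set.MapsTo (SymbolicDynamics.FullShift.shift (1 : ℤ)) X X}

/-- Measurable finite-valued maps on a shift space are approximated by block maps. -/
theorem exists_window_approx {k : ℕ} {f : X → Fin k} (hf : Measurable f) {ε : ℝ} (hε : 0 < ε) :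
    ∃ (r : ℕ) (g : (Fin (2 * r + 1) → S) → Fin k),
      m.real {x | f x ≠ g (window X (-(r : ℤ)) (2 * r + 1) x)} < ε := by
  classical
  obtain ⟨x₀⟩ := m.nonempty_of_neZero
  have hk : (0 : ℝ) < k := by exact_mod_cast (Nat.zero_le _).trans_lt (f x₀).2
  have happ : ∀ c : Fin k, ∃ B ∈ localSets X, m.real (symmDiff (f ⁻¹' {c}) B) < ε / k := by
    intro c
    obtain ⟨B, hB, hlt⟩ := (measureDense_localSets m).approx (f ⁻¹' {c})
      (hf (measurableSet_singleton c)) (measure_ne_top _ _) (ε / k) (div_pos hε hk)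
    refine ⟨B, hB, ?_⟩
    rw [measureReal_def]
    exact (ENNReal.toReal_lt_toReal (measure_ne_top _ _) ENNReal.ofReal_ne_top).2 hlt |>.trans_eq
      (ENNReal.toReal_ofReal (div_pos hε hk).le)
  choose B hB hlt using happ
  choose r₀ hr₀ using fun c => exists_eq_preimage_window (hB c)
  set r := ∑ c, r₀ c with hr
  have hW : ∀ c, ∃ W : Set (Fin (2 * r + 1) → S), B c = window X (-(r : ℤ)) (2 * r + 1) ⁻¹' W :=
    fun c => hr₀ c r (Finset.single_le_sum (fun _ _ => Nat.zero_le _) (Finset.mem_univ c))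
  choose W hW using hW
  -- Outside the symmetric differences the window lies in W c for c = f x only, so the choice is
  -- forced; the default value merely fills in the other windows.
  refine ⟨r, fun w => if h : ∃ c, w ∈ W c then h.choose else f x₀, ?_⟩
  have hsub : {x | f x ≠ (fun w => if h : ∃ c, w ∈ W c then h.choose else f x₀)
      (window X (-(r : ℤ)) (2 * r + 1) x)} ⊆ ⋃ c, symmDiff (f ⁻¹' {c}) (B c) := by
    intro x hx
    by_contra hnot
    simp only [Set.mem_iUnion, not_exists, Set.mem_symmDiff, Set.mem_preimage,
      Set.mem_singleton_iff, hW] at hnot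
    have hiff : ∀ c, f x = c ↔ window X (-(r : ℤ)) (2 * r + 1) x ∈ W c := fun c => by
      have := hnot c
      tauto
    have hex : ∃ c, window X (-(r : ℤ)) (2 * r + 1) x ∈ W c := ⟨f x, (hiff _).1 rfl⟩
    refine hx ?_
    simp only
    rw [dif_pos hex]
    exact (hiff _).2 hex.choose_spec
  calc _ ≤ m.real (⋃ c, symmDiff (f ⁻¹' {c}) (B c)) := measureReal_mono hsub (measure_ne_top _ _)
    _ ≤ ∑ c, m.real (symmDiff (f ⁻¹' {c}) (B c)) := measureReal_iUnion_fintype_le _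
    _ < ∑ _c : Fin k, ε / k :=
        Finset.sum_lt_sum_of_nonempty ⟨f x₀, Finset.mem_univ _⟩ fun c _ => hlt c
    _ = ε := by
        rw [Finset.sum_const, Finset.card_univ, Fintype.card_fin, nsmul_eq_mul]
        field_simp

omit [IsProbabilityMeasure m] in
theorem levelEntropy_window_add_nat (hm : MeasurePreserving (shiftMap X hX) m m) (α : ℤ) (n k : ℕ) :
    levelEntropy m (window X (α + n) k) = levelEntropy m (window X α k) := by
  rw [← levelEntropy_comp_iterate hm (measurable_window α k) n]
  simp only [window_shiftMap_iterate]

omit [IsProbabilityMeasure m] in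
theorem levelEntropy_window (hm : MeasurePreserving (shiftMap X hX) m m) (α : ℤ) (k : ℕ) :
    levelEntropy m (window X α k) = levelEntropy m (window X 0 k) := by
  rcases le_total 0 α with h | h
  · obtain ⟨n, rfl⟩ := Int.eq_ofNat_of_zero_le h
    simpa using levelEntropy_window_add_nat hm 0 n k
  · obtain ⟨n, hn⟩ := Int.exists_eq_neg_ofNat h
    rw [← levelEntropy_window_add_nat hm α n k, hn, neg_add_cancel]

theorem levelEntropy_window_add_le (hm : MeasurePreserving (shiftMap X hX) m m) (n k : ℕ) :
    levelEntropy m (window X 0 (n + k)) ≤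
      levelEntropy m (window X 0 n) + levelEntropy m (window X 0 k) := by
  have hcomp : window X 0 (n + k) = (fun q : (Fin n → S) × (Fin k → S) => Fin.append q.1 q.2) ∘
      fun x => (window X 0 n x, window X n k x) := by
    funext x i
    refine Fin.addCases (fun i => ?_) (fun i => ?_) i <;> simp [window]
  rw [hcomp, ← levelEntropy_window hm n k]
  exact (levelEntropy_comp_le ((measurable_window 0 n).prodMk (measurable_window n k)) _).trans
    (levelEntropy_prodMk_le (measurable_window 0 n) (measurable_window n k))

theorem levelEntropy_window_mul_le (hm : MeasurePreserving (shiftMap X hX) m m) (N q : ℕ) :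
    levelEntropy m (window X 0 (N * q)) ≤ q * levelEntropy m (window X 0 N) := by
  induction q with
  | zero =>
    refine (levelEntropy_le_log_card (measurable_window 0 _) Finset.univ
      fun _ => Finset.mem_univ _).trans ?_
    simp
  | succ q ih =>
    rw [mul_add, mul_one]
    refine (levelEntropy_window_add_le hm _ _).trans ?_
    push_cast
    linarith

/-- Reading a block of width 2r + 1 at n successive times uses n + 2r coordinates; the 2r extra ones
cost a constant. -/
theorem joinEntropy_window_le (hm : MeasurePreserving (shiftMap X hX) m m) {k : ℕ} (r n : ℕ)
    (g : (Fin (2 * r + 1) → S) → Fin k) :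
    joinEntropy (shiftMap X hX) m (fun x => g (window X (-(r : ℤ)) (2 * r + 1) x)) n ≤
      levelEntropy m (window X 0 n) + levelEntropy m (window X 0 (2 * r)) := by
  rw [joinEntropy_eq]
  have hcomp : (fun x (i : Fin n) =>
      g (window X (-(r : ℤ)) (2 * r + 1) ((shiftMap X hX)^[i] x))) =
      (fun (y : Fin (n + 2 * r) → S) (i : Fin n) => g fun j => y ⟨i + j, by omega⟩) ∘
        window X (-(r : ℤ)) (n + 2 * r) := by
    funext x i
    simp only [Function.comp, window_shiftMap_iterate]
    congr 1
    funext j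
    exact congrArg x.1 (by push_cast; ring)
  rw [hcomp]
  refine (levelEntropy_comp_le (measurable_window _ _) _).trans ?_
  rw [levelEntropy_window hm]
  exact levelEntropy_window_add_le hm n (2 * r)

/-- The entropy of an invariant measure is at most the growth rate of the entropies of windows. -/
theorem entropy_le (hm : MeasurePreserving (shiftMap X hX) m m) {h C : ℝ}
    (hle : ∀ n : ℕ, levelEntropy m (window X 0 n) ≤ n * h + C) :
    entropy (shiftMap X hX) m ≤ (h : EReal) := by
  refine iSup_le fun k => iSup_le fun f => iSup_le fun hf => ?_
  refine EReal.le_of_forall_lt_iff_le.1 fun z hz => ?_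
  have hz' : h < z := by exact_mod_cast hz
  -- One half pays for the entropy of the correction between f and its block approximation, the
  -- other for the constant divided by n.
  set η := (z - h) / 2 with hη
  have hηpos : 0 < η := by
    rw [hη]
    linarith
  let : MeasurableSpace (Option (Fin k)) := ⊤
  have : DiscreteMeasurableSpace (Option (Fin k)) := ⟨fun _ => trivial⟩
  obtain ⟨ε, hε, hsmall⟩ := exists_levelEntropy_lt (m := m) (none : Option (Fin k)) hηpos
  obtain ⟨r, g, hg⟩ := exists_window_approx (m := m) hf hε
  have hgm : Measurable fun x => g (window X (-(r : ℤ)) (2 * r + 1) x) :=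
    (measurable_of_finite g).comp (measurable_window _ _)
  classical
  have hDm : Measurable (fun x => if f x = g (window X (-(r : ℤ)) (2 * r + 1) x) then none
      else some (f x)) :=
    (measurable_of_finite fun q : Fin k × Fin k => if q.1 = q.2 then none else some q.1).comp
      (hf.prodMk hgm)
  have hD := hsmall _ hDm (by
    refine lt_of_eq_of_lt ?_ hg
    congr 1
    ext x
    simp)
  set C' := C + levelEntropy m (window X 0 (2 * r)) with hC'
  have hbound : ∀ n : ℕ, joinEntropy (shiftMap X hX) m f n ≤ n * (h + η) + C' := by
    intro n
    have h1 := joinEntropy_le_add hm hf hgm n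
    have h2 := joinEntropy_window_le hm r n g
    have h3 := mul_le_mul_of_nonneg_left hD.le (Nat.cast_nonneg n : (0 : ℝ) ≤ n)
    have h4 := hle n
    rw [hC', mul_add]
    linarith
  refine Filter.limsup_le_of_le (h := ?_)
  have hlim : Tendsto (fun n : ℕ => C' / n) atTop (𝓝 0) := tendsto_const_div_atTop_nhds_zero_nat C'
  filter_upwards [hlim.eventually (gt_mem_nhds hηpos), eventually_gt_atTop 0] with n hn hn0
  have hn0' : (0 : ℝ) < n := by exact_mod_cast hn0
  rw [EReal.coe_le_coe_iff, one_div, inv_mul_eq_div, div_le_iff₀ hn0']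
  rw [div_lt_iff₀ hn0'] at hn
  have hz2 : z = h + η + η := by
    rw [hη]
    ring
  rw [hz2]
  linarith [hbound n]

/-- The partition by the zeroth letter suffices, since its n-fold join is the partition into words
of length n. -/
theorem le_entropy {h C : ℝ} (hle : ∀ n : ℕ, n * h - C ≤ levelEntropy m (window X 0 n)) :
    (h : EReal) ≤ entropy (shiftMap X hX) m := by
  classical
  let e := Fintype.equivFin S
  have hf : Measurable fun x : X => e (x.1 0) :=
    (measurable_of_finite e).comp ((measurable_pi_apply 0).comp measurable_subtype_coe)
  have hjoin : ∀ n : ℕ, n * h - C ≤ joinEntropy (shiftMap X hX) m (fun x : X => e (x.1 0)) n := by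
    intro n
    refine (hle n).trans ?_
    rw [joinEntropy_eq]
    have hcomp : window X 0 n = (fun (y : Fin n → Fin (Fintype.card S)) (i : Fin n) => e.symm (y i)) ∘
        fun x (i : Fin n) => e (((shiftMap X hX)^[i] x).1 0) := by
      funext x i
      simp [window, shiftMap_iterate_apply]
    have hmeas : Measurable fun x (i : Fin n) => e (((shiftMap X hX)^[i] x).1 0) :=
      measurable_pi_lambda _ fun i => hf.comp ((measurable_shiftMap hX).iterate i)
    rw [hcomp]
    exact levelEntropy_comp_le hmeas _
  refine le_trans ?_ (le_iSup_of_le (Fintype.card S) (le_iSup_of_le (fun x : X => e (x.1 0))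
    (le_iSup_of_le hf le_rfl)))
  have hlim : Tendsto (fun n : ℕ => ((h - C / n : ℝ) : EReal)) atTop (𝓝 ((h : ℝ) : EReal)) := by
    refine (continuous_coe_real_ereal.tendsto _).comp ?_
    simpa using (tendsto_const_nhds (x := h)).sub (tendsto_const_div_atTop_nhds_zero_nat C)
  rw [← hlim.limsup_eq]
  refine Filter.limsup_le_limsup ?_
  filter_upwards [eventually_gt_atTop 0] with n hn
  have hn' : (0 : ℝ) < n := by exact_mod_cast hn
  rw [EReal.coe_le_coe_iff, one_div, inv_mul_eq_div, le_div_iff₀ hn', sub_mul,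
    div_mul_cancel₀ _ hn'.ne', mul_comm]
  exact hjoin n

/-- By subadditivity the entropy is at most H_N / N for every N, so a lower bound on the entropy
holds at each finite length without error term. The constant in the estimate absorbs the incomplete
last block. -/
theorem mul_le_levelEntropy_window_of_le_entropy (hm : MeasurePreserving (shiftMap X hX) m m)
    {h : ℝ} (hent : (h : EReal) ≤ entropy (shiftMap X hX) m) (N : ℕ) :
    N * h ≤ levelEntropy m (window X 0 N) := by
  rcases Nat.eq_zero_or_pos N with rfl | hN
  · simpa using levelEntropy_nonneg m _
  have hN' : (0 : ℝ) < N := by exact_mod_cast hN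
  have hH0 := levelEntropy_nonneg m (window X 0 N)
  have hle : ∀ n : ℕ, levelEntropy m (window X 0 n) ≤
      n * (levelEntropy m (window X 0 N) / N) +
        ∑ r ∈ Finset.range N, levelEntropy m (window X 0 r) := by
    intro n
    have h1 := levelEntropy_window_add_le hm (N * (n / N)) (n % N)
    rw [Nat.div_add_mod] at h1
    have h2 := levelEntropy_window_mul_le hm N (n / N)
    have h3 : levelEntropy m (window X 0 (n % N)) ≤
        ∑ r ∈ Finset.range N, levelEntropy m (window X 0 r) :=
      Finset.single_le_sum (f := fun r => levelEntropy m (window X 0 r))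
        (fun r _ => levelEntropy_nonneg m _) (Finset.mem_range.2 (Nat.mod_lt n hN))
    have h4 : ((n / N : ℕ) : ℝ) * levelEntropy m (window X 0 N) ≤
        n * (levelEntropy m (window X 0 N) / N) := by
      rw [mul_div_assoc', le_div_iff₀ hN', mul_right_comm]
      refine mul_le_mul_of_nonneg_right ?_ hH0
      exact_mod_cast Nat.div_mul_le_self n N
    linarith
  have := hent.trans (entropy_le hm hle)
  rw [EReal.coe_le_coe_iff, le_div_iff₀ hN'] at this
  linarith

end ShiftSpace

/-! ### The measure of maximal entropy -/

namespace IsPerronPresentation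

open ShiftSpace MeasurePreservingMap

variable {V S : Type*} [Fintype V] [DecidableEq V] [Fintype S] [MeasurableSpace S]
  {X : Set (ℤ → S)} {M : S → Matrix V V ℝ} {lam : ℝ} {u v : V → ℝ} {p : ℕ}
  {c : V → ZMod p} {μ : Measure X}

theorem topEntropy_eq (h : IsPerronPresentation X M lam u v p c μ) :
    topEntropy X = (Real.log lam : EReal) := by
  have hlam := h.lam_pos
  obtain ⟨C, hC, hup⟩ := h.exists_sum_wordIndicator_le
  obtain ⟨b, hb, hlow⟩ := h.exists_le_sum_wordIndicator
  have hlim : ∀ D : ℝ, Tendsto (fun n : ℕ => Real.log lam + D / n) atTop (𝓝 (Real.log lam)) :=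
    fun D => by
      simpa using (tendsto_const_nhds (x := Real.log lam)).add
        (tendsto_const_div_atTop_nhds_zero_nat D)
  have ht : Tendsto (fun n : ℕ => 1 / (n : ℝ) * Real.log ((blocks X n).ncard : ℝ)) atTop
      (𝓝 (Real.log lam)) := by
    refine tendsto_of_tendsto_of_tendsto_of_le_of_le' (hlim (Real.log b)) (hlim (Real.log C)) ?_ ?_
    · filter_upwards [eventually_gt_atTop 0] with n hn
      have hn' : (0 : ℝ) < n := by exact_mod_cast hn
      have h1 := hlow n
      rw [← h.ncard_blocks] at h1
      have h2 := Real.log_le_log (by positivity) h1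
      rw [Real.log_mul hb.ne' (pow_pos hlam n).ne', Real.log_pow] at h2
      rw [one_div, inv_mul_eq_div, le_div_iff₀ hn', add_mul, div_mul_cancel₀ _ hn'.ne']
      linarith
    · filter_upwards [eventually_gt_atTop 0] with n hn
      have hn' : (0 : ℝ) < n := by exact_mod_cast hn
      have h1 := hlow n
      have h0 : 0 < b * lam ^ n := by positivity
      have h3 := hup n
      rw [← h.ncard_blocks] at h1 h3
      have h2 := Real.log_le_log (h0.trans_le h1) h3
      rw [Real.log_mul hC.ne' (pow_pos hlam n).ne', Real.log_pow] at h2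
      rw [one_div, inv_mul_eq_div, div_le_iff₀ hn', add_mul, div_mul_cancel₀ _ hn'.ne']
      linarith
  exact ((continuous_coe_real_ereal.tendsto _).comp ht).limsup_eq

variable [DiscreteMeasurableSpace S]

/-- From above, the entropy of words is at most the logarithm of their number. From below, the upper
Gibbs bound gives each word of positive measure information at least n log λ - log C. -/
theorem entropy_eq (h : IsPerronPresentation X M lam u v p c μ)
    (hX : Set.MapsTo (SymbolicDynamics.FullShift.shift (1 : ℤ)) X X) :
    entropy (shiftMap X hX) μ = (Real.log lam : EReal) := by
  classical
  have := h.isProbabilityMeasure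
  have hlam := h.lam_pos
  refine le_antisymm ?_ ?_
  · obtain ⟨C, hC, hup⟩ := h.exists_sum_wordIndicator_le
    refine entropy_le (h.measurePreserving hX) (C := Real.log C) fun n => ?_
    have h1 := levelEntropy_le_log_card (m := μ) (measurable_window (X := X) 0 n)
      {w | wordMatrix M (List.ofFn w) ≠ 0} fun x => by simpa using h.support x 0 n
    have hcard : ((Finset.card {w : Fin n → S | wordMatrix M (List.ofFn w) ≠ 0} : ℕ) : ℝ) =
        ∑ w : Fin n → S, wordIndicator M (List.ofFn w) := by
      simp only [wordIndicator]
      rw [Finset.sum_boole]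
    rw [hcard] at h1
    obtain ⟨b, hb, hlow⟩ := h.exists_le_sum_wordIndicator
    have h0 : 0 < b * lam ^ n := by positivity
    have h2 := Real.log_le_log (h0.trans_le (hlow n)) (hup n)
    rw [Real.log_mul hC.ne' (pow_pos hlam n).ne', Real.log_pow] at h2
    linarith
  · obtain ⟨C, hC, hup⟩ := h.exists_wordWeight_le
    refine le_entropy (C := Real.log C) fun n => ?_
    have hterm : ∀ w : Fin n → S, μ.real (window X 0 n ⁻¹' {w}) * (n * Real.log lam - Real.log C) ≤
        Real.negMulLog (μ.real (window X 0 n ⁻¹' {w})) := by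
      intro w
      rcases (measureReal_nonneg : 0 ≤ μ.real (window X 0 n ⁻¹' {w})).eq_or_lt with h0 | hpos
      · simp [← h0]
      · rw [Real.negMulLog, neg_mul, ← mul_neg]
        refine mul_le_mul_of_nonneg_left ?_ hpos.le
        have h1 : μ.real (window X 0 n ⁻¹' {w}) ≤ C / lam ^ n := by
          rw [← cylinder_eq_preimage, h.measure_cylinder]
          have := hup (List.ofFn w)
          rw [List.length_ofFn] at this
          refine this.trans (div_le_div_of_nonneg_right ?_ (pow_pos hlam n).le)
          refine mul_le_of_le_one_right hC.le ?_
          rw [wordIndicator]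
          split_ifs <;> simp
        have h2 := Real.log_le_log hpos h1
        rw [Real.log_div hC.ne' (pow_pos hlam n).ne', Real.log_pow] at h2
        linarith
    have h3 := Finset.sum_le_sum fun w (_ : w ∈ (Finset.univ : Finset (Fin n → S))) => hterm w
    rwa [← Finset.sum_mul, sum_measureReal_preimage_eq_one (measurable_window 0 n), one_mul] at h3

/-- An invariant measure of maximal entropy is absolutely continuous with respect to the measure
with Perron weights. -/
theorem absolutelyContinuous (h : IsPerronPresentation X M lam u v p c μ)
    (hX : Set.MapsTo (SymbolicDynamics.FullShift.shift (1 : ℤ)) X X) {m : Measure X}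
    [IsProbabilityMeasure m] (hm : MeasurePreserving (shiftMap X hX) m m)
    (hent : ∀ n : ℕ, n * Real.log lam ≤ levelEntropy m (window X 0 n)) : m ≪ μ := by
  classical
  have := h.isProbabilityMeasure
  have hlam := h.lam_pos
  refine Measure.AbsolutelyContinuous.mk fun E hE hμE => ?_
  by_contra hmE
  set a := m.real E with ha
  have hapos : 0 < a := lt_of_le_of_ne measureReal_nonneg fun h0 =>
    hmE ((measureReal_eq_zero_iff (measure_ne_top _ _)).1 h0.symm)
  obtain ⟨b, hb, hlow⟩ := h.exists_le_wordWeight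
  -- Whatever ε is, the length n of the approximating window cancels from the estimate; letting ε
  -- tend to 0 then gives the contradiction.
  have hkey : ∀ ε : ℝ, 0 < ε → ε < 1 → 0 ≤ Real.log 2 - Real.log b + a / 2 * Real.log ε := by
    intro ε hε hε1
    -- Approximating for m + μ gives one local set that is small for μ and carries at least half of
    -- a for m.
    obtain ⟨B, hB, hlt⟩ := (measureDense_localSets (m + μ)).approx E hE (measure_ne_top _ _)
      (min ε (a / 2)) (by positivity)
    have hBm := measurableSet_of_mem_localSets hB
    have hlt' : m.real (symmDiff E B) + μ.real (symmDiff E B) < min ε (a / 2) := by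
      rw [← measureReal_add_apply]
      rw [measureReal_def]
      exact (ENNReal.toReal_lt_toReal (measure_ne_top _ _) ENNReal.ofReal_ne_top).2 hlt |>.trans_eq
        (ENNReal.toReal_ofReal (by positivity))
    have hm0 : 0 ≤ m.real (symmDiff E B) := measureReal_nonneg
    have hμ0 : 0 ≤ μ.real (symmDiff E B) := measureReal_nonneg
    have hμB : μ.real B ≤ ε := by
      have h1 := abs_measureReal_sub_le_measureReal_symmDiff (μ := μ) hE.nullMeasurableSet
        hBm.nullMeasurableSet
      have h2 : μ.real E = 0 := (measureReal_eq_zero_iff (measure_ne_top _ _)).2 hμE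
      rw [h2, abs_le] at h1
      linarith [h1.1, min_le_left ε (a / 2)]
    have hmB : a / 2 ≤ m.real B := by
      have h1 := abs_measureReal_sub_le_measureReal_symmDiff (μ := m) hE.nullMeasurableSet
        hBm.nullMeasurableSet
      rw [abs_le] at h1
      linarith [h1.2, min_le_right ε (a / 2)]
    obtain ⟨r₀, hr₀⟩ := exists_eq_preimage_window hB
    obtain ⟨n, W, rfl⟩ : ∃ (n : ℕ) (W : Set (Fin n → S)),
        B = window X (-(r₀ : ℤ)) n ⁻¹' W := ⟨_, hr₀ r₀ le_rfl⟩
    set f := window X (-(r₀ : ℤ)) n with hf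
    have hfm : Measurable f := measurable_window _ _
    have hH := hent n
    rw [← levelEntropy_window hm (-(r₀ : ℤ)) n] at hH
    have hweight : ∀ w, m.real (f ⁻¹' {w}) ≠ 0 → b / lam ^ n ≤ μ.real (f ⁻¹' {w}) := by
      intro w hw
      have hne : (f ⁻¹' {w}).Nonempty := by
        rw [Set.nonempty_iff_ne_empty]
        intro h0
        exact hw (by rw [h0, measureReal_empty])
      obtain ⟨x, hx⟩ := hne
      have hsupp := h.support x (-(r₀ : ℤ)) n
      rw [show window X (-(r₀ : ℤ)) n x = w from hx] at hsupp
      rw [hf, ← cylinder_eq_preimage, h.measure_cylinder]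
      have := hlow (List.ofFn w)
      rwa [wordIndicator, if_pos hsupp, mul_one, List.length_ofFn] at this
    -- The test weights are μ/2 off W and μ/(2ε) on W. Their total is at most 1 because μ(W) ≤ ε,
    -- and the tilt gains (a/2) log ε in the entropy bound.
    have hgibbs := levelEntropy_le (m := m) hfm
      (q := fun w => μ.real (f ⁻¹' {w}) * ((if w ∈ W then ε⁻¹ else 1) / 2))
      (fun w => mul_nonneg measureReal_nonneg (by split_ifs <;> positivity)) ?_ ?_
    · have hterm : ∀ w, -(m.real (f ⁻¹' {w}) *
          Real.log (μ.real (f ⁻¹' {w}) * ((if w ∈ W then ε⁻¹ else 1) / 2))) ≤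
          m.real (f ⁻¹' {w}) * (n * Real.log lam - Real.log b + Real.log 2) +
            (if w ∈ W then m.real (f ⁻¹' {w}) else 0) * Real.log ε := by
        intro w
        rcases (measureReal_nonneg : 0 ≤ m.real (f ⁻¹' {w})).eq_or_lt with h0 | hpos
        · simp [← h0]
        · have h1 := hweight w hpos.ne'
          have h2 : 0 < b / lam ^ n := by positivity
          have h3 := Real.log_le_log h2 h1
          rw [Real.log_div hb.ne' (pow_pos hlam n).ne', Real.log_pow] at h3
          have h4 := mul_le_mul_of_nonneg_left h3 hpos.le
          split_ifs with hw
          · rw [Real.log_mul (h2.trans_le h1).ne' (by positivity),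
              Real.log_div (inv_ne_zero hε.ne') two_ne_zero, Real.log_inv]
            linarith
          · rw [Real.log_mul (h2.trans_le h1).ne' (by norm_num),
              Real.log_div one_ne_zero two_ne_zero, Real.log_one]
            linarith
      have h5 := hgibbs.trans (Finset.sum_le_sum fun w _ => hterm w)
      rw [Finset.sum_add_distrib, ← Finset.sum_mul, ← Finset.sum_mul,
        sum_measureReal_preimage_eq_one hfm, one_mul, ← measureReal_preimage_eq_sum hfm W] at h5
      have h6 : m.real (f ⁻¹' W) * Real.log ε ≤ a / 2 * Real.log ε :=
        mul_le_mul_of_nonpos_right hmB (Real.log_nonpos hε.le hε1.le)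
      linarith
    · have h7 : ∀ w, μ.real (f ⁻¹' {w}) * ((if w ∈ W then ε⁻¹ else 1) / 2) ≤
          (if w ∈ W then μ.real (f ⁻¹' {w}) else 0) * (ε⁻¹ / 2) + μ.real (f ⁻¹' {w}) * (1 / 2) := by
        intro w
        have : 0 ≤ μ.real (f ⁻¹' {w}) := measureReal_nonneg
        split_ifs <;> linarith
      refine (Finset.sum_le_sum fun w _ => h7 w).trans ?_
      rw [Finset.sum_add_distrib, ← Finset.sum_mul, ← Finset.sum_mul,
        ← measureReal_preimage_eq_sum hfm W, sum_measureReal_preimage_eq_one hfm]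
      have h8 : μ.real (f ⁻¹' W) * (ε⁻¹ / 2) ≤ ε * (ε⁻¹ / 2) :=
        mul_le_mul_of_nonneg_right hμB (by positivity)
      have h9 : ε * (ε⁻¹ / 2) = 1 / 2 := by field_simp
      linarith
    · intro w hw
      have h1 := hweight w hw
      have h2 : 0 < b / lam ^ n := by positivity
      refine mul_ne_zero (h2.trans_le h1).ne' ?_
      split_ifs <;> positivity
  -- With ε = exp(-K) the right-hand side of `hkey` is at most -a/2.
  set K := |Real.log 2 - Real.log b| * 2 / a + 1 with hK
  have hKpos : 0 < K := by positivity
  have h1 := hkey (Real.exp (-K)) (Real.exp_pos _) (by rw [Real.exp_lt_one_iff]; linarith)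
  rw [Real.log_exp] at h1
  have h2 : a / 2 * K = |Real.log 2 - Real.log b| + a / 2 := by
    rw [hK]
    field_simp
  have h3 := le_abs_self (Real.log 2 - Real.log b)
  linarith

/-- The measure with Perron weights is the unique ergodic measure of maximal entropy. -/
theorem ergodic_and_entropy_eq_iff (h : IsPerronPresentation X M lam u v p c μ) [NeZero p]
    (hX : Set.MapsTo (SymbolicDynamics.FullShift.shift (1 : ℤ)) X X) (m : Measure X)
    [IsProbabilityMeasure m] :
    (Ergodic (shiftMap X hX) m ∧ entropy (shiftMap X hX) m = topEntropy X) ↔ m = μ := by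
  have := h.isProbabilityMeasure
  constructor
  · rintro ⟨herg, hent⟩
    have hm := herg.toMeasurePreserving
    rw [h.topEntropy_eq] at hent
    -- An invariant probability measure absolutely continuous with respect to an ergodic one
    -- coincides with it.
    exact (h.ergodic hX).eq_of_absolutelyContinuous hm (h.absolutelyContinuous hX hm
      (mul_le_levelEntropy_window_of_le_entropy hm hent.ge))
  · rintro rfl
    exact ⟨h.ergodic hX, by rw [h.entropy_eq hX, h.topEntropy_eq]⟩

end IsPerronPresentation

end

noncomputable section

namespace LabeledGraph

open PerronFrobenius ShiftSpace

/-! ### The Parry measure of the edge shift -/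

section Parry

variable {V E S : Type*} [Fintype V] [DecidableEq V] {G : LabeledGraph V E S}

/-- A product of matrix units is again a matrix unit if consecutive indices match and zero
otherwise; only paths have non-zero weight. -/
theorem wordMatrix_singleEdgeMatrix {n : ℕ} (w : Fin (n + 1) → E) :
    wordMatrix G.singleEdgeMatrix (List.ofFn w) =
      (∏ i : Fin n, G.edgeMatrix (w i.castSucc) (w i.succ)) •
        Matrix.single (G.src (w 0)) (G.tgt (w (Fin.last n))) 1 := by
  induction n with
  | zero => simp [singleEdgeMatrix]
  | succ n ih =>
    rw [List.ofFn_succ, wordMatrix_cons, ih, Fin.prod_univ_succ, Matrix.mul_smul, singleEdgeMatrix]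
    simp only [Fin.castSucc_zero, Fin.succ_castSucc, Fin.succ_last]
    by_cases h : G.tgt (w 0) = G.src (w (Fin.succ 0))
    · rw [h, Matrix.single_mul_single_same, edgeMatrix, if_pos h]
      simp
    · rw [Matrix.single_mul_single_of_ne _ _ _ _ h, edgeMatrix, if_neg h]
      simp

variable [Fintype E]

theorem adjMatrix_mulVec (b : V → ℝ) (i : V) :
    (G.adjMatrix *ᵥ b) i = ∑ e, if i = G.src e then b (G.tgt e) else 0 := by
  rw [adjMatrix_eq_sum, Matrix.sum_mulVec, Finset.sum_apply]
  refine Finset.sum_congr rfl fun e _ => ?_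
  simp only [Matrix.mulVec, dotProduct, singleEdgeMatrix, Matrix.single_apply]
  by_cases h : G.src e = i
  · simp [h]
  · simp [h, Ne.symm h]

theorem vecMul_adjMatrix (a : V → ℝ) (j : V) :
    (a ᵥ* G.adjMatrix) j = ∑ e, if G.tgt e = j then a (G.src e) else 0 := by
  rw [adjMatrix_eq_sum, Matrix.vecMul_sum, Finset.sum_apply]
  refine Finset.sum_congr rfl fun e _ => ?_
  simp only [Matrix.vecMul, dotProduct, singleEdgeMatrix, Matrix.single_apply]
  by_cases h : G.tgt e = j <;> simp [h]

/-- The Perron triple of the edge matrix induced by one of the adjacency matrix. -/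
theorem isPerronTriple_edgeMatrix [DecidableEq E] {lam : ℝ} {u v : V → ℝ} (hlam : 0 < lam)
    (hu : ∀ i, 0 < u i) (h : IsPerronTriple G.adjMatrix lam u v) :
    IsPerronTriple G.edgeMatrix lam (fun e => u (G.src e) / lam) (fun e => v (G.tgt e)) := by
  have hleft : (fun e => u (G.src e) / lam) ᵥ* G.edgeMatrix =
      lam • fun e => u (G.src e) / lam := by
    ext f
    have := congrFun h.left_eigen (G.src f)
    rw [vecMul_adjMatrix, Pi.smul_apply, smul_eq_mul] at this
    simp only [Matrix.vecMul, dotProduct, edgeMatrix, mul_ite, mul_one, mul_zero, Pi.smul_apply,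
      smul_eq_mul]
    rw [mul_div_assoc', ← this, Finset.sum_div]
    exact Finset.sum_congr rfl fun e _ => by split_ifs <;> simp
  refine ⟨hlam.le, norm_le_of_pos_left_eigenvector (fun e f => ?_)
    (fun e => div_pos (hu _) hlam) hleft, hleft, ?_, ?_⟩
  · rw [edgeMatrix]
    split_ifs <;> simp
  · ext e
    have := congrFun h.right_eigen (G.tgt e)
    rw [adjMatrix_mulVec, Pi.smul_apply, smul_eq_mul] at this
    simp only [Matrix.mulVec, dotProduct, edgeMatrix, ite_mul, one_mul, zero_mul, Pi.smul_apply,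
      smul_eq_mul]
    exact this
  -- Over the edges the products u(src) v(tgt) add up to u A v = λ, which is why the left
  -- eigenvector is divided by λ.
  · have h1 : u ⬝ᵥ (G.adjMatrix *ᵥ v) = lam := by
      rw [h.right_eigen, dotProduct_smul, h.normalized, smul_eq_mul, mul_one]
    have h2 : u ⬝ᵥ (G.adjMatrix *ᵥ v) = ∑ e, u (G.src e) * v (G.tgt e) := by
      simp only [dotProduct, adjMatrix_mulVec, Finset.mul_sum, mul_ite, mul_zero]
      rw [Finset.sum_comm]
      simp
    rw [h1] at h2
    simp only [dotProduct, div_mul_eq_mul_div, ← Finset.sum_div]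
    rw [← h2, div_self hlam.ne']

variable [DecidableEq E] [MeasurableSpace E] [DiscreteMeasurableSpace E]

omit [Fintype V] [DecidableEq V] in
theorem measurableSet_edgeShift : MeasurableSet G.edgeShift := by
  have : G.edgeShift = ⋂ n : ℤ, {ξ : ℤ → E | G.tgt (ξ n) = G.src (ξ (n + 1))} := by
    ext ξ
    simp [mem_edgeShift_iff]
  rw [this]
  refine MeasurableSet.iInter fun n => ?_
  have hm : Measurable fun ξ : ℤ → E => (ξ n, ξ (n + 1)) :=
    (measurable_pi_apply n).prodMk (measurable_pi_apply (n + 1))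
  exact hm (t := {q | G.tgt q.1 = G.src q.2}) (Set.toFinite _).measurableSet

/-- The weights of the edge words extend to a measure on the edge shift. -/
theorem exists_measure_edgeShift {lam : ℝ} {u v : V → ℝ} (hlam : 0 < lam) (hu : ∀ i, 0 < u i)
    (hv : ∀ i, 0 < v i) (h : IsPerronTriple G.adjMatrix lam u v) :
    ∃ ν : Measure G.edgeShift, IsProbabilityMeasure ν ∧
      ∀ (n : ℕ) (w : Fin n → E) (α : ℤ), ν.real (cylinder G.edgeShift α w) =
        wordWeight G.singleEdgeMatrix lam u v (List.ofFn w) := by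
  have hnn := wordWeight_nonneg (M := G.singleEdgeMatrix) singleEdgeMatrix_nonneg hlam hu hv
  obtain ⟨ν, hν, hcyl⟩ := exists_measure_fullCylinder hnn (wordWeight_nil h.normalized)
    (sum_wordWeight_append hlam.ne' (by rw [← adjMatrix_eq_sum]; exact h.right_eigen))
    (sum_wordWeight_cons hlam.ne' (by rw [← adjMatrix_eq_sum]; exact h.left_eigen))
  have hX : MeasurableSet G.edgeShift := measurableSet_edgeShift
  -- A sequence outside the edge shift contains a non-composable pair at some site, and these
  -- countably many cylinders have weight zero.
  have hnull : ν (G.edgeShift)ᶜ = 0 := by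
    have hsub : (G.edgeShift)ᶜ ⊆ ⋃ (n : ℤ) (q : {q : E × E // G.tgt q.1 ≠ G.src q.2}),
        {ξ : ℤ → E | ∀ i : Fin 2, ξ (n + i) = ![q.1.1, q.1.2] i} := by
      intro ξ hξ
      rw [Set.mem_compl_iff, mem_edgeShift_iff] at hξ
      push Not at hξ
      obtain ⟨n, hn⟩ := hξ
      refine Set.mem_iUnion.2 ⟨n, Set.mem_iUnion.2 ⟨⟨(ξ n, ξ (n + 1)), hn⟩, ?_⟩⟩
      simp [Fin.forall_fin_two]
    refine measure_mono_null hsub (measure_iUnion_null fun n => measure_iUnion_null fun q => ?_)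
    rw [hcyl 2, wordWeight, wordMatrix_singleEdgeMatrix]
    simp [edgeMatrix, q.2]
  have hemb := MeasurableEmbedding.subtype_coe hX
  have hfull : ν G.edgeShift = 1 := by
    rw [← prob_compl_eq_zero_iff hX]
    exact hnull
  refine ⟨ν.comap Subtype.val, ⟨?_⟩, fun n w α => ?_⟩
  · rw [hemb.comap_apply, Set.image_univ, Subtype.range_coe, hfull]
  · rw [measureReal_def, hemb.comap_apply]
    have : Subtype.val '' cylinder G.edgeShift α w =
        {x | ∀ i : Fin n, x (α + i) = w i} ∩ G.edgeShift := by
      ext x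
      simp only [ShiftSpace.cylinder, Set.mem_image, Subtype.exists, Set.mem_inter_iff, Set.mem_ofPred_eq]
      constructor
      · rintro ⟨y, hy, hyw, rfl⟩
        exact ⟨hyw, hy⟩
      · rintro ⟨h1, h2⟩
        exact ⟨x, h2, h1, rfl⟩
    rw [this, measure_inter_conull hnull, hcyl, ENNReal.toReal_ofReal (hnn _)]

omit [DiscreteMeasurableSpace E] in
-- A word of n + 1 edges has the weight factor λ^{-(n+1)}; one factor belongs to the left
-- eigenvector u/λ, leaving λ^{-n}.
theorem isParryMeasure {lam : ℝ} {u v : V → ℝ} (hlam : 0 < lam) (hu : ∀ i, 0 < u i)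
    (h : IsPerronTriple G.adjMatrix lam u v) {ν : Measure G.edgeShift} (hν : IsProbabilityMeasure ν)
    (hcyl : ∀ (n : ℕ) (w : Fin n → E) (α : ℤ), ν.real (cylinder G.edgeShift α w) =
      wordWeight G.singleEdgeMatrix lam u v (List.ofFn w)) :
    IsParryMeasure G.edgeMatrix ν := by
  refine ⟨hν, lam, _, _, isPerronTriple_edgeMatrix hlam hu h, fun n w α => ?_⟩
  refine (hcyl (n + 1) w α).trans ?_
  rw [wordWeight, wordMatrix_singleEdgeMatrix, List.length_ofFn, Matrix.smul_mulVec,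
    dotProduct_smul, smul_eq_mul]
  have : u ⬝ᵥ (Matrix.single (G.src (w 0)) (G.tgt (w (Fin.last n))) 1 *ᵥ v) =
      u (G.src (w 0)) * v (G.tgt (w (Fin.last n))) := by
    simp only [dotProduct, Matrix.mulVec, Matrix.single_apply]
    rw [Finset.sum_eq_single (G.src (w 0))]
    · simp
    · intro b _ hb
      simp [hb.symm]
    · simp
  rw [this, pow_succ]
  field_simp

end Parry

/-! ### The sofic shift -/

section Sofic

variable {V E S : Type*} [Fintype V] [DecidableEq V] [Fintype E] [DecidableEq E]
  {G : LabeledGraph V E S}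

/-- The walk itself exhibits a positive entry, so the words of the sofic shift have non-zero
matrices. -/
theorem wordMatrix_symbolMatrix_pos {ξ : ℤ → E} (hξ : ξ ∈ G.edgeShift) (n : ℕ) (α : ℤ) :
    0 < wordMatrix G.symbolMatrix (List.ofFn fun i : Fin n => G.label (ξ (α + i)))
      (G.src (ξ α)) (G.src (ξ (α + n))) := by
  rw [mem_edgeShift_iff] at hξ
  induction n generalizing α with
  | zero => simp
  | succ n ih =>
    rw [List.ofFn_succ, wordMatrix_cons, Matrix.mul_apply]
    refine Finset.sum_pos' (fun k _ => mul_nonneg (G.symbolMatrix_nonneg _ _ _)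
      (wordMatrix_nonneg G.symbolMatrix_nonneg _ _ _))
      ⟨G.src (ξ (α + 1)), Finset.mem_univ _, mul_pos ?_ ?_⟩
    · rw [symbolMatrix, if_pos ⟨ξ α, rfl, hξ α, by simp⟩]
      exact one_pos
    · have h1 : (fun i : Fin n => G.label (ξ (α + (i.succ : ℕ)))) =
          fun i : Fin n => G.label (ξ (α + 1 + i)) :=
        funext fun i => congrArg (fun z => G.label (ξ z)) (by push_cast [Fin.val_succ]; ring)
      have h2 : α + ((n + 1 : ℕ) : ℤ) = α + 1 + n := by
        push_cast
        ring
      rw [h1, h2]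
      exact ih (α + 1)

variable [MeasurableSpace E] [DiscreteMeasurableSpace E] [Fintype S] [MeasurableSpace S]
  [DiscreteMeasurableSpace S]

omit [Fintype V] [DecidableEq V] [Fintype S] [DiscreteMeasurableSpace S] in
theorem measurable_labelMap : Measurable G.labelMap := by
  have h : Measurable fun ξ : G.edgeShift => fun n : ℤ => G.label (ξ.1 n) :=
    measurable_pi_lambda _ fun n =>
      (measurable_of_finite G.label).comp ((measurable_pi_apply n).comp measurable_subtype_coe)
  exact h.subtype_mk

/-- A label cylinder pulls back to the disjoint union of the edge cylinders with these labels. By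
distributivity their matrices add up to the product of the symbol matrices. -/
theorem RightResolving.measureReal_map_labelMap_cylinder (hres : G.RightResolving) {lam : ℝ}
    {u v : V → ℝ} {ν : Measure G.edgeShift} [IsProbabilityMeasure ν]
    (hcyl : ∀ (n : ℕ) (w : Fin n → E) (α : ℤ), ν.real (cylinder G.edgeShift α w) =
      wordWeight G.singleEdgeMatrix lam u v (List.ofFn w)) (n : ℕ) (w : Fin n → S) (α : ℤ) :
    (ν.map G.labelMap).real (cylinder G.soficShift α w) =
      wordWeight G.symbolMatrix lam u v (List.ofFn w) := by
  classical
  have hpre : G.labelMap ⁻¹' cylinder G.soficShift α w =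
      window G.edgeShift α n ⁻¹' {x | ∀ i, G.label (x i) = w i} := by
    ext ξ
    rfl
  rw [map_measureReal_apply measurable_labelMap (measurableSet_cylinder α w), hpre,
    measureReal_preimage_eq_sum (measurable_window α n)]
  simp only [← cylinder_eq_preimage, hcyl, Set.mem_ofPred_eq]
  have hM : G.symbolMatrix = fun s => ∑ e, if G.label e = s then G.singleEdgeMatrix e else 0 :=
    funext hres.symbolMatrix_eq_sum
  rw [wordWeight, hM, ← sum_wordMatrix_fiber, Matrix.sum_mulVec, dotProduct_sum, Finset.sum_div]
  refine Finset.sum_congr rfl fun x _ => ?_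
  split_ifs
  · simp only [wordWeight, List.length_ofFn]
  · simp

omit [DecidableEq E] [MeasurableSpace E] [DiscreteMeasurableSpace E] [MeasurableSpace S]
  [DiscreteMeasurableSpace S] in
/-- A positive Perron triple and cyclic classes of the adjacency matrix make the normalized total
matrix a cyclic chain. -/
theorem RightResolving.isCyclicChain (hres : G.RightResolving) (hirr : G.Irreducible) {lam : ℝ}
    {u v : V → ℝ} (hlam : 0 < lam) (hu : ∀ i, 0 < u i) (hv : ∀ i, 0 < v i)
    (h : IsPerronTriple G.adjMatrix lam u v) {p : ℕ} {c : V → ZMod p}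
    (hc : ∀ i j, 0 < G.adjMatrix i j → c j = c i + 1)
    (hN : ∃ N : ℕ, ∀ n ≥ N, ∀ i j, c j = c i + n → 0 < (G.adjMatrix ^ n) i j) :
    IsCyclicChain (lam⁻¹ • ∑ s, G.symbolMatrix s) u v p c := by
  classical
  have hA : ∑ s, G.symbolMatrix s = G.adjMatrix := hres.totalMatrix_eq_adjMatrix
  rw [hA]
  refine ⟨fun i j => mul_nonneg (inv_nonneg.2 hlam.le) (hirr.nonneg i j), hu, hv, ?_, ?_,
    h.normalized, fun i j hij => hc i j ?_, ?_⟩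
  · rw [Matrix.vecMul_smul, h.left_eigen, smul_smul, inv_mul_cancel₀ hlam.ne', one_smul]
  · rw [Matrix.smul_mulVec, h.right_eigen, smul_smul, inv_mul_cancel₀ hlam.ne', one_smul]
  · exact lt_of_le_of_ne (hirr.nonneg i j) (right_ne_zero_of_mul hij).symm
  · obtain ⟨N, hN⟩ := hN
    refine ⟨N, fun n hn i j hij => ?_⟩
    rw [smul_pow]
    exact mul_pos (pow_pos (inv_pos.2 hlam) n) (hN n hn i j hij)

end Sofic

end LabeledGraph

end

/-! ### The natural measure of an irreducible right-resolving labeled graph -/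

theorem theorem1p2 {V E S : Type*}
    [Fintype V] [DecidableEq V] [Nonempty V]
    [Fintype E] [DecidableEq E] [MeasurableSpace E] [DiscreteMeasurableSpace E]
    [Fintype S] [MeasurableSpace S] [DiscreteMeasurableSpace S]
    (G : LabeledGraph V E S) (hirr : G.Irreducible) (hres : G.RightResolving) :
    ∃ μ : Measure G.soficShift,
      -- the natural measure exists (averaging over the period)
      ShiftSpace.IsNaturalMeasure G.soficShift (PerronFrobenius.period G.adjMatrix) μ ∧
      -- in the aperiodic case no averaging is needed
      (G.adjMatrix.IsPrimitive → ShiftSpace.IsNaturalMeasure G.soficShift 1 μ) ∧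
      -- the explicit formula
      (∃ (lam : ℝ) (u v : V → ℝ), PerronFrobenius.IsPerronTriple G.totalMatrix lam u v) ∧
      (∀ (lam : ℝ) (u v : V → ℝ), PerronFrobenius.IsPerronTriple G.totalMatrix lam u v →
        ∀ (n : ℕ) (w : Fin n → S) (α : ℤ),
          μ.real (ShiftSpace.cylinder G.soficShift α w) =
            (1 / lam ^ n) * ∑ i : V, ∑ j : V,
              u i * (List.ofFn fun t : Fin n => G.symbolMatrix (w t)).prod i j * v j) ∧
      -- it is the hidden Markov measure induced by the Parry measure of the edge shift
      (∃ ν : Measure G.edgeShift,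
        PerronFrobenius.IsParryMeasure G.edgeMatrix ν ∧ μ = ν.map G.labelMap) ∧
      -- it is the unique ergodic measure of maximal entropy
      (∀ m : Measure G.soficShift, IsProbabilityMeasure m →
        ((Ergodic G.soficMap m ∧
            MeasurePreservingMap.entropy G.soficMap m = ShiftSpace.topEntropy G.soficShift) ↔
          m = μ)) ∧
      -- it is strongly mixing if the graph is aperiodic
      (G.adjMatrix.IsPrimitive → MeasurePreservingMap.IsStrongMixing G.soficMap μ) := by
  classical
  have hA : G.totalMatrix = G.adjMatrix := hres.totalMatrix_eq_adjMatrix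
  have hirr' : G.adjMatrix.IsIrreducible := hirr
  obtain ⟨lam, u, v, hlam, hu, hv, htriple⟩ := PerronFrobenius.exists_pos_perronTriple hirr'
  obtain ⟨c, hc, hN⟩ := PerronFrobenius.exists_cyclicClass hirr'
  have : NeZero (PerronFrobenius.period G.adjMatrix) := ⟨(PerronFrobenius.period_pos hirr').ne'⟩
  obtain ⟨ν, hν, hcyl⟩ := LabeledGraph.exists_measure_edgeShift hlam hu hv htriple
  have hpres : IsPerronPresentation G.soficShift G.symbolMatrix lam u v
      (PerronFrobenius.period G.adjMatrix) c (ν.map G.labelMap) := by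
    refine ⟨hres.isPartialMapMatrix, hlam, hres.isCyclicChain hirr hlam hu hv htriple hc hN,
      Measure.isProbabilityMeasure_map LabeledGraph.measurable_labelMap.aemeasurable,
      hres.measureReal_map_labelMap_cylinder hcyl, ?_⟩
    rintro ⟨x, ξ, hξ, rfl⟩ α n h0
    have hpos := LabeledGraph.wordMatrix_symbolMatrix_pos hξ n α
    have h1 : wordMatrix G.symbolMatrix (List.ofFn fun i : Fin n => G.label (ξ (α + i))) = 0 := h0
    rw [h1] at hpos
    exact lt_irrefl _ hpos
  have hnat := hpres.isNaturalMeasure G.mapsTo_shift_soficShift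
  have hprob := hpres.isProbabilityMeasure
  refine ⟨ν.map G.labelMap, hnat, fun hprim => ?_, ⟨lam, u, v, by rwa [hA]⟩, ?_,
    ⟨ν, LabeledGraph.isParryMeasure hlam hu htriple hν hcyl, rfl⟩, fun m hm => ?_, fun hprim => ?_⟩
  · rwa [PerronFrobenius.period_eq_one_of_isPrimitive hprim] at hnat
  · intro lam' u' v' h' n w α
    rw [hA] at h'
    -- The given triple may differ from the positive one by reciprocal scalings, possibly negative,
    -- but the formula involves only the products u_i v_j.
    obtain ⟨rfl, huv⟩ := htriple.unique hirr' hu hv h'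
    rw [hpres.measure_cylinder, wordWeight, List.length_ofFn, one_div, inv_mul_eq_div, wordMatrix,
      List.map_ofFn]
    congr 1
    simp only [dotProduct, Matrix.mulVec, Finset.mul_sum]
    refine Finset.sum_congr rfl fun i _ => Finset.sum_congr rfl fun j _ => ?_
    rw [mul_left_comm, ← huv i j]
    simp only [Function.comp_def]
    ring
  · exact hpres.ergodic_and_entropy_eq_iff G.mapsTo_shift_soficShift m
  · refine isStrongMixing_of_isAveragedMixing_one
      (hpres.measurePreserving G.mapsTo_shift_soficShift) fun E F hE hF => ?_
    have := hpres.isAveragedMixing G.mapsTo_shift_soficShift hE hF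
    rwa [PerronFrobenius.period_eq_one_of_isPrimitive hprim] at this
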